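/- Let $S$ be a scheme, let $1\le r\le n$ be integers, and let $(E,\phi)$ be a symplectic bundle of rank $2n-2$ over $S$ (a vector bundle with a nondegenerate alternating bilinear form with values in $\mathcal O_S$). Let $(F,\psi)$ be the symplectic bundle of rank $2n$ $$F=\mathcal O_S\oplus E\oplus\mathcal O_S,\qquad \psi=\begin{pmatrix}0&0&1\\0&\phi&0\\-1&0&0\end{pmatrix},\qquad \psi\bigl((a,w,c),(a',w',c')\bigr)=ac'+\phi(w,w')-ca',$$ and let $\lambda\colon F\to\mathcal O_S$ be the projection onto the third factor, with kernel $\mathcal O_S\oplus E$. For a symplectic bundle $(V,\chi)$ over $S$ let $\mathrm{HGr}_S(s,V,\chi)$ be the quaternionic Grassmannian: the $S$-scheme with a tautological symplectic subbundle of rank $2s$ of the pullback of $V$, such that every symplectic subbundle of rank $2s$ of the pullback of $V$ to an $S$-scheme $T$ is the pullback of the tautological one along a unique $S$-morphism $T\to\mathrm{HGr}_S(s,V,\chi)$. An $\mathbb A^m$-bundle is a (Zariski-locally trivial) torsor under a vector bundle of rank $m$. The $S$-schemes $\mathrm{HGr}_S(r,F,\psi)$ and $\mathrm{HGr}_S(r-1,E,\phi)$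 exist. Let $\mathcal U_r$ and $\mathcal U_{r-1}$ be their tautological symplectic subbundles, of ranks $2r$ and $2r-2$. The set $N^+=\mathrm{HGr}_S(r,F,\psi)\cap \mathrm{Gr}_S(2r,\mathcal O_S\oplus E)$ of the points at which the fibre of $\mathcal U_r$ lies in $\ker\lambda$ is closed in $\mathrm{HGr}_S(r,F,\psi)$; let $Y$ be its open complement. There are morphisms over $S$ $$Y\xleftarrow{\,g_1\,}Y_1\xleftarrow{\,g_2\,}Y_2\xrightarrow{\,q\,}\mathrm{HGr}_S(r-1,E,\phi)$$ with $g_1$ an $\mathbb A^{2r-1}$-bundle, $g_2$ an $\mathbb A^{2r-2}$-bundle and $q$ an $\mathbb A^{4n-3}$-bundle, with the following properties. 1. $g_1^*\mathcal U_r$ has a tautological section $f_1$ with $\lambda(f_1)=1$: for every morphism $g\colon T\to Y$ over $S$ and every section $f'$ of $g^*\mathcal U_r$ with $\lambda(f')=1$ there is a unique lift $k\colon T\to Y_1$ of $g$ with $k^*f_1=f'$. 2. $g_2^*g_1^*\mathcal U_r$ has two tautological sections $e,f$, with $f=g_2^*f_1$, satisfying $$\lambda(f)=1,\qquad \lambda(e)=0,\qquad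 \psi(e,f)=1,$$ and such that for every morphism $g\colon T\to Y$ over $S$ and all sections $e',f'$ of $g^*\mathcal U_r$ satisfying these three conditions there is a unique lift $k\colon T\to Y_2$ of $g$ with $k^*e=e'$ and $k^*f=f'$. 3. Write $\pi\colon Y_2\to S$ for the projection and $e=(1-\phi(u,v),u,0)$, $f=(b,v,1)$ in $\pi^*F=\mathcal O_{Y_2}\oplus\pi^*E\oplus\mathcal O_{Y_2}$. Then $$\rho=\begin{pmatrix}1&v^\vee\phi&b\\0&1&v\\0&0&1\end{pmatrix}\begin{pmatrix}1&0&0\\u&1&0\\0&-u^\vee\phi&1\end{pmatrix}$$ (where $v^\vee\phi$ is the map $w\mapsto\phi(v,w)$, and similarly for $u$) is a symplectic automorphism of $\pi^*(F,\psi)$ with $\rho(1,0,0)=e$ and $\rho(0,0,1)=f$. 4. $\langle e,f\rangle$ and $\rho(q^*\mathcal U_{r-1})$ are symplectic subbundles of $\pi^*(F,\psi)$, of ranks $2$ and $2r-2$, and there is an orthogonal direct sum $$g_2^*g_1^*\mathcal U_r=\langle e,f\rangle\perp\rho(q^*\mathcal U_{r-1})\subset\pi^*F .$$ Equivalently, $\rho$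 maps $\mathcal O\oplus q^*\mathcal U_{r-1}\oplus\mathcal O\subset\pi^*F$, with the restriction of $\psi$, isometrically onto $g_2^*g_1^*\mathcal U_r$. -/

import Mathlib

open CategoryTheory AlgebraicGeometry Opposite

universe u

namespace SympGrass

noncomputable section

/-! ### Vector bundles on the big Zariski site

Vector bundles over `S` are finite locally free modules over the structure sheaf on the big Zariski
site of `S`-schemes. Such a module assigns to `t : T ⟶ S` the `Γ(T, 𝒪_T)`-module `Γ(T, t^*E)` of
sections of the pullback of the bundle. So the pullback of a bundle along `t` is simply its
restriction to schemes over `T`, and the elements of `E.obj T` are the sections of `t^*E`. -/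

/-- A presheaf of modules over the structure sheaf on the category of schemes over `S`. -/
structure ModulePresheaf (S : Scheme.{u}) where
  /-- The sections over `T ⟶ S`. -/
  obj : Over S → Type u
  [addCommGroup : ∀ T, AddCommGroup (obj T)]
  [module : ∀ T : Over S, Module Γ(T.left, ⊤) (obj T)]
  /-- The pullback of sections along a morphism of `S`-schemes. -/
  res : ∀ {T' T : Over S}, (T' ⟶ T) → obj T →+ obj T'
  res_id : ∀ (T : Over S) (x : obj T), res (𝟙 T) x = x
  res_comp : ∀ {T'' T' T : Over S} (k : T'' ⟶ T') (h : T' ⟶ T) (x : obj T),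
    res (k ≫ h) x = res k (res h x)
  res_smul : ∀ {T' T : Over S} (h : T' ⟶ T) (a : Γ(T.left, ⊤)) (x : obj T),
    res h (a • x) = h.left.appTop.hom a • res h x

attribute [instance] ModulePresheaf.addCommGroup ModulePresheaf.module

/-- An open subscheme of an `S`-scheme, as an `S`-scheme. -/
def openOver {S : Scheme.{u}} (T : Over S) (V : T.left.Opens) : Over S :=
  Over.mk (V.ι ≫ T.hom)

/-- The inclusion of an open subscheme, as a morphism of `S`-schemes. -/
def openIncl {S : Scheme.{u}} (T : Over S) (V : T.left.Opens) : openOver T V ⟶ T :=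
  Over.homMk V.ι rfl

/-- A point of an `S`-scheme, as the `S`-scheme given by the spectrum of its residue field. -/
def pointOver {S : Scheme.{u}} (T : Over S) (p : T.left) : Over S :=
  Over.mk (T.left.fromSpecResidueField p ≫ T.hom)

/-- The canonical morphism of `S`-schemes `Spec κ(p) ⟶ T` at a point `p`. -/
def pointIncl {S : Scheme.{u}} (T : Over S) (p : T.left) : pointOver T p ⟶ T :=
  Over.homMk (T.left.fromSpecResidueField p) rfl

namespace ModulePresheaf

variable {S : Scheme.{u}}

/-- The underlying presheaf of sets. -/
def toPresheaf (E : ModulePresheaf S) : (Over S)ᵒᵖ ⥤ Type u where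
  obj T := E.obj T.unop
  map h := ↾(E.res h.unop)
  map_id T := by
    ext x
    exact E.res_id _ x
  map_comp h k := by
    ext x
    exact E.res_comp _ _ x

/-- `E` is a vector bundle of rank `m` over `S`: a sheaf for the Zariski topology for which every
point of `S` has an open neighbourhood `V` with sections `b 1, …, b m` of `E` over `V` whose
pullbacks to every `T ⟶ V` form a basis of the sections of `E` over `T`. -/
structure IsVectorBundle (E : ModulePresheaf S) (m : ℕ) : Prop where
  isSheaf : Presieve.IsSheaf (Scheme.zariskiTopology.{u}.over S) E.toPresheaf
  exists_frame : ∀ p : S, ∃ V : S.Opens, p ∈ V ∧ ∃ b : Fin m → E.obj (Over.mk V.ι),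
    ∀ {T : Over S} (k : T ⟶ Over.mk V.ι),
      LinearIndependent Γ(T.left, ⊤) (fun i => E.res k (b i)) ∧
      Submodule.span Γ(T.left, ⊤) (Set.range fun i => E.res k (b i)) = ⊤

/-- An alternating bilinear form on `E` with values in the structure sheaf. -/
structure AltForm (E : ModulePresheaf S) where
  /-- The bilinear form on the sections over `T ⟶ S`. -/
  form : ∀ T : Over S, LinearMap.BilinForm Γ(T.left, ⊤) (E.obj T)
  res_form : ∀ {T' T : Over S} (h : T' ⟶ T) (x y : E.obj T),
    form T' (E.res h x) (E.res h y) = h.left.appTop.hom (form T x y)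
  alt : ∀ (T : Over S) (x : E.obj T), form T x x = 0

/-- The form is symplectic: the induced map from `E` to its dual is an isomorphism. For vector
bundles this is tested on affine schemes over `S`. -/
def AltForm.IsSymplectic {E : ModulePresheaf S} (φ : E.AltForm) : Prop :=
  ∀ T : Over S, IsAffine T.left →
    Function.Bijective (φ.form T : E.obj T → Module.Dual Γ(T.left, ⊤) (E.obj T))

/-- A symplectic subbundle of rank `m` of the pullback of `(E, φ)` to the `S`-scheme `T`. As
sections of the subbundle stay sections of `E` (injectively) after every base change, this is a
subbundle, not just a locally free subsheaf. -/
@[ext]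
structure SympSubbundle {E : ModulePresheaf S} (φ : E.AltForm) (m : ℕ) (T : Over S) where
  /-- The sections over `h : T' ⟶ T`, among all sections of the pullback of `E` to `T'`. -/
  sec : ∀ {T' : Over S}, (T' ⟶ T) → Submodule Γ(T'.left, ⊤) (E.obj T')
  res_mem : ∀ {T'' T' : Over S} (k : T'' ⟶ T') (h : T' ⟶ T) (x : E.obj T'),
    x ∈ sec h → E.res k x ∈ sec (k ≫ h)
  mem_of_locally_mem : ∀ {T' : Over S} (h : T' ⟶ T) (x : E.obj T'),
    (∀ p : T'.left, ∃ V : T'.left.Opens, p ∈ V ∧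
      E.res (openIncl T' V) x ∈ sec (openIncl T' V ≫ h)) → x ∈ sec h
  exists_frame : ∀ p : T.left, ∃ V : T.left.Opens, p ∈ V ∧
    ∃ b : Fin m → E.obj (openOver T V), ∀ {T' : Over S} (k : T' ⟶ openOver T V),
      LinearIndependent Γ(T'.left, ⊤) (fun i => E.res k (b i)) ∧
      Submodule.span Γ(T'.left, ⊤) (Set.range fun i => E.res k (b i)) = sec (k ≫ openIncl T V)
  isSymplectic : ∀ {T' : Over S} (h : T' ⟶ T), IsAffine T'.left →
    Function.Bijective
      ((φ.form T').restrict (sec h) : sec h → Module.Dual Γ(T'.left, ⊤) (sec h))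

/-- The `S`-scheme `H` with the symplectic subbundle `U` of rank `2 * r` of the pullback of
`(E, φ)` is the quaternionic Grassmannian `HGr_S(r, E, φ)` with its tautological symplectic
subbundle: every symplectic subbundle `W` of rank `2 * r` of the pullback of `(E, φ)` to an
`S`-scheme `T` is the pullback of `U` along a unique `S`-morphism `T ⟶ H`. -/
def IsHGr {E : ModulePresheaf S} (φ : E.AltForm) (r : ℕ) (H : Over S)
    (U : SympSubbundle φ (2 * r) H) : Prop :=
  ∀ (T : Over S) (W : SympSubbundle φ (2 * r) T), ∃! h : T ⟶ H,
    ∀ {T' : Over S} (k : T' ⟶ T), W.sec k = U.sec (k ≫ h)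

/-! ### The bundle `F = 𝒪 ⊕ E ⊕ 𝒪` -/

/-- The module `F = 𝒪 ⊕ E ⊕ 𝒪`. -/
def hyp (E : ModulePresheaf S) : ModulePresheaf S where
  obj T := Γ(T.left, ⊤) × E.obj T × Γ(T.left, ⊤)
  res h := AddMonoidHom.prodMap (h.left.appTop.hom : _ →+ _)
    (AddMonoidHom.prodMap (E.res h) (h.left.appTop.hom : _ →+ _))
  res_id T x := by
    obtain ⟨a, w, c⟩ := x
    simp [E.res_id]
  res_comp k h x := by
    obtain ⟨a, w, c⟩ := x
    change (((k ≫ h).left.appTop.hom a, E.res (k ≫ h) w, (k ≫ h).left.appTop.hom c) : _ × _ × _) =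
      (k.left.appTop.hom (h.left.appTop.hom a), E.res k (E.res h w),
        k.left.appTop.hom (h.left.appTop.hom c))
    rw [E.res_comp, Over.comp_left, Scheme.Hom.comp_appTop]
    rfl
  res_smul h a x := by
    obtain ⟨b, w, c⟩ := x
    simp [E.res_smul]

/-- For a bilinear form `B` on `M`, the form with matrix `[[0, 0, 1], [0, B, 0], [-1, 0, 0]]` on
`R ⊕ M ⊕ R`. -/
def hypBilin {R M : Type*} [CommRing R] [AddCommGroup M] [Module R M]
    (B : LinearMap.BilinForm R M) : LinearMap.BilinForm R (R × M × R) :=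
  LinearMap.mk₂ R (fun x y => x.1 * y.2.2 + B x.2.1 y.2.1 - x.2.2 * y.1)
    (fun x x' y => by simp; ring)
    (fun a x y => by simp; ring)
    (fun x y y' => by simp; ring)
    (fun a x y => by simp; ring)

/-- The form `ψ = [[0, 0, 1], [0, φ, 0], [-1, 0, 0]]` on `F = 𝒪 ⊕ E ⊕ 𝒪`. -/
def AltForm.hyp {E : ModulePresheaf S} (φ : E.AltForm) : E.hyp.AltForm where
  form T := hypBilin (φ.form T)
  res_form {T' T} h x y := by
    obtain ⟨a, w, c⟩ := x
    obtain ⟨a', w', c'⟩ := y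
    change h.left.appTop.hom a * h.left.appTop.hom c' + φ.form T' (E.res h w) (E.res h w') -
      h.left.appTop.hom c * h.left.appTop.hom a' =
      h.left.appTop.hom (a * c' + φ.form T w w' - c * a')
    rw [φ.res_form, map_sub, map_add, map_mul, map_mul]
  alt T x := by
    obtain ⟨a, w, c⟩ := x
    change a * c + φ.form T w w - c * a = 0
    rw [φ.alt]
    ring

/-- A section of `F` over `T`, from its three components. -/
def hyp.mk {E : ModulePresheaf S} {T : Over S} (a : Γ(T.left, ⊤)) (w : E.obj T)
    (c : Γ(T.left, ⊤)) : E.hyp.obj T :=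
  (a, w, c)

/-- The first component of a section of `F = 𝒪 ⊕ E ⊕ 𝒪`. -/
def hyp.fst {E : ModulePresheaf S} {T : Over S} (x : E.hyp.obj T) : Γ(T.left, ⊤) := x.1

/-- The second component of a section of `F = 𝒪 ⊕ E ⊕ 𝒪`. -/
def hyp.mid {E : ModulePresheaf S} {T : Over S} (x : E.hyp.obj T) : E.obj T := x.2.1

/-- The projection `lam : F ⟶ 𝒪` onto the third factor, with kernel `𝒪 ⊕ E`. -/
def hyp.lam {E : ModulePresheaf S} {T : Over S} (x : E.hyp.obj T) : Γ(T.left, ⊤) := x.2.2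

/-- The automorphism `ρ₊(v, b)` of `F` with matrix `[[1, v^∨ φ, b], [0, 1, v], [0, 0, 1]]`. -/
def rhoPlus {E : ModulePresheaf S} (φ : E.AltForm) {T : Over S} (v : E.obj T) (b : Γ(T.left, ⊤))
    (x : E.hyp.obj T) : E.hyp.obj T :=
  hyp.mk (hyp.fst x + φ.form T v (hyp.mid x) + b * hyp.lam x) (hyp.mid x + hyp.lam x • v)
    (hyp.lam x)

/-- The automorphism `ρ₋(u, s)` of `F` with matrix `[[1, 0, 0], [u, 1, 0], [s, -u^∨ φ, 1]]`. -/
def rhoMinus {E : ModulePresheaf S} (φ : E.AltForm) {T : Over S} (u : E.obj T) (s : Γ(T.left, ⊤))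
    (x : E.hyp.obj T) : E.hyp.obj T :=
  hyp.mk (hyp.fst x) (hyp.fst x • u + hyp.mid x)
    (s * hyp.fst x - φ.form T u (hyp.mid x) + hyp.lam x)

/-- For a submodule `W` of the sections of `E` over `T`, the submodule of sections of
`F = 𝒪 ⊕ E ⊕ 𝒪` with zero first and third component and second component in `W`. -/
def hyp.ofMid {E : ModulePresheaf S} {T : Over S} (W : Submodule Γ(T.left, ⊤) (E.obj T)) :
    Submodule Γ(T.left, ⊤) (E.hyp.obj T) :=
  Submodule.prod (⊥ : Submodule Γ(T.left, ⊤) Γ(T.left, ⊤))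
    (Submodule.prod W (⊥ : Submodule Γ(T.left, ⊤) Γ(T.left, ⊤)))

/-- For a submodule `W` of the sections of `E` over `T`, the submodule `𝒪 ⊕ W ⊕ 𝒪`. -/
def hyp.ofHyp {E : ModulePresheaf S} {T : Over S} (W : Submodule Γ(T.left, ⊤) (E.obj T)) :
    Submodule Γ(T.left, ⊤) (E.hyp.obj T) :=
  Submodule.prod (⊤ : Submodule Γ(T.left, ⊤) Γ(T.left, ⊤))
    (Submodule.prod W (⊤ : Submodule Γ(T.left, ⊤) Γ(T.left, ⊤)))

/-- The closed subset `N⁺` of `H = HGr_S(r, F, ψ)` underlying the intersection with the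
Grassmannian of `𝒪 ⊕ E`: the points at which the fibre of the tautological bundle `U` lies in
`𝒪 ⊕ E = ker lam`. -/
def Nplus {E : ModulePresheaf S} {φ : E.AltForm} {m : ℕ} {H : Over S}
    (U : SympSubbundle φ.hyp m H) : Set H.left :=
  {p | ∀ x ∈ U.sec (pointIncl H p), hyp.lam x = 0}

/-- A symplectic automorphism of the pullback of `(E, φ)` to the `S`-scheme `T`. -/
structure SympAut {E : ModulePresheaf S} (φ : E.AltForm) (T : Over S) where
  /-- The automorphism on sections over `h : T' ⟶ T`. -/
  app : ∀ {T' : Over S}, (T' ⟶ T) → (E.obj T' ≃ₗ[Γ(T'.left, ⊤)] E.obj T')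
  res_app : ∀ {T'' T' : Over S} (k : T'' ⟶ T') (h : T' ⟶ T) (x : E.obj T'),
    E.res k (app h x) = app (k ≫ h) (E.res k x)
  form_app : ∀ {T' : Over S} (h : T' ⟶ T) (x y : E.obj T'),
    φ.form T' (app h x) (app h y) = φ.form T' x y

/-- The pullback of `U` along `h₀` is the orthogonal direct sum of the symplectic subbundles `A` and `B`. -/
def SympSubbundle.IsOrthogonalSum {E : ModulePresheaf S} {φ : E.AltForm} {m a b : ℕ}
    {T T₀ : Over S} (h₀ : T ⟶ T₀) (U : SympSubbundle φ m T₀) (A : SympSubbundle φ a T)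
    (B : SympSubbundle φ b T) : Prop :=
  ∀ {T' : Over S} (h : T' ⟶ T),
    A.sec h ⊔ B.sec h = U.sec (h ≫ h₀) ∧ Disjoint (A.sec h) (B.sec h) ∧
    ∀ x ∈ A.sec h, ∀ y ∈ B.sec h, φ.form T' x y = 0

end ModulePresheaf

/-! ### Affine bundles -/

/-- The structure of a torsor under the vector bundle `V` over `X` on a morphism `p : P ⟶ X`: the
sections of `V` over every `T ⟶ X` act on the `X`-morphisms `T ⟶ P`, naturally in `T` and simply
transitively, and `p` has sections locally on `X` for the Zariski topology. -/
structure BundleTorsor {X P : Scheme.{u}} (V : ModulePresheaf X) (p : P ⟶ X) where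
  /-- The action by translations. -/
  act : ∀ {T : Over X}, V.obj T → (T ⟶ Over.mk p) → (T ⟶ Over.mk p)
  zero_act : ∀ {T : Over X} (s : T ⟶ Over.mk p), act 0 s = s
  add_act : ∀ {T : Over X} (v w : V.obj T) (s : T ⟶ Over.mk p), act (v + w) s = act v (act w s)
  res_act : ∀ {T' T : Over X} (h : T' ⟶ T) (v : V.obj T) (s : T ⟶ Over.mk p),
    act (V.res h v) (h ≫ s) = h ≫ act v s
  existsUnique_act : ∀ {T : Over X} (s s' : T ⟶ Over.mk p), ∃! v : V.obj T, act v s = s'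
  exists_section : ∀ x : X, ∃ W : X.Opens, x ∈ W ∧ Nonempty (Over.mk W.ι ⟶ Over.mk p)

/-- `p : P ⟶ X` is an `𝔸^m`-bundle: a torsor under a vector bundle of rank `m` over `X`. In
particular it is, locally on `X` for the Zariski topology, isomorphic to `X × 𝔸^m`. -/
def IsAffineBundle {X P : Scheme.{u}} (p : P ⟶ X) (m : ℕ) : Prop :=
  ∃ V : ModulePresheaf X, V.IsVectorBundle m ∧ Nonempty (BundleTorsor V p)

end

end SympGrass

/-!
Everything is expressed through functors of points. Modules, subbundles and morphisms of
`S`-schemes are sheaves on the big Zariski site of `S`, whose sheaf condition is unique gluing over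
covers by open subschemes (`isSheaf_over_iff`). Schemes are obtained from the criterion that a
sheaf covered by representable open subsheaves is representable (`exists_representing`).

*Grassmannians.* A subbundle is symplectic if and only if its local frames have invertible Gram
matrices (`SympSubbundle.isUnit_gram`, `SympSubbundle.ofGram`), so symplectic subbundles form a
sheaf (`isSheaf_sympPresheaf`). Given a frame of `E` over an open subset of `S` and `m` of its
members, the subbundles that project isomorphically to the span of these are the column spaces of
matrices with an identity block. Those among them that are symplectic form the open subscheme of an
affine space where the Gram determinant is invertible. These charts cover, since over a residue
field a matrix of full column rank has a nonzero maximal minor (`exists_representing_symp`).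

*The two bundles over `Y`.* A torsor under a subbundle `K`, given by cosets of `K` in the sections
of an ambient bundle, is representable, and the representing scheme is an affine bundle
(`IsCoset.exists_representing`, `IsCoset.isAffineBundle`). The kernel of a functional on a bundle of
rank `m + 1` that locally takes the value `1` is a bundle of rank `m` (`IsSubbundle.ker`), so the
sections where the functional is `1` form an `𝔸^m`-bundle. Off `N⁺` some section of `U_r` has an
invertible third component near every point, and conversely; this shows that `Y` is open and gives
`Y₁` from the functional `λ` on `U_r`. Next, `Y₂` comes from the functional `ψ(·, f)` on
`ker λ ∩ U_r`. It takes the value `1` locally: the section `e` of `U_r` that represents `λ`, which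
exists as `U_r` is symplectic, satisfies `λ(e) = ψ(e, e) = 0` and `ψ(e, f) = λ(f) = 1`
(`SympSubbundle.exists_partner`, `exists_pairBundles`).

*The morphism `q`.* The matrix `ρ` is a product of two isometries and maps `(1, 0, 0)` and
`(0, 0, 1)` to `e` and `f`. So `ρ⁻¹(U_r)` contains these two vectors and is of the form
`𝒪 ⊕ W ⊕ 𝒪`, where `W` is symplectic of rank `2r - 2` (`SympSubbundle.exists_eq_map_ofHyp`); it
defines `q`. The orthogonal decomposition of `𝒪 ⊕ W ⊕ 𝒪` is transported along `ρ`
(`isOrthogonalSum_rhoPair`). Conversely, `W` and arbitrary `u`, `v` and `b` determine `ρ`, hence the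
pair `e = (1 - φ(u, v), u, 0)`, `f = (b, v, 1)` and the bundle `ρ(𝒪 ⊕ W ⊕ 𝒪)`, that is, a point of
`Y₂`. So `Y₂` is the trivial torsor under `E ⊕ E ⊕ 𝒪` over the smaller Grassmannian, and the rank of
this bundle is `2(2n - 2) + 1 = 4n - 3` (`isAffineBundle_of_pair`).
-/

namespace SympGrass

universe w

/-! ### Zariski sheaves on schemes over a base, tested on open covers -/

section Sheaves

variable {S : Scheme.{u}}

/-- Morphisms whose image lies in that of an open immersion factor through it. -/
lemma exists_lift_of_isOpenImmersion {D T T' : Over S} (j : D ⟶ T) [IsOpenImmersion j.left]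
    (g : T' ⟶ T) (h : ∀ t : T'.left, g.left t ∈ Set.range j.left) :
    ∃ g' : T' ⟶ D, g' ≫ j = g := by
  have h' : Set.range g.left ⊆ Set.range j.left := Set.range_subset_iff.mpr h
  refine ⟨Over.homMk (IsOpenImmersion.lift j.left g.left h') ?_, ?_⟩
  · rw [← Over.w j, IsOpenImmersion.lift_fac_assoc, Over.w]
  · ext1
    exact IsOpenImmersion.lift_fac _ _ h'

instance isOpenImmersion_openIncl_left (T : Over S) (V : T.left.Opens) :
    IsOpenImmersion (openIncl T V).left :=
  inferInstanceAs (IsOpenImmersion V.ι)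

lemma range_openIncl_left (T : Over S) (V : T.left.Opens) :
    Set.range (openIncl T V).left = V :=
  V.range_ι

lemma exists_lift_openIncl {T T' : Over S} (V : T.left.Opens) (g : T' ⟶ T)
    (h : ∀ t : T'.left, g.left t ∈ V) : ∃ g' : T' ⟶ openOver T V, g' ≫ openIncl T V = g :=
  exists_lift_of_isOpenImmersion (openIncl T V) g fun t => by
    rw [range_openIncl_left]
    exact h t

lemma openIncl_left_mem {T : Over S} {V : T.left.Opens} (t : (openOver T V).left) :
    (openIncl T V).left t ∈ V := by
  have := Set.mem_range_self (f := (openIncl T V).left) t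
  rwa [range_openIncl_left] at this

lemma exists_openIncl_left_eq {T : Over S} {V : T.left.Opens} {t : T.left} (h : t ∈ V) :
    ∃ t' : (openOver T V).left, (openIncl T V).left t' = t := by
  have : t ∈ Set.range (openIncl T V).left := by
    rwa [range_openIncl_left]
  exact this

lemma mono_of_isOpenImmersion {D T : Over S} (j : D ⟶ T) [IsOpenImmersion j.left] : Mono j :=
  Over.mono_of_mono_left j

instance mono_openIncl (T : Over S) (V : T.left.Opens) : Mono (openIncl T V) :=
  mono_of_isOpenImmersion _

/-- The preimage of an open subset under the morphism `h`. -/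
abbrev preOpen {T' T : Over S} (h : T' ⟶ T) (V : T.left.Opens) : T'.left.Opens := h.left ⁻¹ᵁ V

/-- The morphism from the preimage of an open subscheme to that open subscheme. -/
noncomputable def preIncl {T' T : Over S} (h : T' ⟶ T) (V : T.left.Opens) :
    openOver T' (preOpen h V) ⟶ openOver T V :=
  (exists_lift_openIncl V (openIncl T' (preOpen h V) ≫ h) fun t => openIncl_left_mem t).choose

lemma preIncl_openIncl {T' T : Over S} (h : T' ⟶ T) (V : T.left.Opens) :
    preIncl h V ≫ openIncl T V = openIncl T' (preOpen h V) ≫ h :=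
  (exists_lift_openIncl V (openIncl T' (preOpen h V) ≫ h) fun t => openIncl_left_mem t).choose_spec

/-- A covering sieve contains the inclusion of an open neighbourhood of every point. -/
lemma exists_openIncl_mem {T : Over S} {R : Sieve T}
    (hR : R ∈ (Scheme.zariskiTopology.{u}.over S) T) (p : T.left) :
    ∃ V : T.left.Opens, p ∈ V ∧ R (openIncl T V) := by
  rw [GrothendieckTopology.mem_over_iff] at hR
  obtain ⟨𝓤, h𝓤⟩ := Scheme.mem_grothendieckTopology_iff.mp hR
  obtain ⟨i, y, hy⟩ := 𝓤.exists_eq p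
  have : IsOpenImmersion (𝓤.f i) := 𝓤.map_prop i
  have hi : Sieve.overEquiv T R (𝓤.f i) := h𝓤 _ _ (Presieve.ofArrows.mk i)
  rw [Sieve.overEquiv_iff] at hi
  refine ⟨(𝓤.f i).opensRange, ⟨y, hy⟩, ?_⟩
  let j : Over.mk (𝓤.f i ≫ T.hom) ⟶ T := Over.homMk (𝓤.f i)
  have : IsOpenImmersion j.left := this
  obtain ⟨g, hg⟩ := exists_lift_of_isOpenImmersion j (openIncl T (𝓤.f i).opensRange) fun t =>
    openIncl_left_mem t
  rw [← hg]
  exact R.downward_closed hi g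

/-- An open cover generates a covering sieve. -/
lemma ofArrows_openIncl_mem (T : Over S) {ι : Type*} (V : ι → T.left.Opens)
    (hV : ∀ p : T.left, ∃ i, p ∈ V i) :
    Sieve.ofArrows (fun i => openOver T (V i)) (fun i => openIncl T (V i)) ∈
      (Scheme.zariskiTopology.{u}.over S) T := by
  rw [GrothendieckTopology.mem_over_iff, Sieve.overEquiv_ofArrows]
  let 𝓤 := T.left.openCoverOfIsOpenCover (fun p : T.left => V (hV p).choose) (by
    rw [TopologicalSpace.IsOpenCover, eq_top_iff]
    intro p _
    rw [TopologicalSpace.Opens.mem_iSup]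
    exact ⟨p, (hV p).choose_spec⟩)
  refine Scheme.mem_grothendieckTopology_iff.mpr ⟨𝓤, ?_⟩
  rintro _ _ ⟨p⟩
  exact Sieve.ofArrows_mk _ (fun i => (openIncl T (V i)).left) (hV p).choose

/-- The pullback of a cover by open subschemes is the cover by their preimages. -/
lemma pullback_ofArrows_openIncl {T' T : Over S} (h : T' ⟶ T) {ι : Type*}
    (V : ι → T.left.Opens) :
    (Sieve.ofArrows (fun i => openOver T (V i)) (fun i => openIncl T (V i))).pullback h =
      Sieve.ofArrows (fun i => openOver T' (preOpen h (V i)))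
        (fun i => openIncl T' (preOpen h (V i))) := by
  ext Z g
  rw [Sieve.pullback_apply, Sieve.mem_ofArrows_iff, Sieve.mem_ofArrows_iff]
  constructor
  · rintro ⟨i, a, ha⟩
    obtain ⟨g', hg'⟩ := exists_lift_openIncl (preOpen h (V i)) g fun t => by
      have : (g ≫ h).left t = (openIncl T (V i)).left (a.left t) := by rw [ha]; rfl
      change (g ≫ h).left t ∈ V i
      rw [this]
      exact openIncl_left_mem _
    exact ⟨i, g', hg'.symm⟩
  · rintro ⟨i, a, rfl⟩
    exact ⟨i, a ≫ preIncl h (V i), by rw [Category.assoc, Category.assoc, preIncl_openIncl]⟩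

/-- The sheaf condition on the big Zariski site of `S` amounts to unique gluing over covers by
open subschemes. -/
theorem isSheaf_over_iff (F : (Over S)ᵒᵖ ⥤ Type w) :
    Presieve.IsSheaf (Scheme.zariskiTopology.{u}.over S) F ↔
      ∀ (T : Over S) (ι : Type u) (V : ι → T.left.Opens), (∀ p : T.left, ∃ i, p ∈ V i) →
        Presieve.IsSheafFor F
          (Presieve.ofArrows (fun i => openOver T (V i)) (fun i => openIncl T (V i))) := by
  constructor
  · intro h T ι V hV
    rw [Presieve.isSheafFor_iff_generate]
    exact h _ (ofArrows_openIncl_mem T V hV)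
  · intro h T R hR
    choose V hV hVR using exists_openIncl_mem hR
    refine Presieve.isSheafFor_subsieve F
      (S := Sieve.ofArrows (fun p => openOver T (V p)) (fun p => openIncl T (V p))) ?_ ?_
    · change Sieve.ofArrows _ _ ≤ R
      rw [Sieve.ofArrows, Sieve.generate_le_iff]
      rintro _ _ ⟨p⟩
      exact hVR p
    · intro T' g
      rw [pullback_ofArrows_openIncl]
      exact (Presieve.isSheafFor_iff_generate _).mp
        (h T' _ (fun p => preOpen g (V p)) fun t => ⟨g.left t, hV (g.left t)⟩)

end Sheaves

/-! ### Gluing sections and morphisms -/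

section Gluing

variable {S : Scheme.{u}} {F : (Over S)ᵒᵖ ⥤ Type w}

lemma eq_of_locally_eq (hF : Presieve.IsSheaf (Scheme.zariskiTopology.{u}.over S) F)
    {T : Over S} (x y : F.obj (op T))
    (h : ∀ p : T.left, ∃ V : T.left.Opens, p ∈ V ∧
      F.map (openIncl T V).op x = F.map (openIncl T V).op y) : x = y := by
  choose V hV hxy using h
  have := (Presieve.isSheafFor_arrows_iff _ _).mp
    ((isSheaf_over_iff F).mp hF T _ V fun p => ⟨p, hV p⟩)
    (fun p => F.map (openIncl T (V p)).op x) (fun i j Z a b hab => by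
      rw [← Functor.map_comp_apply, ← op_comp, ← Functor.map_comp_apply, ← op_comp, hab])
  exact this.unique (fun p => rfl) fun p => (hxy p).symm

/-- Sections characterized uniquely by a property `Q` stable under restriction exist as soon as
they exist locally. -/
lemma exists_of_locally_exists (hF : Presieve.IsSheaf (Scheme.zariskiTopology.{u}.over S) F)
    {T : Over S} (Q : ∀ {T' : Over S}, (T' ⟶ T) → F.obj (op T') → Prop)
    (Q_res : ∀ {T'' T' : Over S} (k : T'' ⟶ T') (h : T' ⟶ T) (x : F.obj (op T')),
      Q h x → Q (k ≫ h) (F.map k.op x))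
    (Q_unique : ∀ {T' : Over S} (h : T' ⟶ T) (x y : F.obj (op T')), Q h x → Q h y → x = y)
    (Q_local : ∀ p : T.left, ∃ V : T.left.Opens, p ∈ V ∧ ∃ x, Q (openIncl T V) x) :
    ∃ x : F.obj (op T), ∀ p : T.left, ∃ V : T.left.Opens, p ∈ V ∧
      Q (openIncl T V) (F.map (openIncl T V).op x) := by
  choose V hV x hx using Q_local
  obtain ⟨y, hy, -⟩ := (Presieve.isSheafFor_arrows_iff _ _).mp
    ((isSheaf_over_iff F).mp hF T _ V fun p => ⟨p, hV p⟩) x (fun i j Z a b hab => by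
      refine Q_unique (a ≫ openIncl T (V i)) _ _ (Q_res a _ _ (hx i)) ?_
      rw [hab]
      exact Q_res b _ _ (hx j))
  refine ⟨y, fun p => ⟨V p, hV p, ?_⟩⟩
  rw [hy p]
  exact hx p

lemma isSheaf_yoneda_over (T : Over S) :
    Presieve.IsSheaf (Scheme.zariskiTopology.{u}.over S) (yoneda.obj T) :=
  GrothendieckTopology.Subcanonical.isSheaf_of_isRepresentable _

/-- Two morphisms of `S`-schemes that agree locally are equal. -/
lemma hom_eq_of_locally_eq {T H : Over S} (k k' : T ⟶ H)
    (h : ∀ p : T.left, ∃ V : T.left.Opens, p ∈ V ∧ openIncl T V ≫ k = openIncl T V ≫ k') :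
    k = k' :=
  eq_of_locally_eq (isSheaf_yoneda_over H) (T := T) k k' h

end Gluing

/-! ### Representability of sheaves covered by representable open subsheaves -/

section Representability

variable {S : Scheme.{u}} (F : (Over S)ᵒᵖ ⥤ Type u)

/-- Equality of pairs of a morphism `t : T ⟶ S` and a section of `F` over `t`. -/
lemma sigma_over_ext {T : Scheme.{u}} {t t' : T ⟶ S} (x : F.obj (op (Over.mk t)))
    (x' : F.obj (op (Over.mk t'))) (h : t' = t)
    (hx : F.map (Over.homMk (𝟙 T) (by simpa using h.symm) : Over.mk t' ⟶ Over.mk t).op x = x') :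
    (⟨t, x⟩ : Σ t : T ⟶ S, F.obj (op (Over.mk t))) = ⟨t', x'⟩ := by
  subst h
  have : (Over.homMk (𝟙 T) : Over.mk t' ⟶ Over.mk t') = 𝟙 _ := rfl
  rw [← hx, this, op_id, F.map_id]
  rfl

/-- The presheaf on schemes whose sections over `T` are a morphism `t : T ⟶ S` together with a
section of `F` over `t`. -/
def totalPresheaf : Scheme.{u}ᵒᵖ ⥤ Type u where
  obj T := Σ t : T.unop ⟶ S, F.obj (op (Over.mk t))
  map k := ↾fun x => ⟨k.unop ≫ x.1,
    F.map (Over.homMk k.unop : Over.mk (k.unop ≫ x.1) ⟶ Over.mk x.1).op x.2⟩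
  map_id T := by
    apply ConcreteCategory.hom_ext
    intro x
    refine sigma_over_ext F _ _ (Category.id_comp _).symm ?_
    rw [← Functor.map_comp_apply, ← op_comp]
    exact ConcreteCategory.congr_hom (F.map_id _) x.2
  map_comp h k := by
    apply ConcreteCategory.hom_ext
    intro x
    refine sigma_over_ext F _ _ (Category.assoc _ _ _).symm ?_
    change F.map _ (F.map _ _) = F.map _ (F.map _ _)
    rw [← Functor.map_comp_apply, ← Functor.map_comp_apply]
    rfl

variable {F}

lemma totalPresheaf_map {T T' : Over S} (k : T' ⟶ T) (x : F.obj (op T)) :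
    (totalPresheaf F).map k.left.op ⟨T.hom, x⟩ = ⟨T'.hom, F.map k.op x⟩ := by
  refine sigma_over_ext F _ _ (Over.w k).symm ?_
  rw [← Functor.map_comp_apply, ← op_comp]
  congr 3

lemma totalPresheaf_eq_iff {T : Over S} (x y : F.obj (op T)) :
    (⟨T.hom, x⟩ : (totalPresheaf F).obj (op T.left)) = ⟨T.hom, y⟩ ↔ x = y := by
  constructor
  · intro h
    exact eq_of_heq (Sigma.mk.inj h).2
  · rintro rfl
    rfl

/-- Gluing the first components defines the morphism to `S`, over which the second components
glue. -/
lemma isSheaf_totalPresheaf (hF : Presieve.IsSheaf (Scheme.zariskiTopology.{u}.over S) F) :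
    Presieve.IsSheaf Scheme.zariskiTopology.{u} (totalPresheaf F) := by
  rw [Precoverage.isSheaf_toGrothendieck_iff_of_isStableUnderBaseChange]
  intro T R hR
  obtain ⟨(𝓤 : T.OpenCover), rfl⟩ := Scheme.exists_cover_of_mem_pretopology hR
  refine (Presieve.isSheafFor_arrows_iff _ _).mpr fun x hx => ?_
  let t : T ⟶ S := 𝓤.glueMorphisms (fun i => (x i).1) fun i j =>
    congrArg Sigma.fst (hx i j _ _ _ Limits.pullback.condition)
  have ht : ∀ i, 𝓤.f i ≫ t = (x i).1 := fun i => 𝓤.ι_glueMorphisms _ _ i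
  let π : ∀ i, Over.mk (𝓤.f i ≫ t) ⟶ Over.mk t := fun i => Over.homMk (𝓤.f i)
  have hcov : Sieve.ofArrows _ π ∈ (Scheme.zariskiTopology.{u}.over S) (Over.mk t) := by
    rw [GrothendieckTopology.mem_over_iff, Sieve.overEquiv_ofArrows]
    exact 𝓤.mem_grothendieckTopology
  have hFπ : Presieve.IsSheafFor F (Presieve.ofArrows _ π) := by
    rw [Presieve.isSheafFor_iff_generate]
    exact hF _ hcov
  have hx' : ∀ i, ∃ y : F.obj (op (Over.mk (𝓤.f i ≫ t))),
      (⟨𝓤.f i ≫ t, y⟩ : (totalPresheaf F).obj (op (𝓤.X i))) = x i := by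
    intro i
    rw [ht i]
    exact ⟨(x i).2, rfl⟩
  choose y hy using hx'
  obtain ⟨z, hz, hz'⟩ := (Presieve.isSheafFor_arrows_iff _ _).mp hFπ y (fun i j Z a b hab => by
    have h1 := hx i j Z.left a.left b.left (congrArg (fun f => f.left) hab)
    rw [← hy, ← hy] at h1
    have h2 := totalPresheaf_map a (y i)
    have h3 := totalPresheaf_map b (y j)
    exact (totalPresheaf_eq_iff _ _).mp (h2.symm.trans (h1.trans h3)))
  refine ⟨⟨t, z⟩, fun i => ?_, ?_⟩
  · rw [← hy i]
    refine (totalPresheaf_map (π i) z).trans ?_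
    rw [hz i]
    rfl
  · rintro ⟨t', z'⟩ h
    have : t' = t := 𝓤.hom_ext _ _ fun i => by
      rw [ht]
      exact congrArg Sigma.fst (h i)
    subst this
    refine (totalPresheaf_eq_iff _ _).mpr (hz' z' fun i => ?_)
    refine (totalPresheaf_eq_iff _ _).mp ((totalPresheaf_map (π i) z').symm.trans ?_)
    exact (h i).trans (hy i).symm

/-- A Zariski sheaf on schemes over `S` is representable if it is covered by representable open
subsheaves: there are schemes `H i` over `S` with sections `x i` such that a section of `F` is the
pullback of `x i` along at most one morphism, such that the locus where a given section is locally
such a pullback is open and compatible with base change, and such that these loci cover. -/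
theorem exists_representing (hF : Presieve.IsSheaf (Scheme.zariskiTopology.{u}.over S) F)
    {ι : Type u} (H : ι → Over S) (x : ∀ i, F.obj (op (H i)))
    (x_mono : ∀ i (T : Over S) (k k' : T ⟶ H i), F.map k.op (x i) = F.map k'.op (x i) → k = k')
    (x_open : ∀ i (T T' : Over S) (y : F.obj (op T)) (k : T' ⟶ T) (l : T' ⟶ H i),
      F.map l.op (x i) = F.map k.op y → ∀ t : T'.left, ∃ V : T.left.Opens, k.left t ∈ V ∧
        ∃ m : openOver T V ⟶ H i, F.map m.op (x i) = F.map (openIncl T V).op y)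
    (x_cover : ∀ (T : Over S) (y : F.obj (op T)) (p : T.left), ∃ i, ∃ V : T.left.Opens, p ∈ V ∧
        ∃ m : openOver T V ⟶ H i, F.map m.op (x i) = F.map (openIncl T V).op y) :
    ∃ (X : Over S) (z : F.obj (op X)), ∀ (T : Over S) (y : F.obj (op T)),
      ∃! k : T ⟶ X, F.map k.op z = y := by
  let G := totalPresheaf F
  let f : ∀ i, yoneda.obj (H i).left ⟶ G := fun i => yonedaEquiv.symm ⟨(H i).hom, x i⟩
  have hf_app : ∀ i (T : Over S) (k : T ⟶ H i),
      (f i).app (op T.left) k.left = ⟨T.hom, F.map k.op (x i)⟩ := fun i T k =>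
    totalPresheaf_map k (x i)
  -- the morphism `k` over `S` underlying an equality of sections of the total presheaf
  have hf_lift : ∀ i (T : Over S) (y : F.obj (op T)) (k : T.left ⟶ (H i).left),
      (f i).app (op T.left) k = ⟨T.hom, y⟩ →
        ∃ k' : T ⟶ H i, k'.left = k ∧ F.map k'.op (x i) = y := by
    intro i T y k hk
    let k' : T ⟶ H i := Over.homMk k (congrArg Sigma.fst hk)
    exact ⟨k', rfl, (totalPresheaf_eq_iff _ _).mp ((hf_app i T k').symm.trans hk)⟩
  -- the base change of `f i` along a section is the open subscheme where the section is locally a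
  -- pullback of `x i`
  have hf : ∀ i, IsOpenImmersion.presheaf (f i) := by
    intro i
    refine MorphismProperty.relative.of_exists fun T g => ?_
    obtain ⟨⟨t, y⟩, rfl⟩ := yonedaEquiv.symm.surjective g
    let T₀ : Over S := Over.mk t
    let U : T.Opens := sSup {V : T.Opens | ∃ m : openOver T₀ V ⟶ H i,
      F.map m.op (x i) = F.map (openIncl T₀ V).op y}
    have hm : ∃ m : openOver T₀ U ⟶ H i, F.map m.op (x i) = F.map (openIncl T₀ U).op y := by
      obtain ⟨m, hm⟩ := exists_of_locally_exists (isSheaf_yoneda_over (H i)) (T := openOver T₀ U)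
        (fun {T'} h (m : T' ⟶ H i) => F.map m.op (x i) = F.map (h ≫ openIncl T₀ U).op y)
        (fun k h m hm => by
          change F.map (k ≫ m).op (x i) = _
          rw [op_comp, Functor.map_comp_apply, hm, ← Functor.map_comp_apply, ← op_comp,
            Category.assoc])
        (fun h m m' hm hm' => x_mono i _ _ _ (hm.trans hm'.symm))
        (fun p => by
          have hp : (openIncl T₀ U).left p ∈ U := openIncl_left_mem p
          obtain ⟨V, ⟨m, hm⟩, hpV⟩ := TopologicalSpace.Opens.mem_sSup.mp hp
          refine ⟨preOpen (openIncl T₀ U) V, hpV, preIncl (openIncl T₀ U) V ≫ m, ?_⟩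
          rw [op_comp, Functor.map_comp_apply, hm, ← Functor.map_comp_apply, ← op_comp,
            preIncl_openIncl])
      refine ⟨m, eq_of_locally_eq hF _ _ fun p => ?_⟩
      obtain ⟨V, hpV, hV⟩ := hm p
      refine ⟨V, hpV, ?_⟩
      rw [← Functor.map_comp_apply, ← op_comp, ← Functor.map_comp_apply, ← op_comp]
      exact hV
    obtain ⟨m, hm⟩ := hm
    have hg_app : ∀ (T' : Over S) (k : T' ⟶ T₀),
        (yonedaEquiv.symm (show G.obj (op T) from ⟨t, y⟩)).app (op T'.left) k.left =
          (show G.obj (op T'.left) from ⟨T'.hom, F.map k.op y⟩) := fun T' k => totalPresheaf_map k y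
    refine ⟨(openOver T₀ U).left, yoneda.map m.left, (openIncl T₀ U).left, ?_, inferInstance⟩
    refine IsPullback.of_forall_isPullback_app fun Z => (Limits.Types.isPullback_iff _ _ _ _).mpr
      ⟨?_, ?_, ?_⟩
    · apply ConcreteCategory.hom_ext
      intro (k : Z.unop ⟶ (openOver T₀ U).left)
      let k' : Over.mk (k ≫ (openOver T₀ U).hom) ⟶ openOver T₀ U := Over.homMk k
      refine (hf_app i _ (k' ≫ m)).trans (Eq.trans ?_ (hg_app _ (k' ≫ openIncl T₀ U)).symm)
      refine (totalPresheaf_eq_iff _ _).mpr ?_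
      rw [op_comp, Functor.map_comp_apply, hm, op_comp, Functor.map_comp_apply]
    · rintro (k : Z.unop ⟶ (openOver T₀ U).left) (k' : Z.unop ⟶ (openOver T₀ U).left) ⟨-, h⟩
      exact (cancel_mono (openIncl T₀ U).left).mp h
    · intro (l : Z.unop ⟶ (H i).left) (k : Z.unop ⟶ T) h
      let k' : Over.mk (k ≫ t) ⟶ T₀ := Over.homMk k
      obtain ⟨l', hl', hl⟩ := hf_lift i (Over.mk (k ≫ t)) (F.map k'.op y) l
        (h.trans (hg_app _ k'))
      obtain ⟨j, hj⟩ := exists_lift_openIncl U k' fun q => by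
        obtain ⟨V, hqV, hV⟩ := x_open i T₀ _ y k' l' hl q
        exact TopologicalSpace.Opens.mem_sSup.mpr ⟨V, hV, hqV⟩
      refine ⟨j.left, ?_, congrArg (fun f => f.left) hj⟩
      have : j ≫ m = l' := x_mono i _ _ _ (by
        rw [op_comp, Functor.map_comp_apply, hm, ← Functor.map_comp_apply, ← op_comp, hj, hl])
      rw [← hl', ← this]
      rfl
  have : Presheaf.IsLocallySurjective Scheme.zariskiTopology (Limits.Sigma.desc f) := by
    constructor
    rintro T ⟨t, y⟩
    choose i V hV m hm using x_cover (Over.mk t) y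
    have hcov := ofArrows_openIncl_mem (Over.mk t) V fun p => ⟨p, hV p⟩
    rw [GrothendieckTopology.mem_over_iff, Sieve.overEquiv_ofArrows] at hcov
    refine GrothendieckTopology.superset_covering _ ?_ hcov
    rw [Sieve.ofArrows, Sieve.generate_le_iff]
    rintro _ _ ⟨p⟩
    refine ⟨(Limits.Sigma.ι (fun i => yoneda.obj (H i).left) (i p)).app _ (m p).left, ?_⟩
    rw [← NatTrans.comp_app_apply, Limits.Sigma.ι_desc]
    refine (hf_app (i p) _ (m p)).trans ?_
    rw [hm p]
    exact (totalPresheaf_map (openIncl (Over.mk t) (V p)) y).symm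
  have hG : G.IsRepresentable := Scheme.LocalRepresentability.isRepresentable
    (F := ⟨G, (isSheaf_iff_isSheaf_of_type _ _).mpr (isSheaf_totalPresheaf hF)⟩) (f := f) hf
  obtain ⟨X, ⟨e⟩⟩ := hG.has_representation
  obtain ⟨⟨p, z⟩, hz⟩ : ∃ a : Σ p : X ⟶ S, F.obj (op (Over.mk p)), e.homEquiv (𝟙 X) = a := ⟨_, rfl⟩
  have key : ∀ (T : Over S) (k : T ⟶ Over.mk p),
      e.homEquiv k.left = (show G.obj (op T.left) from ⟨T.hom, F.map k.op z⟩) := by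
    intro T k
    refine Eq.trans ?_ (totalPresheaf_map k z)
    rw [← Category.comp_id k.left]
    refine (e.homEquiv_comp k.left (𝟙 X)).trans ?_
    rw [hz, Category.comp_id]
    rfl
  refine ⟨Over.mk p, z, fun T y => ?_⟩
  obtain ⟨k, hk⟩ := e.homEquiv.surjective (show G.obj (op T.left) from ⟨T.hom, y⟩)
  have hkp : k ≫ p = T.hom := by
    have h := e.homEquiv_comp k (𝟙 X)
    rw [Category.comp_id, hk, hz] at h
    exact (congrArg Sigma.fst h).symm
  refine ⟨Over.homMk k hkp, ?_, fun k' hk' => ?_⟩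
  · exact (totalPresheaf_eq_iff _ _).mp ((key T (Over.homMk k hkp)).symm.trans hk)
  · ext1
    apply e.homEquiv.injective
    refine (key T k').trans ?_
    rw [hk']
    exact hk.symm

end Representability

/-! ### Affine spaces over a base, and the structure sheaf -/

section AffineSpace

variable {S : Scheme.{u}}

lemma appTop_id_apply (T : Over S) (a : Γ(T.left, ⊤)) : (𝟙 T : T ⟶ T).left.appTop.hom a = a := by
  simp

lemma appTop_comp_apply {T'' T' T : Over S} (k : T'' ⟶ T') (h : T' ⟶ T) (a : Γ(T.left, ⊤)) :
    (k ≫ h).left.appTop.hom a = k.left.appTop.hom (h.left.appTop.hom a) := by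
  rw [Over.comp_left, Scheme.Hom.comp_appTop]
  rfl

/-- The affine space over an `S`-scheme `V` with coordinates indexed by `n`. -/
noncomputable def affOver (V : Over S) (n : Type u) : Over S :=
  Over.mk ((𝔸(n; V.left) ↘ V.left) ≫ V.hom)

/-- The structure morphism of the affine space over `V`. -/
noncomputable def affProj (V : Over S) (n : Type u) : affOver V n ⟶ V :=
  Over.homMk (𝔸(n; V.left) ↘ V.left)

/-- The coordinates of the affine space over `V`. -/
noncomputable def affCoord (V : Over S) {n : Type u} (i : n) : Γ((affOver V n).left, ⊤) :=
  AffineSpace.coord V.left i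

lemma affOver_hom_ext {V : Over S} {n : Type u} {T : Over S} {l l' : T ⟶ affOver V n}
    (h : l ≫ affProj V n = l' ≫ affProj V n)
    (h' : ∀ i, l.left.appTop.hom (affCoord V i) = l'.left.appTop.hom (affCoord V i)) : l = l' := by
  ext1
  exact AffineSpace.hom_ext (congrArg (fun f => f.left) h) h'

lemma exists_affOver_lift {V : Over S} {n : Type u} {T : Over S} (t : T ⟶ V)
    (x : n → Γ(T.left, ⊤)) :
    ∃ l : T ⟶ affOver V n, l ≫ affProj V n = t ∧
      ∀ i, l.left.appTop.hom (affCoord V i) = x i := by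
  have h : AffineSpace.homOfVector t.left x ≫ (𝔸(n; V.left) ↘ V.left) = t.left :=
    AffineSpace.homOfVector_over _ _
  refine ⟨Over.homMk (AffineSpace.homOfVector t.left x) ?_, ?_, fun i => ?_⟩
  · exact (Category.assoc _ _ _).symm.trans ((congrArg (· ≫ V.hom) h).trans (Over.w t))
  · ext1
    exact h
  · exact AffineSpace.homOfVector_appTop_coord _ _ i

namespace ModulePresheaf

/-- The structure sheaf as a module over itself. -/
noncomputable def unit (S : Scheme.{u}) : ModulePresheaf S where
  obj T := Γ(T.left, ⊤)
  res h := (h.left.appTop.hom : _ →+ _)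
  res_id := appTop_id_apply
  res_comp := appTop_comp_apply
  res_smul h a x := map_mul h.left.appTop.hom a x

/-- The direct sum of two modules. -/
def prod (E E' : ModulePresheaf S) : ModulePresheaf S where
  obj T := E.obj T × E'.obj T
  res h := AddMonoidHom.prodMap (E.res h) (E'.res h)
  res_id T x := Prod.ext (E.res_id T x.1) (E'.res_id T x.2)
  res_comp k h x := Prod.ext (E.res_comp k h x.1) (E'.res_comp k h x.2)
  res_smul h a x := Prod.ext (E.res_smul h a x.1) (E'.res_smul h a x.2)

lemma hyp_eq_prod (E : ModulePresheaf S) : E.hyp = (unit S).prod (E.prod (unit S)) := rfl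

/-- Functions on `T` are the morphisms from `T` to the affine line over `S`, so they glue. -/
lemma isSheaf_unit (S : Scheme.{u}) :
    Presieve.IsSheaf (Scheme.zariskiTopology.{u}.over S) (unit S).toPresheaf := by
  rw [isSheaf_over_iff]
  intro T ι V hV
  refine (Presieve.isSheafFor_arrows_iff _ _).mpr fun x hx => ?_
  let X : Over S := Over.mk (𝟙 S)
  choose l hl hlx using fun i => exists_affOver_lift (V := X) (n := PUnit)
    (Over.homMk (openOver T (V i)).hom : openOver T (V i) ⟶ X) fun _ => x i
  have hX : ∀ {Z : Over S} (k k' : Z ⟶ X), k = k' := fun k k' => by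
    ext1
    exact (cancel_mono (𝟙 S)).mp ((Over.w k).trans (Over.w k').symm)
  obtain ⟨m, hm, -⟩ := (Presieve.isSheafFor_arrows_iff _ _).mp
    ((isSheaf_over_iff _).mp (isSheaf_yoneda_over (affOver X PUnit)) T ι V hV) l
    fun i j Z a b hab => affOver_hom_ext (hX _ _) fun e => by
      change (a ≫ l i).left.appTop.hom _ = (b ≫ l j).left.appTop.hom _
      rw [appTop_comp_apply, appTop_comp_apply, hlx, hlx]
      exact hx i j Z a b hab
  refine ⟨m.left.appTop.hom (affCoord X PUnit.unit), fun i => ?_, fun y hy => ?_⟩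
  · rw [← hlx i PUnit.unit, ← show openIncl T (V i) ≫ m = l i from hm i, appTop_comp_apply]
    rfl
  · obtain ⟨n, -, hn⟩ := exists_affOver_lift (V := X) (n := PUnit)
      (Over.homMk T.hom : T ⟶ X) fun _ => y
    rw [← hn PUnit.unit]
    have hnm : n = m := hom_eq_of_locally_eq _ _ fun p => by
      obtain ⟨i, hi⟩ := hV p
      refine ⟨V i, hi, affOver_hom_ext (hX _ _) fun e => ?_⟩
      rw [show openIncl T (V i) ≫ m = l i from hm i, hlx, appTop_comp_apply, hn]
      exact hy i
    rw [hnm]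

lemma isSheaf_prod {E E' : ModulePresheaf S}
    (hE : Presieve.IsSheaf (Scheme.zariskiTopology.{u}.over S) E.toPresheaf)
    (hE' : Presieve.IsSheaf (Scheme.zariskiTopology.{u}.over S) E'.toPresheaf) :
    Presieve.IsSheaf (Scheme.zariskiTopology.{u}.over S) (E.prod E').toPresheaf := by
  rw [isSheaf_over_iff] at hE hE' ⊢
  intro T ι V hV
  refine (Presieve.isSheafFor_arrows_iff _ _).mpr fun x hx => ?_
  obtain ⟨y, hy, hyu⟩ := (Presieve.isSheafFor_arrows_iff _ _).mp (hE T ι V hV) (fun i => (x i).1)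
    fun i j Z a b hab => congrArg Prod.fst (hx i j Z a b hab)
  obtain ⟨y', hy', hyu'⟩ := (Presieve.isSheafFor_arrows_iff _ _).mp (hE' T ι V hV)
    (fun i => (x i).2) fun i j Z a b hab => congrArg Prod.snd (hx i j Z a b hab)
  exact ⟨(y, y'), fun i => Prod.ext (hy i) (hy' i), fun z hz => Prod.ext
    (hyu z.1 fun i => congrArg Prod.fst (hz i)) (hyu' z.2 fun i => congrArg Prod.snd (hz i))⟩

end ModulePresheaf

end AffineSpace

/-! ### Vanishing and invertibility of functions -/

section Functions

variable {S : Scheme.{u}}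

lemma mem_basicOpen_pullback {T' T : Over S} (k : T' ⟶ T) (a : Γ(T.left, ⊤)) (t : T'.left) :
    t ∈ T'.left.basicOpen (k.left.appTop.hom a) ↔ k.left t ∈ T.left.basicOpen a := by
  have h := Scheme.preimage_basicOpen_top k.left a
  change t ∈ T'.left.basicOpen (k.left.appTop a) ↔ _
  rw [← h]
  rfl

lemma isUnit_iff_forall_mem_basicOpen {T : Over S} (a : Γ(T.left, ⊤)) :
    IsUnit a ↔ ∀ p, p ∈ T.left.basicOpen a := by
  constructor
  · rintro h -
    rw [Scheme.basicOpen_of_isUnit _ h]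
    trivial
  · intro h
    exact T.left.toRingedSpace.isUnit_of_isUnit_germ ⊤ a fun p _ =>
      (T.left.mem_basicOpen_top a p).mp (h p)

lemma isUnit_pullback_basicOpen {T' T : Over S} (a : Γ(T.left, ⊤)) (k : T' ⟶ T)
    (h : ∀ t, k.left t ∈ T.left.basicOpen a) : IsUnit (k.left.appTop.hom a) :=
  (isUnit_iff_forall_mem_basicOpen _).mpr fun t => (mem_basicOpen_pullback k a t).mpr (h t)

lemma mem_basicOpen_of_isUnit_pullback {T' T : Over S} {a : Γ(T.left, ⊤)} {k : T' ⟶ T}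
    (h : IsUnit (k.left.appTop.hom a)) (t : T'.left) : k.left t ∈ T.left.basicOpen a :=
  (mem_basicOpen_pullback k a t).mp ((isUnit_iff_forall_mem_basicOpen _).mp h t)

lemma isUnit_of_locally {T : Over S} (a : Γ(T.left, ⊤))
    (h : ∀ p : T.left, ∃ V : T.left.Opens, p ∈ V ∧ IsUnit ((openIncl T V).left.appTop.hom a)) :
    IsUnit a := by
  rw [isUnit_iff_forall_mem_basicOpen]
  intro p
  obtain ⟨V, hp, hV⟩ := h p
  obtain ⟨t, rfl⟩ := exists_openIncl_left_eq hp
  exact mem_basicOpen_of_isUnit_pullback hV t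

/-- Functions that generate the unit ideal have no common zero. -/
lemma exists_mem_basicOpen_of_sum_mul_eq_one {T : Over S} {ι : Type*} [Fintype ι]
    (a s : ι → Γ(T.left, ⊤)) (h : ∑ i, a i * s i = 1) (p : T.left) :
    ∃ i, p ∈ T.left.basicOpen (s i) := by
  by_contra! hp
  have h1 : IsUnit (T.left.presheaf.germ ⊤ p trivial (∑ i, a i * s i)) := by
    rw [h, map_one]
    exact isUnit_one
  refine h1.elim fun v hv => ?_
  have : T.left.presheaf.germ ⊤ p trivial (∑ i, a i * s i) ∈
      IsLocalRing.maximalIdeal (T.left.presheaf.stalk p) := by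
    rw [map_sum]
    refine Ideal.sum_mem _ fun i _ => ?_
    rw [map_mul]
    refine Ideal.mul_mem_left _ _ ?_
    rw [IsLocalRing.mem_maximalIdeal, mem_nonunits_iff, ← T.left.mem_basicOpen_top]
    exact hp i
  exact this h1

lemma function_eq_of_locally {T : Over S} (a b : Γ(T.left, ⊤))
    (h : ∀ p : T.left, ∃ V : T.left.Opens, p ∈ V ∧
      (openIncl T V).left.appTop.hom a = (openIncl T V).left.appTop.hom b) : a = b :=
  eq_of_locally_eq (ModulePresheaf.isSheaf_unit S) (T := T) a b h

end Functions

/-! ### Frames of families of submodules -/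

namespace ModulePresheaf

variable {S : Scheme.{u}} {E : ModulePresheaf S}

lemma section_eq_of_locally
    (hE : Presieve.IsSheaf (Scheme.zariskiTopology.{u}.over S) E.toPresheaf) {T : Over S}
    (x y : E.obj T) (h : ∀ p : T.left, ∃ V : T.left.Opens, p ∈ V ∧
      E.res (openIncl T V) x = E.res (openIncl T V) y) : x = y :=
  eq_of_locally_eq hE (T := T) x y h

lemma res_sum {T' T : Over S} (k : T' ⟶ T) {ι : Type*} [Fintype ι] (a : ι → Γ(T.left, ⊤))
    (b : ι → E.obj T) :
    E.res k (∑ i, a i • b i) = ∑ i, k.left.appTop.hom (a i) • E.res k (b i) := by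
  rw [map_sum]
  exact Finset.sum_congr rfl fun i _ => E.res_smul k (a i) (b i)

/-- Sections `b` over `D` form a frame of the family of submodules `N`, given over all schemes
over `D`, if all their pullbacks are bases. -/
def IsFrame {D : Over S} (N : ∀ T : Over S, (T ⟶ D) → Submodule Γ(T.left, ⊤) (E.obj T))
    {ι : Type*} (b : ι → E.obj D) : Prop :=
  ∀ (T : Over S) (k : T ⟶ D), LinearIndependent Γ(T.left, ⊤) (fun i => E.res k (b i)) ∧
    Submodule.span Γ(T.left, ⊤) (Set.range fun i => E.res k (b i)) = N T k

section Frame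

variable {D : Over S} {N : ∀ T : Over S, (T ⟶ D) → Submodule Γ(T.left, ⊤) (E.obj T)}
  {ι : Type*} {b : ι → E.obj D}

lemma IsFrame.res (hb : IsFrame N b) {D' : Over S} (j : D' ⟶ D) :
    IsFrame (fun T k => N T (k ≫ j)) (fun i => E.res j (b i)) := fun T k => by
  simp only [← E.res_comp]
  exact hb T (k ≫ j)

lemma IsFrame.reindex (hb : IsFrame N b) {κ : Type*} (e : κ ≃ ι) :
    IsFrame N (fun i => b (e i)) := fun T k => by
  refine ⟨((hb T k).1.comp e e.injective), ?_⟩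
  rw [← (hb T k).2]
  congr 1
  exact e.surjective.range_comp (fun i => E.res k (b i))

lemma IsFrame.res_mem (hb : IsFrame N b) {T : Over S} (k : T ⟶ D) (i : ι) :
    E.res k (b i) ∈ N T k := by
  rw [← (hb T k).2]
  exact Submodule.subset_span ⟨i, rfl⟩

lemma IsFrame.mem (hb : IsFrame N b) (i : ι) : b i ∈ N D (𝟙 D) := by
  have := hb.res_mem (𝟙 D) i
  rwa [E.res_id] at this

variable [Fintype ι]

/-- A frame amounts to unique coordinates of all sections of `N` over all schemes over `D`. -/
lemma IsFrame.of_coord (h_mem : ∀ (T : Over S) (k : T ⟶ D) i, E.res k (b i) ∈ N T k)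
    (h_exists : ∀ (T : Over S) (k : T ⟶ D), ∀ x ∈ N T k,
      ∃ a : ι → Γ(T.left, ⊤), ∑ i, a i • E.res k (b i) = x)
    (h_indep : ∀ (T : Over S) (k : T ⟶ D) (a : ι → Γ(T.left, ⊤)),
      ∑ i, a i • E.res k (b i) = 0 → ∀ i, a i = 0) : IsFrame N b := fun T k => by
  refine ⟨Fintype.linearIndependent_iff.mpr (h_indep T k), le_antisymm ?_ fun x hx => ?_⟩
  · rw [Submodule.span_le]
    rintro _ ⟨i, rfl⟩
    exact h_mem T k i
  · exact (Submodule.mem_span_range_iff_exists_fun _).mpr (h_exists T k x hx)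

lemma IsFrame.coord_eq_zero (hb : IsFrame N b) {T : Over S} (k : T ⟶ D)
    {a : ι → Γ(T.left, ⊤)} (h : ∑ i, a i • E.res k (b i) = 0) (i : ι) : a i = 0 :=
  Fintype.linearIndependent_iff.mp (hb T k).1 a h i

lemma IsFrame.exists_coord (hb : IsFrame N b) {T : Over S} {k : T ⟶ D} {x : E.obj T}
    (hx : x ∈ N T k) : ∃ a : ι → Γ(T.left, ⊤), ∑ i, a i • E.res k (b i) = x := by
  rw [← (hb T k).2] at hx
  exact (Submodule.mem_span_range_iff_exists_fun _).mp hx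

lemma IsFrame.coord_unique (hb : IsFrame N b) {T : Over S} (k : T ⟶ D)
    {a a' : ι → Γ(T.left, ⊤)}
    (h : ∑ i, a i • E.res k (b i) = ∑ i, a' i • E.res k (b i)) : a = a' := by
  have := Fintype.linearIndependent_iff.mp (hb T k).1 (fun i => a i - a' i) (by
    simp only [sub_smul, Finset.sum_sub_distrib, h, sub_self])
  exact funext fun i => sub_eq_zero.mp (this i)

lemma IsFrame.coord_mem (hb : IsFrame N b) {T : Over S} (k : T ⟶ D) (a : ι → Γ(T.left, ⊤)) :
    ∑ i, a i • E.res k (b i) ∈ N T k :=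
  Submodule.sum_mem _ fun i _ => Submodule.smul_mem _ _ (hb.res_mem k i)

lemma sum_mulVec_smul {R M : Type*} [CommRing R] [AddCommGroup M] [Module R M] {κ : Type*}
    [Fintype κ] (A : Matrix ι κ R) (a : κ → R) (v : ι → M) :
    ∑ j, a j • ∑ i, A i j • v i = ∑ i, (A.mulVec a) i • v i := by
  simp only [Finset.smul_sum, Matrix.mulVec, dotProduct, Finset.sum_smul, smul_smul]
  rw [Finset.sum_comm]
  simp only [mul_comm]

/-- An invertible matrix transforms a frame into a frame. -/
lemma IsFrame.change [DecidableEq ι] (hb : IsFrame N b) (A : Matrix ι ι Γ(D.left, ⊤))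
    (hA : IsUnit A.det) : IsFrame N (fun j => ∑ i, A i j • b i) := fun T k => by
  let A' : Matrix ι ι Γ(T.left, ⊤) := A.map k.left.appTop.hom
  have hA' : IsUnit A'.det := by
    have : A'.det = k.left.appTop.hom A.det := (RingHom.map_det _ _).symm
    rw [this]
    exact hA.map _
  have hres : (fun j => E.res k (∑ i, A i j • b i)) = fun j => ∑ i, A' i j • E.res k (b i) :=
    funext fun j => res_sum k _ _
  rw [hres]
  constructor
  · rw [Fintype.linearIndependent_iff]
    intro a ha
    rw [sum_mulVec_smul] at ha
    have h0 := Fintype.linearIndependent_iff.mp (hb T k).1 _ ha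
    have : a = A'⁻¹.mulVec (A'.mulVec a) := by
      rw [Matrix.mulVec_mulVec, Matrix.nonsing_inv_mul _ hA', Matrix.one_mulVec]
    rw [this, funext h0]
    simp [Matrix.mulVec, dotProduct]
  · rw [← (hb T k).2]
    apply le_antisymm
    · rw [Submodule.span_le]
      rintro _ ⟨j, rfl⟩
      exact Submodule.sum_mem _ fun i _ => Submodule.smul_mem _ _ (Submodule.subset_span ⟨i, rfl⟩)
    · intro x hx
      obtain ⟨a, rfl⟩ := (Submodule.mem_span_range_iff_exists_fun _).mp hx
      refine (Submodule.mem_span_range_iff_exists_fun _).mpr ⟨A'⁻¹.mulVec a, ?_⟩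
      rw [sum_mulVec_smul, Matrix.mulVec_mulVec, Matrix.mul_nonsing_inv _ hA', Matrix.one_mulVec]

end Frame

/-! ### Vector bundles -/

lemma isFrame_unit (D : Over S) : IsFrame (E := unit S) (D := D) (fun _ _ => ⊤)
    (fun _ : Fin 1 => (1 : Γ(D.left, ⊤))) := by
  have h : ∀ (T : Over S) (k : T ⟶ D) (a : Fin 1 → Γ(T.left, ⊤)),
      ∑ i, a i • (unit S).res k (1 : Γ(D.left, ⊤)) = a 0 := by
    intro T k a
    rw [Fin.sum_univ_one]
    exact (congrArg (a 0 * ·) (map_one k.left.appTop.hom)).trans (mul_one _)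
  refine IsFrame.of_coord (fun _ _ _ => trivial) (fun T k x _ => ⟨fun _ => x, h T k _⟩) ?_
  intro T k a ha i
  rw [Subsingleton.elim i 0, ← h T k a]
  exact ha

lemma isVectorBundle_unit (S : Scheme.{u}) : (unit S).IsVectorBundle 1 where
  isSheaf := isSheaf_unit S
  exists_frame _ := ⟨⊤, trivial, _, fun k => isFrame_unit _ _ k⟩

lemma IsFrame.prod {E' : ModulePresheaf S} {D : Over S}
    {N : ∀ T : Over S, (T ⟶ D) → Submodule Γ(T.left, ⊤) (E.obj T)}
    {N' : ∀ T : Over S, (T ⟶ D) → Submodule Γ(T.left, ⊤) (E'.obj T)}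
    {ι ι' : Type*} [Fintype ι] [Fintype ι'] {b : ι → E.obj D} {b' : ι' → E'.obj D}
    (hb : IsFrame N b) (hb' : IsFrame N' b') :
    IsFrame (E := E.prod E') (fun T k => (N T k).prod (N' T k))
      (Sum.elim (fun i => (b i, (0 : E'.obj D))) fun i => ((0 : E.obj D), b' i)) := by
  have h : ∀ (T : Over S) (k : T ⟶ D) (a : ι ⊕ ι' → Γ(T.left, ⊤)),
      ∑ i, a i • (E.prod E').res k
        (Sum.elim (fun i => (b i, (0 : E'.obj D))) (fun i => ((0 : E.obj D), b' i)) i) =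
      (∑ i, a (Sum.inl i) • E.res k (b i), ∑ i, a (Sum.inr i) • E'.res k (b' i)) := by
    intro T k a
    let p : (E.prod E').obj T →ₗ[Γ(T.left, ⊤)] E.obj T := LinearMap.fst _ (E.obj T) (E'.obj T)
    let p' : (E.prod E').obj T →ₗ[Γ(T.left, ⊤)] E'.obj T := LinearMap.snd _ (E.obj T) (E'.obj T)
    refine Prod.ext ?_ ?_
    · refine (map_sum p _ _).trans ((Fintype.sum_sum_type _).trans ?_)
      have h0 : ∀ i, p (a (Sum.inr i) • (E.prod E').res k ((0 : E.obj D), b' i)) = 0 := fun i =>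
        (congrArg (a (Sum.inr i) • ·) (map_zero (E.res k))).trans (smul_zero _)
      exact (congrArg₂ (· + ·) rfl (Finset.sum_eq_zero fun i _ => h0 i)).trans (add_zero _)
    · refine (map_sum p' _ _).trans ((Fintype.sum_sum_type _).trans ?_)
      have h0 : ∀ i, p' (a (Sum.inl i) • (E.prod E').res k (b i, (0 : E'.obj D))) = 0 := fun i =>
        (congrArg (a (Sum.inl i) • ·) (map_zero (E'.res k))).trans (smul_zero _)
      exact (congrArg₂ (· + ·) (Finset.sum_eq_zero fun i _ => h0 i) rfl).trans (zero_add _)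
  refine IsFrame.of_coord ?_ ?_ ?_
  · rintro T k (i | i)
    · exact ⟨hb.res_mem k i, by
        change E'.res k 0 ∈ _
        rw [map_zero]
        exact zero_mem _⟩
    · exact ⟨by
        change E.res k 0 ∈ _
        rw [map_zero]
        exact zero_mem _, hb'.res_mem k i⟩
  · rintro T k ⟨x, x'⟩ ⟨hx, hx'⟩
    obtain ⟨a, ha⟩ := hb.exists_coord hx
    obtain ⟨a', ha'⟩ := hb'.exists_coord hx'
    exact ⟨Sum.elim a a', (h T k _).trans (Prod.ext ha ha')⟩
  · intro T k a ha
    rw [h] at ha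
    rintro (i | i)
    · exact hb.coord_eq_zero k (congrArg Prod.fst ha) i
    · exact hb'.coord_eq_zero k (congrArg Prod.snd ha) i

lemma isVectorBundle_prod {E' : ModulePresheaf S} {m m' : ℕ} (hE : E.IsVectorBundle m)
    (hE' : E'.IsVectorBundle m') : (E.prod E').IsVectorBundle (m + m') where
  isSheaf := isSheaf_prod hE.isSheaf hE'.isSheaf
  exists_frame p := by
    obtain ⟨V, hp, b, hb⟩ := hE.exists_frame p
    obtain ⟨V', hp', b', hb'⟩ := hE'.exists_frame p
    let j : Over.mk (V ⊓ V').ι ⟶ Over.mk V.ι := Over.homMk (S.homOfLE inf_le_left)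
    let j' : Over.mk (V ⊓ V').ι ⟶ Over.mk V'.ι := Over.homMk (S.homOfLE inf_le_right)
    have h := (IsFrame.res (N := fun _ _ => ⊤) (fun _ => hb) j).prod
      (IsFrame.res (N := fun _ _ => ⊤) (fun _ => hb') j')
    refine ⟨V ⊓ V', ⟨hp, hp'⟩, fun i => Sum.elim (fun i => (E.res j (b i), (0 : E'.obj _)))
      (fun i => ((0 : E.obj _), E'.res j' (b' i))) (finSumFinEquiv.symm i), fun k => ?_⟩
    have := (h.reindex finSumFinEquiv.symm) _ k
    exact ⟨this.1, this.2.trans Submodule.prod_top⟩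

lemma isVectorBundle_hyp {m : ℕ} (hE : E.IsVectorBundle m) :
    E.hyp.IsVectorBundle (1 + (m + 1)) := by
  rw [hyp_eq_prod]
  exact isVectorBundle_prod (isVectorBundle_unit S) (isVectorBundle_prod hE (isVectorBundle_unit S))

end ModulePresheaf

/-! ### Subbundles -/

section OpenLE

variable {S : Scheme.{u}} {T : Over S}

/-- The inclusion of an open subscheme in a larger one. -/
noncomputable def openLE {V V' : T.left.Opens} (h : V ≤ V') : openOver T V ⟶ openOver T V' :=
  (exists_lift_openIncl V' (openIncl T V) fun t => h (openIncl_left_mem t)).choose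

lemma openLE_openIncl {V V' : T.left.Opens} (h : V ≤ V') :
    openLE h ≫ openIncl T V' = openIncl T V :=
  (exists_lift_openIncl V' (openIncl T V) fun t => h (openIncl_left_mem t)).choose_spec

instance isOpenImmersion_comp_left {T' T'' : Over S} (f : T'' ⟶ T') (g : T' ⟶ T)
    [IsOpenImmersion f.left] [IsOpenImmersion g.left] : IsOpenImmersion (f ≫ g).left := by
  rw [Over.comp_left]
  infer_instance

lemma exists_affine_openOver (p : T.left) (V : T.left.Opens) (hp : p ∈ V) :
    ∃ W : T.left.Opens, p ∈ W ∧ W ≤ V ∧ IsAffine (openOver T W).left := by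
  obtain ⟨W, hW, hpW, hWV⟩ := exists_isAffineOpen_mem_and_subset hp
  exact ⟨W, hpW, hWV, hW⟩

end OpenLE

namespace ModulePresheaf

variable {S : Scheme.{u}} {E : ModulePresheaf S}

/-- The submodules `N`, given over all schemes over `T`, form a subbundle of rank `m` of the
pullback of `E` to `T`: they are stable under pullback, membership is local, and there are local
frames. -/
structure IsSubbundle {T : Over S}
    (N : ∀ T' : Over S, (T' ⟶ T) → Submodule Γ(T'.left, ⊤) (E.obj T')) (m : ℕ) : Prop where
  res_mem : ∀ {T'' T' : Over S} (k : T'' ⟶ T') (h : T' ⟶ T) (x : E.obj T'),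
    x ∈ N T' h → E.res k x ∈ N T'' (k ≫ h)
  mem_of_locally_mem : ∀ {T' : Over S} (h : T' ⟶ T) (x : E.obj T'),
    (∀ p : T'.left, ∃ V : T'.left.Opens, p ∈ V ∧
      E.res (openIncl T' V) x ∈ N _ (openIncl T' V ≫ h)) → x ∈ N T' h
  exists_frame : ∀ p : T.left, ∃ V : T.left.Opens, p ∈ V ∧
    ∃ b : Fin m → E.obj (openOver T V), IsFrame (fun T' k => N T' (k ≫ openIncl T V)) b

lemma SympSubbundle.isSubbundle {φ : E.AltForm} {m : ℕ} {T : Over S} (W : SympSubbundle φ m T) :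
    IsSubbundle (fun _ h => W.sec h) m where
  res_mem := W.res_mem
  mem_of_locally_mem := W.mem_of_locally_mem
  exists_frame p := by
    obtain ⟨V, hp, b, hb⟩ := W.exists_frame p
    exact ⟨V, hp, b, fun _ k => hb k⟩

section

variable {T : Over S} {N : ∀ T' : Over S, (T' ⟶ T) → Submodule Γ(T'.left, ⊤) (E.obj T')} {m : ℕ}

/-- Frames over open immersions give frames over open subschemes. -/
lemma exists_frame_of_isOpenImmersion {D : Over S} (j : D ⟶ T) [IsOpenImmersion j.left]
    {ι : Type*} (b : ι → E.obj D) (hb : IsFrame (fun T' k => N T' (k ≫ j)) b) (p : D.left) :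
    ∃ V : T.left.Opens, j.left p ∈ V ∧
      ∃ b : ι → E.obj (openOver T V), IsFrame (fun T' k => N T' (k ≫ openIncl T V)) b := by
  obtain ⟨g, hg⟩ := exists_lift_of_isOpenImmersion j (openIncl T j.left.opensRange)
    fun t => openIncl_left_mem t
  refine ⟨j.left.opensRange, ⟨p, rfl⟩, fun i => E.res g (b i), ?_⟩
  · have := hb.res g
    simp only [Category.assoc, hg] at this
    exact this

lemma IsFrame.restrict {V V' : T.left.Opens} {ι : Type*} {b : ι → E.obj (openOver T V')}
    (hb : IsFrame (fun T' k => N T' (k ≫ openIncl T V')) b) (h : V ≤ V') :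
    IsFrame (fun T' k => N T' (k ≫ openIncl T V)) (fun i => E.res (openLE h) (b i)) := by
  have := hb.res (openLE h)
  simp only [Category.assoc, openLE_openIncl] at this
  exact this

/-- Every point has arbitrarily small affine open neighbourhoods with a frame. -/
lemma IsSubbundle.exists_affine_frame (hN : IsSubbundle N m) (p : T.left) (O : T.left.Opens)
    (hp : p ∈ O) : ∃ V : T.left.Opens, p ∈ V ∧ V ≤ O ∧ IsAffine (openOver T V).left ∧
      ∃ b : Fin m → E.obj (openOver T V), IsFrame (fun T' k => N T' (k ≫ openIncl T V)) b := by
  obtain ⟨V, hpV, b, hb⟩ := hN.exists_frame p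
  obtain ⟨W, hpW, hWV, hW⟩ := exists_affine_openOver p (V ⊓ O) ⟨hpV, hp⟩
  exact ⟨W, hpW, hWV.trans inf_le_right, hW, _, hb.restrict (hWV.trans inf_le_left)⟩

lemma IsSubbundle.pullback (hN : IsSubbundle N m) {T₁ : Over S} (g : T₁ ⟶ T) :
    IsSubbundle (fun T' k => N T' (k ≫ g)) m where
  res_mem k h x hx := by
    rw [Category.assoc]
    exact hN.res_mem k (h ≫ g) x hx
  mem_of_locally_mem h x hx := hN.mem_of_locally_mem (h ≫ g) x fun p => by
    obtain ⟨V, hp, hV⟩ := hx p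
    rw [Category.assoc] at hV
    exact ⟨V, hp, hV⟩
  exists_frame p := by
    obtain ⟨V, hp, b, hb⟩ := hN.exists_frame (g.left p)
    have := hb.res (preIncl g V)
    simp only [Category.assoc, preIncl_openIncl] at this
    refine ⟨preOpen g V, hp, fun i => E.res (preIncl g V) (b i), ?_⟩
    · simp only [Category.assoc]
      exact this

lemma sum_smul_sub_smul {R M : Type*} [CommRing R] [AddCommGroup M] [Module R M] {ι : Type*}
    [Fintype ι] (a t : ι → R) (v : ι → M) (w : M) :
    ∑ j, a j • (v j - t j • w) = (-∑ j, a j * t j) • w + ∑ j, a j • v j := by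
  simp only [smul_sub, Finset.sum_sub_distrib, smul_smul, neg_smul, Finset.sum_smul]
  abel

/-- The kernel of a linear functional on a subbundle which locally takes the value `1` is a
subbundle, of rank one less. -/
lemma IsSubbundle.ker (hN : IsSubbundle N (m + 1))
    (l : ∀ T' : Over S, (T' ⟶ T) → E.obj T' →ₗ[Γ(T'.left, ⊤)] Γ(T'.left, ⊤))
    (l_res : ∀ {T'' T' : Over S} (k : T'' ⟶ T') (h : T' ⟶ T) (x : E.obj T'),
      l T'' (k ≫ h) (E.res k x) = k.left.appTop.hom (l T' h x))
    (l_one : ∀ p : T.left, ∃ V : T.left.Opens, p ∈ V ∧ ∃ f ∈ N _ (openIncl T V),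
      l _ (openIncl T V) f = 1) :
    IsSubbundle (fun T' h => N T' h ⊓ LinearMap.ker (l T' h)) m where
  res_mem k h x hx := ⟨hN.res_mem k h x hx.1, by
    rw [SetLike.mem_coe, LinearMap.mem_ker, l_res, LinearMap.mem_ker.mp hx.2, map_zero]⟩
  mem_of_locally_mem h x hx := by
    refine ⟨hN.mem_of_locally_mem h x fun p => ?_, ?_⟩
    · obtain ⟨V, hp, hV⟩ := hx p
      exact ⟨V, hp, hV.1⟩
    · refine function_eq_of_locally _ _ fun p => ?_
      obtain ⟨V, hp, hV⟩ := hx p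
      refine ⟨V, hp, ?_⟩
      rw [← l_res, map_zero]
      exact hV.2
  exists_frame p := by
    obtain ⟨V₀, hp₀, f₀, hf₀, hlf₀⟩ := l_one p
    obtain ⟨V, hp, hV, -, b, hb⟩ := hN.exists_affine_frame p V₀ hp₀
    have hf := hN.res_mem (openLE hV) _ f₀ hf₀
    rw [openLE_openIncl, ← Category.id_comp (openIncl T V)] at hf
    obtain ⟨a, ha⟩ := hb.exists_coord hf
    simp only [E.res_id] at ha
    have hla : ∑ i, a i * l _ (openIncl T V) (b i) = 1 := by
      have h1 := l_res (openLE hV) (openIncl T V₀) f₀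
      rw [hlf₀, map_one, openLE_openIncl, ← ha, map_sum] at h1
      rw [← h1]
      exact Finset.sum_congr rfl fun i _ => ((l _ _).map_smul _ _).symm
    obtain ⟨q, hq⟩ := exists_openIncl_left_eq hp
    obtain ⟨i₀, hi₀⟩ := exists_mem_basicOpen_of_sum_mul_eq_one _ _ hla q
    -- where `l (b i₀)` is invertible, the kernel has the frame `b i - t i • b i₀` for `i ≠ i₀`,
    -- with `t i = l (b i) / l (b i₀)`
    let O := (openOver T V).left.basicOpen (l _ (openIncl T V) (b i₀))
    let j : openOver (openOver T V) O ⟶ openOver T V := openIncl _ O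
    have hu : IsUnit (l _ (j ≫ openIncl T V) (E.res j (b i₀))) := by
      rw [l_res]
      exact isUnit_pullback_basicOpen _ j fun t => openIncl_left_mem t
    obtain ⟨s, hs⟩ := hu.exists_left_inv
    have hb' := hb.res j
    simp only [Category.assoc] at hb'
    generalize hc : (fun i => E.res j (b i)) = c at hb'
    have hci : ∀ i, E.res j (b i) = c i := fun i => congrFun hc i
    rw [hci] at hs
    set h₀ := j ≫ openIncl T V with hh₀
    let t : Fin m → Γ((openOver (openOver T V) O).left, ⊤) := fun i =>
      l _ h₀ (c (i₀.succAbove i)) * s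
    have hframe : IsFrame (fun T' k => N T' (k ≫ h₀) ⊓ LinearMap.ker (l T' (k ≫ h₀)))
        (fun i => c (i₀.succAbove i) - t i • c i₀) := by
      have hsum : ∀ (T' : Over S) (k : T' ⟶ _) (a : Fin m → Γ(T'.left, ⊤)),
          ∑ i, a i • E.res k (c (i₀.succAbove i) - t i • c i₀) =
          (-∑ i, a i * k.left.appTop.hom (t i)) • E.res k (c i₀) +
            ∑ i, a i • E.res k (c (i₀.succAbove i)) := by
        intro T' k a
        rw [← sum_smul_sub_smul]
        simp only [map_sub, E.res_smul]
      refine IsFrame.of_coord ?_ ?_ ?_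
      · intro T' k i
        rw [map_sub, E.res_smul]
        refine ⟨sub_mem (hb'.res_mem k _) (Submodule.smul_mem _ _ (hb'.res_mem k _)), ?_⟩
        rw [SetLike.mem_coe, LinearMap.mem_ker, map_sub, LinearMap.map_smul, l_res, l_res,
          smul_eq_mul, ← map_mul, ← map_sub]
        have : t i * l _ h₀ (c i₀) = l _ h₀ (c (i₀.succAbove i)) := by
          simp only [t, mul_assoc, hs, mul_one]
        rw [this, sub_self, map_zero]
      · rintro T' k x ⟨hx, hlx⟩
        obtain ⟨a, rfl⟩ := hb'.exists_coord hx
        refine ⟨fun i => a (i₀.succAbove i), ?_⟩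
        rw [hsum, Fin.sum_univ_succAbove _ i₀]
        congr 2
        have h1 : ∑ i, a i * k.left.appTop.hom (l _ h₀ (c i)) = 0 := by
          rw [SetLike.mem_coe, LinearMap.mem_ker, map_sum] at hlx
          rw [← hlx]
          refine Finset.sum_congr rfl fun i _ => ?_
          rw [LinearMap.map_smul, l_res, smul_eq_mul]
        rw [Fin.sum_univ_succAbove _ i₀] at h1
        have h2 : k.left.appTop.hom s * k.left.appTop.hom (l _ h₀ (c i₀)) = 1 := by
          rw [← map_mul, hs, map_one]
        simp only [t, map_mul, ← mul_assoc]
        rw [← Finset.sum_mul]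
        linear_combination (-k.left.appTop.hom s) * h1 + a i₀ * h2
      · intro T' k a ha i
        rw [hsum] at ha
        have h0 : ∑ i',
            (i₀.insertNth (-∑ i, a i * k.left.appTop.hom (t i)) a : Fin (m + 1) → _) i' •
              E.res k (c i') = 0 := by
          rw [Fin.sum_univ_succAbove _ i₀]
          simpa using ha
        simpa using hb'.coord_eq_zero k h0 (i₀.succAbove i)
    obtain ⟨q', hq'⟩ := exists_openIncl_left_eq (T := openOver T V) (V := O) hi₀
    have hqp : h₀.left q' = p := by
      rw [← hq, ← hq']
      rfl
    obtain ⟨V', hpV', b', hb''⟩ := exists_frame_of_isOpenImmersion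
      (N := fun T' h => N T' h ⊓ LinearMap.ker (l T' h)) h₀ _ hframe q'
    rw [hqp] at hpV'
    exact ⟨V', hpV', b', hb''⟩

end

end ModulePresheaf

/-! ### Unimodular bilinear forms -/

section Unimodular

variable {R M : Type*} [CommRing R] [AddCommGroup M] [Module R M] (B : LinearMap.BilinForm R M)

/-- The restriction of `B` to `N` identifies `N` with its dual. -/
def UnimodularOn (N : Submodule R M) : Prop :=
  (∀ x ∈ N, (∀ y ∈ N, B x y = 0) → x = 0) ∧
    ∀ l : Module.Dual R N, ∃ x ∈ N, ∀ y : N, B x y = l y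

/-- `UnimodularOn` states the condition on symplectic subbundles in terms of elements, avoiding
the dual of the subtype. -/
lemma bijective_restrict_iff (N : Submodule R M) :
    Function.Bijective (B.restrict N : N → Module.Dual R N) ↔ UnimodularOn B N := by
  constructor
  · rintro ⟨h1, h2⟩
    refine ⟨fun x hx h => ?_, fun l => ?_⟩
    · have : (⟨x, hx⟩ : N) = 0 := h1 (by
        ext y
        simpa using h y y.2)
      exact congrArg Subtype.val this
    · obtain ⟨x, hx⟩ := h2 l
      exact ⟨x, x.2, fun y => by rw [← hx]; rfl⟩
  · rintro ⟨h1, h2⟩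
    constructor
    · rw [injective_iff_map_eq_zero]
      intro x hx
      exact Subtype.ext (h1 x x.2 fun y hy => LinearMap.congr_fun hx ⟨y, hy⟩)
    · intro l
      obtain ⟨x, hx, h⟩ := h2 l
      exact ⟨⟨x, hx⟩, LinearMap.ext h⟩

lemma bijective_iff :
    Function.Bijective (B : M → Module.Dual R M) ↔
      (∀ x, (∀ y, B x y = 0) → x = 0) ∧ ∀ l : Module.Dual R M, ∃ x, ∀ y, B x y = l y := by
  constructor
  · rintro ⟨h1, h2⟩
    refine ⟨fun x h => (injective_iff_map_eq_zero _).mp h1 x (LinearMap.ext h), fun l => ?_⟩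
    obtain ⟨x, hx⟩ := h2 l
    exact ⟨x, fun y => LinearMap.congr_fun hx y⟩
  · rintro ⟨h1, h2⟩
    refine ⟨(injective_iff_map_eq_zero _).mpr fun x hx => h1 x fun y => LinearMap.congr_fun hx y,
      fun l => ?_⟩
    obtain ⟨x, hx⟩ := h2 l
    exact ⟨x, LinearMap.ext hx⟩

variable {B} {ι : Type*} [Fintype ι] [DecidableEq ι] {b : ι → M}

omit [DecidableEq ι] in
lemma sum_smul_left_apply (a : ι → R) (b : ι → M) (z : M) :
    B (∑ i, a i • b i) z = ∑ i, a i * B (b i) z := by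
  simp [map_sum, LinearMap.sum_apply]

/-- If the Gram matrix of `b` is invertible, every family of values on `b` is the pairing with a
combination of `b`. -/
lemma gram_exists (hb : IsUnit (Matrix.of fun i j => B (b i) (b j)).det) (c : ι → R) :
    ∃ a : ι → R, ∀ j, B (∑ i, a i • b i) (b j) = c j := by
  refine ⟨Matrix.vecMul c (Matrix.of fun i j => B (b i) (b j))⁻¹, fun j => ?_⟩
  rw [sum_smul_left_apply]
  have := congrFun (Matrix.vecMul_vecMul c (Matrix.of fun i j => B (b i) (b j))⁻¹
    (Matrix.of fun i j => B (b i) (b j))) j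
  rw [Matrix.nonsing_inv_mul _ hb, Matrix.vecMul_one] at this
  exact this

lemma gram_unique (hb : IsUnit (Matrix.of fun i j => B (b i) (b j)).det) (a : ι → R)
    (h : ∀ j, B (∑ i, a i • b i) (b j) = 0) : a = 0 := by
  have h0 : Matrix.vecMul a (Matrix.of fun i j => B (b i) (b j)) = 0 := by
    funext j
    have := h j
    rw [sum_smul_left_apply] at this
    exact this
  have := Matrix.vecMul_vecMul a (Matrix.of fun i j => B (b i) (b j))
    (Matrix.of fun i j => B (b i) (b j))⁻¹
  rwa [h0, Matrix.zero_vecMul, Matrix.mul_nonsing_inv _ hb, Matrix.vecMul_one, eq_comm] at this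

lemma linearIndependent_of_gram (hb : IsUnit (Matrix.of fun i j => B (b i) (b j)).det) :
    LinearIndependent R b := by
  rw [Fintype.linearIndependent_iff]
  intro a ha i
  rw [gram_unique hb a fun j => by rw [ha, map_zero, LinearMap.zero_apply]]
  rfl

omit [Fintype ι] [DecidableEq ι] in
lemma form_eq_of_span {N : Submodule R M} (hN : Submodule.span R (Set.range b) = N) {x y : M}
    (h : ∀ j, B x (b j) = B y (b j)) : ∀ z ∈ N, B x z = B y z := by
  intro z hz
  rw [← hN] at hz
  induction hz using Submodule.span_induction with
  | mem z hz =>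
    obtain ⟨j, rfl⟩ := hz
    exact h j
  | zero => simp
  | add z w _ _ hz hw => rw [map_add, map_add, hz, hw]
  | smul a z _ hz => rw [map_smul, map_smul, hz]

lemma unimodularOn_span_of_gram (hb : IsUnit (Matrix.of fun i j => B (b i) (b j)).det) :
    UnimodularOn B (Submodule.span R (Set.range b)) := by
  refine ⟨fun x hx h => ?_, fun l => ?_⟩
  · obtain ⟨a, rfl⟩ := (Submodule.mem_span_range_iff_exists_fun _).mp hx
    rw [gram_unique hb a fun j => h _ (Submodule.subset_span ⟨j, rfl⟩)]
    simp
  · have hmem : ∀ j, b j ∈ Submodule.span R (Set.range b) := fun j =>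
      Submodule.subset_span ⟨j, rfl⟩
    obtain ⟨a, ha⟩ := gram_exists hb fun j => l ⟨b j, hmem j⟩
    refine ⟨∑ i, a i • b i, Submodule.sum_mem _ fun i _ => Submodule.smul_mem _ _ (hmem i), ?_⟩
    rintro ⟨z, hz⟩
    induction hz using Submodule.span_induction with
    | mem z hz =>
      obtain ⟨j, rfl⟩ := hz
      exact ha j
    | zero => exact (map_zero _).trans (map_zero l).symm
    | add z w h1 h2 hz hw =>
      refine (map_add _ _ _).trans ?_
      rw [hz, hw, ← map_add]
      rfl
    | smul a z h1 hz =>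
      refine (map_smul _ _ _).trans ?_
      rw [hz, ← map_smul]
      rfl

/-- The elements that represent the dual basis give a left inverse of the Gram matrix. -/
lemma isUnit_gram_of_unimodularOn {N : Submodule R M} (hb : LinearIndependent R b)
    (hN : Submodule.span R (Set.range b) = N) (h : UnimodularOn B N) :
    IsUnit (Matrix.of fun i j => B (b i) (b j)).det := by
  subst hN
  let β : Module.Basis ι R (Submodule.span R (Set.range b)) := Module.Basis.span hb
  choose x hx hxl using fun j => h.2 (β.coord j)
  choose a ha using fun j => (Submodule.mem_span_range_iff_exists_fun R).mp (hx j)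
  refine Matrix.isUnit_det_of_left_inverse (B := Matrix.of a) ?_
  ext j i
  rw [Matrix.mul_apply]
  have h1 := hxl j (β i)
  rw [β.coord_apply, β.repr_self, ← ha j, sum_smul_left_apply] at h1
  simp only [β, Module.Basis.span_apply] at h1
  rw [Matrix.one_apply]
  refine h1.trans ?_
  rw [Finsupp.single_apply]
  simp only [eq_comm]

/-- An orthogonal direct summand of a unimodular form is unimodular. -/
lemma unimodularOn_of_projection {N : Submodule R M}
    (hB : Function.Bijective (B : M → Module.Dual R M))
    (h : ∀ x, ∃ y ∈ N, ∀ z ∈ N, B x z = B y z)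
    (hB' : ∀ x y, B x y = -B y x) : UnimodularOn B N := by
  rw [bijective_iff] at hB
  have h1 : ∀ x ∈ N, (∀ y ∈ N, B x y = 0) → x = 0 := by
    intro x hx hxN
    refine hB.1 x fun z => ?_
    obtain ⟨y, hy, hyz⟩ := h z
    rw [hB', hyz x hx, ← hB', hxN y hy]
  refine ⟨h1, fun l => ?_⟩
  choose p hpN hp using h
  -- the orthogonal projection to `N` is linear by the uniqueness `h1`
  have p_unique : ∀ x y, y ∈ N → (∀ z ∈ N, B x z = B y z) → p x = y := fun x y hy hxy =>
    sub_eq_zero.mp (h1 _ (sub_mem (hpN x) hy) fun z hz => by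
      rw [map_sub, LinearMap.sub_apply, ← hp x z hz, hxy z hz, sub_self])
  let P : M →ₗ[R] N :=
    { toFun := fun x => ⟨p x, hpN x⟩
      map_add' := fun x y => Subtype.ext (p_unique _ _ (add_mem (hpN x) (hpN y)) fun z hz => by
        change _ = B (p x + p y) z
        rw [map_add, map_add, LinearMap.add_apply, LinearMap.add_apply, hp x z hz, hp y z hz])
      map_smul' := fun a x => Subtype.ext (p_unique _ _ (N.smul_mem a (hpN x)) fun z hz => by
        change _ = B (a • p x) z
        rw [map_smul, map_smul, LinearMap.smul_apply, LinearMap.smul_apply, hp x z hz]) }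
  obtain ⟨x, hx⟩ := hB.2 (l.comp P)
  refine ⟨p x, hpN x, fun y => ?_⟩
  rw [← hp x y y.2, hx]
  have : P y = y := Subtype.ext (p_unique y y y.2 fun _ _ => rfl)
  rw [LinearMap.comp_apply, this]

end Unimodular

/-! ### Symplectic subbundles from frames -/

namespace ModulePresheaf

variable {S : Scheme.{u}} {E : ModulePresheaf S} {φ : E.AltForm}

lemma section_exists_of_locally
    (hE : Presieve.IsSheaf (Scheme.zariskiTopology.{u}.over S) E.toPresheaf) {T : Over S}
    (Q : ∀ {T' : Over S}, (T' ⟶ T) → E.obj T' → Prop)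
    (Q_res : ∀ {T'' T' : Over S} (k : T'' ⟶ T') (h : T' ⟶ T) (x : E.obj T'),
      Q h x → Q (k ≫ h) (E.res k x))
    (Q_unique : ∀ {T' : Over S} (h : T' ⟶ T) (x y : E.obj T'), Q h x → Q h y → x = y)
    (Q_local : ∀ p : T.left, ∃ V : T.left.Opens, p ∈ V ∧ ∃ x, Q (openIncl T V) x) :
    ∃ x : E.obj T, ∀ p : T.left, ∃ V : T.left.Opens, p ∈ V ∧
      Q (openIncl T V) (E.res (openIncl T V) x) :=
  exists_of_locally_exists hE Q Q_res Q_unique Q_local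

lemma AltForm.form_swap (φ : E.AltForm) {T : Over S} (x y : E.obj T) :
    φ.form T x y = -φ.form T y x := by
  have h := φ.alt T (x + y)
  rw [map_add, map_add, LinearMap.add_apply, LinearMap.add_apply, φ.alt, φ.alt] at h
  linear_combination h

/-- The Gram matrix of a family of sections. -/
def gram (φ : E.AltForm) {T : Over S} {ι : Type*} (b : ι → E.obj T) : Matrix ι ι Γ(T.left, ⊤) :=
  Matrix.of fun i j => φ.form T (b i) (b j)

lemma det_gram_res {T' T : Over S} (k : T' ⟶ T) {ι : Type*} [Fintype ι] [DecidableEq ι]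
    (b : ι → E.obj T) :
    (gram φ fun i => E.res k (b i)).det = k.left.appTop.hom (gram φ b).det := by
  rw [RingHom.map_det]
  congr 1
  ext i j
  exact φ.res_form k _ _

lemma isUnit_gram_res {T' T : Over S} (k : T' ⟶ T) {ι : Type*} [Fintype ι] [DecidableEq ι]
    {b : ι → E.obj T} (hb : IsUnit (gram φ b).det) :
    IsUnit (gram φ fun i => E.res k (b i)).det := by
  rw [det_gram_res]
  exact hb.map _

lemma SympSubbundle.unimodularOn {m : ℕ} {T : Over S} (W : SympSubbundle φ m T) {T' : Over S}
    (h : T' ⟶ T) (hT' : IsAffine T'.left) : UnimodularOn (φ.form T') (W.sec h) :=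
  (bijective_restrict_iff _ _).mp (W.isSymplectic h hT')

/-- Every frame of a symplectic subbundle has an invertible Gram matrix. -/
lemma SympSubbundle.isUnit_gram {m : ℕ} {T : Over S} (W : SympSubbundle φ m T) {D : Over S}
    (j : D ⟶ T) {ι : Type*} [Fintype ι] [DecidableEq ι] {b : ι → E.obj D}
    (hb : IsFrame (fun _ k => W.sec (k ≫ j)) b) : IsUnit (gram φ b).det := by
  refine isUnit_of_locally _ fun p => ?_
  obtain ⟨V, hp, -, hV⟩ := exists_affine_openOver p ⊤ trivial
  refine ⟨V, hp, ?_⟩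
  rw [← det_gram_res]
  exact isUnit_gram_of_unimodularOn (hb _ _).1 (hb _ (openIncl D V)).2
    (W.unimodularOn (openIncl D V ≫ j) hV)

/-- The symplectic subbundle with a given global frame with invertible Gram matrix. -/
def SympSubbundle.ofFrame
    (hE : Presieve.IsSheaf (Scheme.zariskiTopology.{u}.over S) E.toPresheaf) {T : Over S} {m : ℕ}
    (b : Fin m → E.obj T) (hb : IsUnit (gram φ b).det) : SympSubbundle φ m T where
  sec {T'} h := Submodule.span Γ(T'.left, ⊤) (Set.range fun i => E.res h (b i))
  res_mem k h x hx := by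
    obtain ⟨a, rfl⟩ := (Submodule.mem_span_range_iff_exists_fun _).mp hx
    refine (Submodule.mem_span_range_iff_exists_fun _).mpr ⟨fun i => k.left.appTop.hom (a i), ?_⟩
    rw [res_sum]
    simp only [E.res_comp]
  mem_of_locally_mem {T'} h x hx := by
    -- `x` agrees with its orthogonal projection to the span of `b`, as it does so locally
    obtain ⟨a, ha⟩ := gram_exists (isUnit_gram_res h hb) fun j => φ.form T' x (E.res h (b j))
    refine (Submodule.mem_span_range_iff_exists_fun _).mpr ⟨a, ?_⟩
    refine section_eq_of_locally hE _ _ fun p => ?_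
    obtain ⟨V, hp, hV⟩ := hx p
    obtain ⟨c, hc⟩ := (Submodule.mem_span_range_iff_exists_fun _).mp hV
    refine ⟨V, hp, ?_⟩
    set k := openIncl T' V
    have h0 := gram_unique (isUnit_gram_res (k ≫ h) hb)
      (fun i => k.left.appTop.hom (a i) - c i) fun j => by
        have h1 : ∑ i, (k.left.appTop.hom (a i) - c i) • E.res (k ≫ h) (b i) =
            E.res k (∑ i, a i • E.res h (b i)) - E.res k x := by
          rw [← hc, res_sum]
          simp only [sub_smul, Finset.sum_sub_distrib, E.res_comp]
        rw [h1, map_sub, LinearMap.sub_apply, E.res_comp, φ.res_form, φ.res_form]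
        rw [show φ.form T' (∑ i, a i • E.res h (b i)) (E.res h (b j)) = _ from ha j, sub_self]
    rw [← hc, res_sum]
    refine Finset.sum_congr rfl fun i _ => ?_
    rw [E.res_comp, sub_eq_zero.mp (congrFun h0 i)]
  exists_frame p := ⟨⊤, trivial, fun i => E.res (openIncl T ⊤) (b i), fun k => by
    have h : (fun i => E.res k (E.res (openIncl T ⊤) (b i))) =
        fun i => E.res (k ≫ openIncl T ⊤) (b i) := funext fun i => (E.res_comp _ _ _).symm
    rw [h]
    exact ⟨linearIndependent_of_gram (isUnit_gram_res _ hb), rfl⟩⟩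
  isSymplectic h _ := (bijective_restrict_iff _ _).mpr
    (unimodularOn_span_of_gram (isUnit_gram_res h hb))

section OfGram

variable {T : Over S} {N : ∀ T' : Over S, (T' ⟶ T) → Submodule Γ(T'.left, ⊤) (E.obj T')} {m : ℕ}

/-- The subbundle `N` has local frames with invertible Gram matrices. -/
def HasGramFrames (φ : E.AltForm)
    (N : ∀ T' : Over S, (T' ⟶ T) → Submodule Γ(T'.left, ⊤) (E.obj T')) (m : ℕ) : Prop :=
  ∀ p : T.left, ∃ V : T.left.Opens, p ∈ V ∧ ∃ b : Fin m → E.obj (openOver T V),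
    IsFrame (fun T' k => N T' (k ≫ openIncl T V)) b ∧ IsUnit (gram φ b).det

/-- A subbundle with local frames with invertible Gram matrices has orthogonal projections. They
exist locally, and are glued using their uniqueness. -/
lemma IsSubbundle.exists_projection (hN : IsSubbundle N m)
    (hE : Presieve.IsSheaf (Scheme.zariskiTopology.{u}.over S) E.toPresheaf)
    (hgram : HasGramFrames φ N m) {T' : Over S} (h : T' ⟶ T) (x : E.obj T') :
    ∃ y ∈ N T' h, ∀ z ∈ N T' h, φ.form T' x z = φ.form T' y z := by
  obtain ⟨y, hy⟩ := section_exists_of_locally hE (T := T') (fun {T''} k (y : E.obj T'') =>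
      y ∈ N T'' (k ≫ h) ∧ ∀ (T₃ : Over S) (l : T₃ ⟶ T''), ∀ z ∈ N T₃ (l ≫ k ≫ h),
        φ.form T₃ (E.res l (E.res k x)) z = φ.form T₃ (E.res l y) z)
    (fun k k' y hy => by
      refine ⟨?_, fun T₃ l z hz => ?_⟩
      · rw [Category.assoc]
        exact hN.res_mem k _ y hy.1
      · have := hy.2 T₃ (l ≫ k) z (by simpa only [Category.assoc] using hz)
        rw [E.res_comp, E.res_comp] at this
        rw [E.res_comp k k', this])
    (fun {T''} k y y' hy hy' => by
      refine section_eq_of_locally hE _ _ fun p => ?_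
      obtain ⟨V, hV, b, hb, hbg⟩ := hgram ((k ≫ h).left p)
      refine ⟨preOpen (k ≫ h) V, hV, ?_⟩
      set l := openIncl T'' (preOpen (k ≫ h) V)
      have hfr := hb.res (preIncl (k ≫ h) V)
      simp only [Category.assoc, preIncl_openIncl] at hfr
      have hfr' := hfr _ (𝟙 _)
      simp only [Category.id_comp, E.res_id] at hfr'
      have hz : ∀ z ∈ N _ (l ≫ k ≫ h), φ.form _ (E.res l y - E.res l y') z = 0 := fun z hz => by
        rw [map_sub, LinearMap.sub_apply, ← hy.2 _ l z hz, ← hy'.2 _ l z hz, sub_self]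
      have hmem : E.res l y - E.res l y' ∈ N _ (l ≫ k ≫ h) :=
        sub_mem (hN.res_mem _ _ _ hy.1) (hN.res_mem _ _ _ hy'.1)
      have hu := unimodularOn_span_of_gram (isUnit_gram_res (preIncl (k ≫ h) V) hbg)
      rw [hfr'.2] at hu
      exact sub_eq_zero.mp (hu.1 _ hmem hz))
    (fun p => by
      obtain ⟨V, hV, b, hb, hbg⟩ := hgram (h.left p)
      refine ⟨preOpen h V, hV, ?_⟩
      set l := openIncl T' (preOpen h V)
      have hfr := hb.res (preIncl h V)
      simp only [Category.assoc, preIncl_openIncl] at hfr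
      have hcg := isUnit_gram_res (preIncl h V) hbg
      generalize (fun i => E.res (preIncl h V) (b i)) = c at hfr hcg
      obtain ⟨a, ha⟩ := gram_exists hcg fun j => φ.form _ (E.res l x) (c j)
      refine ⟨∑ i, a i • c i, ?_, fun T₃ l' z hz => ?_⟩
      · have := hfr.coord_mem (𝟙 _) a
        simpa only [Category.id_comp, E.res_id] using this
      · refine form_eq_of_span (hfr _ l').2 (fun j => ?_) z hz
        rw [φ.res_form, φ.res_form, ← ha j])
  refine ⟨y, hN.mem_of_locally_mem _ _ fun p => ?_, fun z hz => ?_⟩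
  · obtain ⟨V, hp, hV⟩ := hy p
    exact ⟨V, hp, hV.1⟩
  · refine function_eq_of_locally _ _ fun p => ?_
    obtain ⟨V, hp, hV⟩ := hy p
    refine ⟨V, hp, ?_⟩
    have h1 := hV.2 _ (𝟙 _) (E.res (openIncl T' V) z) (by
      rw [Category.id_comp]
      exact hN.res_mem _ _ _ hz)
    rw [E.res_id, E.res_id] at h1
    rw [← φ.res_form, ← φ.res_form]
    exact h1

/-- A subbundle of a symplectic bundle with local frames with invertible Gram matrices is a
symplectic subbundle. -/
def SympSubbundle.ofGram (hE : Presieve.IsSheaf (Scheme.zariskiTopology.{u}.over S) E.toPresheaf)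
    (hφ : φ.IsSymplectic) (hN : IsSubbundle N m) (hgram : HasGramFrames φ N m) :
    SympSubbundle φ m T where
  sec {T'} h := N T' h
  res_mem := hN.res_mem
  mem_of_locally_mem := hN.mem_of_locally_mem
  exists_frame p := by
    obtain ⟨V, hp, b, hb⟩ := hN.exists_frame p
    exact ⟨V, hp, b, fun k => hb _ k⟩
  isSymplectic h hT' := (bijective_restrict_iff _ _).mpr
    (unimodularOn_of_projection (hφ _ hT') (hN.exists_projection hE hgram h) φ.form_swap)

end OfGram

end ModulePresheaf

/-! ### The sheaf of symplectic subbundles -/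

section Small

variable {S : Scheme.{u}} (F : (Over S)ᵒᵖ ⥤ Type w) [∀ T, Small.{u} (F.obj T)]

/-- A presheaf with small sets of sections, as a presheaf in the smaller universe. -/
noncomputable def shrinkPresheaf : (Over S)ᵒᵖ ⥤ Type u where
  obj T := Shrink.{u} (F.obj T)
  map h := ↾fun x => equivShrink _ (F.map h ((equivShrink _).symm x))
  map_id T := by
    apply ConcreteCategory.hom_ext
    intro x
    simp
  map_comp h k := by
    apply ConcreteCategory.hom_ext
    intro x
    simp

variable {F}

lemma shrinkPresheaf_map {T T' : (Over S)ᵒᵖ} (h : T ⟶ T') (x : F.obj T) :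
    (shrinkPresheaf F).map h (equivShrink _ x) = equivShrink _ (F.map h x) := by
  change equivShrink _ (F.map h ((equivShrink _).symm (equivShrink _ x))) = _
  rw [Equiv.symm_apply_apply]

/-- The sheaf condition does not depend on the universe of the sets of sections. -/
lemma isSheaf_shrinkPresheaf (hF : Presieve.IsSheaf (Scheme.zariskiTopology.{u}.over S) F) :
    Presieve.IsSheaf (Scheme.zariskiTopology.{u}.over S) (shrinkPresheaf F) := by
  rw [isSheaf_over_iff] at hF ⊢
  intro T ι V hV
  refine (Presieve.isSheafFor_arrows_iff _ _).mpr fun x hx => ?_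
  obtain ⟨y, rfl⟩ : ∃ y : ∀ i, F.obj (op (openOver T (V i))), x = fun i => equivShrink _ (y i) :=
    ⟨fun i => (equivShrink _).symm (x i), funext fun i => ((equivShrink _).apply_symm_apply _).symm⟩
  obtain ⟨z, hz, hz'⟩ := (Presieve.isSheafFor_arrows_iff _ _).mp (hF T ι V hV) y
    fun i j Z a b hab => by
      have := hx i j Z a b hab
      rw [shrinkPresheaf_map, shrinkPresheaf_map] at this
      exact (equivShrink _).injective this
  refine ⟨equivShrink _ z, fun i => ?_, fun w hw => ?_⟩
  · rw [shrinkPresheaf_map, hz]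
  · obtain ⟨w, rfl⟩ := (equivShrink _).surjective w
    refine congrArg _ (hz' w fun i => ?_)
    have := hw i
    rw [shrinkPresheaf_map] at this
    exact (equivShrink _).injective this

/-- The representability criterion for sheaves in a larger universe with small sets of sections. -/
theorem exists_representing_of_small
    (hF : Presieve.IsSheaf (Scheme.zariskiTopology.{u}.over S) F)
    {ι : Type u} (H : ι → Over S) (x : ∀ i, F.obj (op (H i)))
    (x_mono : ∀ i (T : Over S) (k k' : T ⟶ H i), F.map k.op (x i) = F.map k'.op (x i) → k = k')
    (x_open : ∀ i (T T' : Over S) (y : F.obj (op T)) (k : T' ⟶ T) (l : T' ⟶ H i),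
      F.map l.op (x i) = F.map k.op y → ∀ t : T'.left, ∃ V : T.left.Opens, k.left t ∈ V ∧
        ∃ m : openOver T V ⟶ H i, F.map m.op (x i) = F.map (openIncl T V).op y)
    (x_cover : ∀ (T : Over S) (y : F.obj (op T)) (p : T.left), ∃ i, ∃ V : T.left.Opens, p ∈ V ∧
        ∃ m : openOver T V ⟶ H i, F.map m.op (x i) = F.map (openIncl T V).op y) :
    ∃ (X : Over S) (z : F.obj (op X)), ∀ (T : Over S) (y : F.obj (op T)),
      ∃! k : T ⟶ X, F.map k.op z = y := by
  obtain ⟨X, z, hz⟩ := exists_representing (isSheaf_shrinkPresheaf hF) H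
    (fun i => equivShrink _ (x i))
    (fun i T k k' h => by
      rw [shrinkPresheaf_map, shrinkPresheaf_map] at h
      exact x_mono i T k k' ((equivShrink _).injective h))
    (fun i T T' y k l h t => by
      obtain ⟨y, rfl⟩ := (equivShrink _).surjective y
      rw [shrinkPresheaf_map, shrinkPresheaf_map] at h
      obtain ⟨V, hV, m, hm⟩ := x_open i T T' y k l ((equivShrink _).injective h) t
      exact ⟨V, hV, m, by rw [shrinkPresheaf_map, shrinkPresheaf_map, hm]⟩)
    (fun T y p => by
      obtain ⟨y, rfl⟩ := (equivShrink _).surjective y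
      obtain ⟨i, V, hV, m, hm⟩ := x_cover T y p
      exact ⟨i, V, hV, m, by rw [shrinkPresheaf_map, shrinkPresheaf_map, hm]⟩)
  obtain ⟨z, rfl⟩ := (equivShrink _).surjective z
  refine ⟨X, z, fun T y => ?_⟩
  obtain ⟨k, hk, hk'⟩ := hz T (equivShrink _ y)
  rw [shrinkPresheaf_map] at hk
  exact ⟨k, (equivShrink _).injective hk, fun k' h =>
    hk' k' ((shrinkPresheaf_map k'.op z).trans (congrArg _ h))⟩

end Small

namespace ModulePresheaf

variable {S : Scheme.{u}} {E : ModulePresheaf S} {φ : E.AltForm} {m : ℕ}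

/-- An inclusion of subbundles can be checked over open subschemes, since there are frames over
them. -/
lemma IsSubbundle.le_of_frames {T : Over S}
    {N N' : ∀ T' : Over S, (T' ⟶ T) → Submodule Γ(T'.left, ⊤) (E.obj T')} {m' : ℕ}
    (hN : IsSubbundle N m) (hN' : IsSubbundle N' m')
    (h : ∀ V : T.left.Opens, N _ (openIncl T V) ≤ N' _ (openIncl T V)) {T' : Over S}
    (g : T' ⟶ T) : N T' g ≤ N' T' g := by
  intro x hx
  refine hN'.mem_of_locally_mem _ _ fun p => ?_
  obtain ⟨V, hp, b, hb⟩ := hN.exists_frame (g.left p)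
  refine ⟨preOpen g V, hp, ?_⟩
  have hx' := hN.res_mem (openIncl T' (preOpen g V)) g x hx
  rw [← preIncl_openIncl] at hx' ⊢
  obtain ⟨a, ha⟩ := hb.exists_coord hx'
  rw [← ha]
  refine Submodule.sum_mem _ fun i _ => Submodule.smul_mem _ _ (hN'.res_mem _ _ _ (h V ?_))
  have := hb.mem i
  rwa [Category.id_comp] at this

lemma SympSubbundle.ext_of_sec {T : Over S} {W W' : SympSubbundle φ m T}
    (h : ∀ (T' : Over S) (k : T' ⟶ T), W.sec k = W'.sec k) : W = W' := by
  refine SympSubbundle.ext ?_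
  funext T' k
  exact h T' k

lemma SympSubbundle.ext_of_opens {T : Over S} {W W' : SympSubbundle φ m T}
    (h : ∀ V : T.left.Opens, W.sec (openIncl T V) = W'.sec (openIncl T V)) : W = W' :=
  SympSubbundle.ext_of_sec fun _ k => le_antisymm
    (W.isSubbundle.le_of_frames W'.isSubbundle (fun V => (h V).le) k)
    (W'.isSubbundle.le_of_frames W.isSubbundle (fun V => (h V).ge) k)

/-- A symplectic subbundle is a family indexed by the large category of schemes over `T`, but it is
determined by its members over the open subschemes. -/
instance (T : Over S) : Small.{u} (SympSubbundle φ m T) :=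
  small_of_injective (β := ∀ V : T.left.Opens, Submodule Γ((openOver T V).left, ⊤)
    (E.obj (openOver T V))) (f := fun W V => W.sec (openIncl T V))
    fun _ _ h => SympSubbundle.ext_of_opens fun V => congrFun h V

/-- The pullback of a symplectic subbundle. -/
def SympSubbundle.pullback {T' T : Over S} (W : SympSubbundle φ m T) (g : T' ⟶ T) :
    SympSubbundle φ m T' where
  sec k := W.sec (k ≫ g)
  res_mem := (W.isSubbundle.pullback g).res_mem
  mem_of_locally_mem := (W.isSubbundle.pullback g).mem_of_locally_mem
  exists_frame p := by
    obtain ⟨V, hp, b, hb⟩ := (W.isSubbundle.pullback g).exists_frame p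
    exact ⟨V, hp, b, fun k => hb _ k⟩
  isSymplectic k := W.isSymplectic (k ≫ g)

/-- The presheaf of symplectic subbundles of rank `m`. -/
def sympPresheaf (φ : E.AltForm) (m : ℕ) : (Over S)ᵒᵖ ⥤ Type (u + 1) where
  obj T := SympSubbundle φ m T.unop
  map g := ↾fun W => W.pullback g.unop
  map_id T := by
    apply ConcreteCategory.hom_ext
    intro W
    refine SympSubbundle.ext_of_sec fun T' k => ?_
    change W.sec (k ≫ 𝟙 _) = W.sec k
    rw [Category.comp_id]
  map_comp g h := by
    apply ConcreteCategory.hom_ext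
    intro W
    refine SympSubbundle.ext_of_sec fun T' k => ?_
    change W.sec (k ≫ h.unop ≫ g.unop) = W.sec ((k ≫ h.unop) ≫ g.unop)
    rw [Category.assoc]

instance (T : (Over S)ᵒᵖ) : Small.{u} ((sympPresheaf φ m).obj T) :=
  inferInstanceAs (Small.{u} (SympSubbundle φ m T.unop))

/-- Symplectic subbundles of a symplectic bundle glue. -/
theorem isSheaf_sympPresheaf
    (hE : Presieve.IsSheaf (Scheme.zariskiTopology.{u}.over S) E.toPresheaf)
    (hφ : φ.IsSymplectic) (m : ℕ) :
    Presieve.IsSheaf (Scheme.zariskiTopology.{u}.over S) (sympPresheaf φ m) := by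
  rw [isSheaf_over_iff]
  intro T ι V hV
  refine (Presieve.isSheafFor_arrows_iff _ _).mpr fun (W : ∀ i, SympSubbundle φ m _) hW => ?_
  have hW' : ∀ {i j} {Z : Over S} (a : Z ⟶ openOver T (V i)) (b : Z ⟶ openOver T (V j)),
      a ≫ openIncl T (V i) = b ≫ openIncl T (V j) → (W i).sec a = (W j).sec b := by
    intro i j Z a b hab
    have h : (W i).pullback a = (W j).pullback b := hW i j Z a b hab
    have h' : ((W i).pullback a).sec (𝟙 Z) = ((W j).pullback b).sec (𝟙 Z) := by rw [h]
    change (W i).sec (𝟙 Z ≫ a) = (W j).sec (𝟙 Z ≫ b) at h'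
    rwa [Category.id_comp, Category.id_comp] at h'
  -- a section lies in the glued subbundle if it does so wherever this makes sense
  let N : ∀ T' : Over S, (T' ⟶ T) → Submodule Γ(T'.left, ⊤) (E.obj T') := fun T' h =>
    { carrier := {x | ∀ (i : ι) (T'' : Over S) (a : T'' ⟶ T') (b : T'' ⟶ openOver T (V i)),
        a ≫ h = b ≫ openIncl T (V i) → E.res a x ∈ (W i).sec b}
      add_mem' := fun hx hy i T'' a b hab => by
        rw [map_add]
        exact add_mem (hx i T'' a b hab) (hy i T'' a b hab)
      zero_mem' := fun i T'' a b hab => by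
        rw [map_zero]
        exact zero_mem _
      smul_mem' := fun c x hx i T'' a b hab => by
        rw [E.res_smul]
        exact Submodule.smul_mem _ _ (hx i T'' a b hab) }
  have hNW : ∀ (i : ι) (T' : Over S) (b : T' ⟶ openOver T (V i)),
      N T' (b ≫ openIncl T (V i)) = (W i).sec b := by
    intro i T' b
    refine le_antisymm (fun x hx => ?_) fun x hx j T'' a c hac => ?_
    · have := hx i T' (𝟙 _) b (Category.id_comp _)
      rwa [E.res_id] at this
    · rw [← Category.assoc] at hac
      rw [← hW' (a ≫ b) c hac]
      exact (W i).res_mem a b x hx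
  have hN_frame : HasGramFrames φ N m := by
    intro p
    -- a frame over an open subscheme of the member `V i` of the cover is one over an open subscheme
    -- of `T`
    obtain ⟨i, hi⟩ := hV p
    obtain ⟨q, rfl⟩ := exists_openIncl_left_eq hi
    obtain ⟨O, hq, b, hb⟩ := (W i).isSubbundle.exists_frame q
    have hb' : IsFrame (fun T' k => N T' (k ≫ openIncl _ O ≫ openIncl T (V i))) b := by
      intro T' k
      exact ⟨(hb T' k).1, (hb T' k).2.trans ((hNW i T' (k ≫ openIncl _ O)).symm.trans
        (congrArg (N T') (Category.assoc _ _ _)))⟩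
    obtain ⟨q', rfl⟩ := exists_openIncl_left_eq hq
    obtain ⟨g, hg⟩ := exists_lift_of_isOpenImmersion (openIncl _ O ≫ openIncl T (V i))
      (openIncl T (openIncl _ O ≫ openIncl T (V i)).left.opensRange) fun t => openIncl_left_mem t
    refine ⟨(openIncl _ O ≫ openIncl T (V i)).left.opensRange, ⟨q', rfl⟩,
      fun i => E.res g (b i), ?_, isUnit_gram_res g ((W i).isUnit_gram _ hb)⟩
    have := hb'.res g
    simp only [Category.assoc] at this
    rw [hg] at this
    exact this
  have hN : IsSubbundle N m :=
    { res_mem := fun k h x hx i T'' a b hab => by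
        rw [← E.res_comp]
        exact hx i T'' (a ≫ k) b (by rw [Category.assoc, hab])
      mem_of_locally_mem := fun {T'} h x hx i T'' a b hab => by
        refine (W i).mem_of_locally_mem _ _ fun p => ?_
        obtain ⟨O, hp, hO⟩ := hx (a.left p)
        refine ⟨preOpen a O, hp, ?_⟩
        have := hO i _ (preIncl a O) (openIncl T'' (preOpen a O) ≫ b) (by
          rw [← Category.assoc, preIncl_openIncl, Category.assoc, hab, Category.assoc])
        rwa [← E.res_comp, preIncl_openIncl, E.res_comp] at this
      exists_frame := fun p => by
        obtain ⟨O, hp, b, hb, -⟩ := hN_frame p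
        exact ⟨O, hp, b, hb⟩ }
  refine ⟨SympSubbundle.ofGram hE hφ hN hN_frame, fun i => SympSubbundle.ext_of_sec fun T' k =>
    hNW i T' k, fun (W' : SympSubbundle φ m T) hW' => ?_⟩
  have h1 : ∀ i (T' : Over S) (k : T' ⟶ openOver T (V i)),
      W'.sec (k ≫ openIncl T (V i)) = (W i).sec k := by
    intro i T' k
    rw [← hW' i]
    rfl
  refine SympSubbundle.ext_of_sec fun T' k => ?_
  change W'.sec k = N T' k
  refine le_antisymm (fun x hx i T'' a b hab => ?_) fun x hx => ?_
  · rw [← h1, ← hab]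
    exact W'.res_mem a k x hx
  · refine W'.mem_of_locally_mem _ _ fun p => ?_
    obtain ⟨i, hi⟩ := hV (k.left p)
    refine ⟨preOpen k (V i), hi, ?_⟩
    rw [← preIncl_openIncl, h1]
    exact hx i _ _ _ (preIncl_openIncl _ _).symm

end ModulePresheaf

/-! ### Residue fields and maximal minors -/

/-- A matrix with independent columns over a field has a nonzero maximal minor. -/
lemma exists_isUnit_det_submatrix {K : Type*} [Field K] {ι κ : Type*} [Fintype ι] [Fintype κ]
    [DecidableEq κ] (M : Matrix ι κ K) (hM : ∀ a, M.mulVec a = 0 → a = 0) :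
    ∃ I : κ ↪ ι, IsUnit (M.submatrix I id).det := by
  have hcol : LinearIndependent K M.col := by
    rw [← Matrix.mulVec_injective_iff]
    exact (injective_iff_map_eq_zero M.mulVecLin).mpr hM
  obtain ⟨κ', a, ha, hspan, hli⟩ := exists_linearIndependent' K M.row
  have : Fintype κ' := Fintype.ofInjective a ha
  have hcard : Fintype.card κ' = Fintype.card κ := by
    rw [← finrank_span_eq_card hli, hspan, ← Matrix.rank_eq_finrank_span_row,
      ← Matrix.rank_transpose]
    exact LinearIndependent.rank_matrix (M := M.transpose) hcol
  let e : κ ≃ κ' := (Fintype.equivOfCardEq hcard).symm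
  refine ⟨e.toEmbedding.trans ⟨a, ha⟩, ?_⟩
  rw [← Matrix.isUnit_iff_isUnit_det, ← Matrix.linearIndependent_rows_iff_isUnit]
  exact hli.comp e e.injective

/-- The previous lemma for a ring that merely satisfies the field axioms. -/
lemma exists_isUnit_det_submatrix_of_isField {K : Type*} [CommRing K] (hK : IsField K)
    {ι κ : Type*} [Fintype ι] [Fintype κ] [DecidableEq κ] (M : Matrix ι κ K)
    (hM : ∀ a, M.mulVec a = 0 → a = 0) : ∃ I : κ ↪ ι, IsUnit (M.submatrix I id).det :=
  let := hK.toField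
  exists_isUnit_det_submatrix M hM

section Points

variable {S : Scheme.{u}}

lemma pointIncl_left_apply (T : Over S) (p : T.left) (t : (pointOver T p).left) :
    (pointIncl T p).left t = p :=
  Scheme.fromSpecResidueField_apply _ _

/-- The functions on `Spec κ(p)` form a field, although the ring `Γ` carries no `Field` instance. -/
lemma isField_pointOver (T : Over S) (p : T.left) : IsField Γ((pointOver T p).left, ⊤) :=
  (Scheme.ΓSpecIso (T.left.residueField p)).commRingCatIsoToRingEquiv.toMulEquiv.isField
    (Field.toIsField _)

instance (T : Over S) (p : T.left) : Nonempty (pointOver T p).left :=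
  inferInstanceAs (Nonempty (Spec (T.left.residueField p)))

/-- A function is invertible near `p` if and only if its value in the residue field is. -/
lemma mem_basicOpen_iff_pointIncl {T : Over S} (a : Γ(T.left, ⊤)) (p : T.left) :
    p ∈ T.left.basicOpen a ↔ IsUnit ((pointIncl T p).left.appTop.hom a) := by
  obtain ⟨t⟩ : Nonempty (pointOver T p).left := inferInstance
  constructor
  · intro h
    exact isUnit_pullback_basicOpen a (pointIncl T p) fun t => by rwa [pointIncl_left_apply]
  · intro h
    have := mem_basicOpen_of_isUnit_pullback h t
    rwa [pointIncl_left_apply] at this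

end Points

/-! ### Existence of quaternionic Grassmannians -/

namespace ModulePresheaf

variable {S : Scheme.{u}} {E : ModulePresheaf S} {φ : E.AltForm} {m : ℕ}

/-- Data for a chart of the Grassmannian: a frame of `E` over an open subscheme of `S`, with the
first `m` of its sections singled out. -/
structure ChartData (E : ModulePresheaf S) (m : ℕ) where
  /-- The open subset of `S`. -/
  opens : S.Opens
  /-- The number of the remaining sections of the frame. -/
  d : ℕ
  /-- The frame. -/
  frame : Fin m ⊕ Fin d → E.obj (Over.mk opens.ι)
  isFrame : IsFrame (fun _ _ => ⊤) frame

namespace ChartData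

variable (c : ChartData E m)

/-- The open subscheme of the base, as a scheme over the base. -/
abbrev base : Over S := Over.mk c.opens.ι

lemma base_hom_ext {T : Over S} (t t' : T ⟶ c.base) : t = t' := by
  ext1
  exact (cancel_mono c.opens.ι).mp ((Over.w t).trans (Over.w t').symm)

/-- The affine space of matrices with `d` rows and `m` columns. -/
noncomputable abbrev aff : Over S := affOver c.base (ULift.{u} (Fin c.d × Fin m))

/-- The sections `b k + ∑ j, x j k • b j` of `E`, where `k` indexes the first `m` sections of the
frame and `j` the remaining ones. -/
noncomputable def columns {T : Over S} (t : T ⟶ c.base) (x : Fin c.d → Fin m → Γ(T.left, ⊤))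
    (k : Fin m) : E.obj T :=
  E.res t (c.frame (Sum.inl k)) + ∑ j, x j k • E.res t (c.frame (Sum.inr j))

lemma res_columns {T' T : Over S} (f : T' ⟶ T) (t : T ⟶ c.base)
    (x : Fin c.d → Fin m → Γ(T.left, ⊤)) (k : Fin m) :
    E.res f (c.columns t x k) = c.columns (f ≫ t) (fun j k => f.left.appTop.hom (x j k)) k := by
  rw [columns, map_add, res_sum, columns]
  simp only [E.res_comp]

lemma sum_smul_columns {T : Over S} (t : T ⟶ c.base) (x : Fin c.d → Fin m → Γ(T.left, ⊤))
    (a : Fin m → Γ(T.left, ⊤)) :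
    ∑ k, a k • c.columns t x k =
      ∑ i, Sum.elim a (fun j => ∑ k, a k * x j k) i • E.res t (c.frame i) := by
  simp only [columns, smul_add, Finset.sum_add_distrib, Fintype.sum_sum_type, Sum.elim_inl,
    Sum.elim_inr, Finset.smul_sum, Finset.sum_smul, smul_smul]
  congr 1
  rw [Finset.sum_comm]

/-- The tautological columns over the affine space of matrices. -/
noncomputable def tautColumns : Fin m → E.obj c.aff :=
  c.columns (affProj c.base _) fun j k => affCoord c.base (ULift.up (j, k))

variable (φ)

/-- The open subscheme of the affine space of matrices over which the columns span a symplectic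
subbundle. -/
noncomputable abbrev chartOpen : c.aff.left.Opens :=
  c.aff.left.basicOpen (gram φ c.tautColumns).det

/-- The chart of the Grassmannian. -/
noncomputable abbrev chart : Over S := openOver c.aff (c.chartOpen φ)

/-- The tautological columns over the chart. -/
noncomputable def chartColumns (k : Fin m) : E.obj (c.chart φ) :=
  E.res (openIncl c.aff (c.chartOpen φ)) (c.tautColumns k)

lemma isUnit_gram_chartColumns : IsUnit (gram φ (c.chartColumns φ)).det := by
  have := det_gram_res (φ := φ) (openIncl c.aff (c.chartOpen φ)) c.tautColumns
  exact this ▸ isUnit_pullback_basicOpen _ _ fun t => openIncl_left_mem t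

/-- The tautological symplectic subbundle over the chart. -/
noncomputable def chartSub
    (hE : Presieve.IsSheaf (Scheme.zariskiTopology.{u}.over S) E.toPresheaf) :
    SympSubbundle φ m (c.chart φ) :=
  SympSubbundle.ofFrame hE (c.chartColumns φ) (c.isUnit_gram_chartColumns φ)

lemma res_chartColumns {T : Over S} (f : T ⟶ c.chart φ) (k : Fin m) :
    E.res f (c.chartColumns φ k) =
      c.columns (f ≫ openIncl c.aff (c.chartOpen φ) ≫ affProj c.base _) (fun j k =>
        (f ≫ openIncl c.aff (c.chartOpen φ)).left.appTop.hom
          (affCoord c.base (ULift.up (j, k)))) k := by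
  rw [chartColumns, ← E.res_comp, tautColumns, res_columns, Category.assoc]

variable {φ} {c}

/-- The matrix is determined by the span of its columns. -/
lemma columns_eq_of_mem {T : Over S} {t : T ⟶ c.base} {x x' : Fin c.d → Fin m → Γ(T.left, ⊤)}
    (k : Fin m) (h : c.columns t x k ∈ Submodule.span Γ(T.left, ⊤) (Set.range (c.columns t x')))
    (j : Fin c.d) : x j k = x' j k := by
  obtain ⟨a, ha⟩ := (Submodule.mem_span_range_iff_exists_fun _).mp h
  have h1 : c.columns t x k =
      ∑ k', (Pi.single k 1 : Fin m → Γ(T.left, ⊤)) k' • c.columns t x k' := by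
    simp [Pi.single_apply]
  rw [h1, sum_smul_columns, sum_smul_columns] at ha
  have h2 := c.isFrame.coord_unique t ha
  have h3 : a = Pi.single k 1 := funext fun k' => congrFun h2 (Sum.inl k')
  have h4 := congrFun h2 (Sum.inr j)
  simp only [Sum.elim_inr, h3] at h4
  simpa [Pi.single_apply] using h4.symm

/-- A morphism to a chart is determined by the subbundle it classifies. -/
lemma chart_hom_ext (hE : Presieve.IsSheaf (Scheme.zariskiTopology.{u}.over S) E.toPresheaf)
    {T : Over S} {f f' : T ⟶ c.chart φ}
    (h : (c.chartSub φ hE).pullback f = (c.chartSub φ hE).pullback f') : f = f' := by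
  rw [← cancel_mono (openIncl c.aff (c.chartOpen φ))]
  refine affOver_hom_ext (c.base_hom_ext _ _) ?_
  rintro ⟨⟨j, k⟩⟩
  have h1 : (c.chartSub φ hE).sec (𝟙 T ≫ f) = (c.chartSub φ hE).sec (𝟙 T ≫ f') :=
    congrArg (fun W => W.sec (𝟙 T)) h
  have h2 : E.res (𝟙 T ≫ f) (c.chartColumns φ k) ∈ (c.chartSub φ hE).sec (𝟙 T ≫ f') := by
    rw [← h1]
    exact Submodule.subset_span ⟨k, rfl⟩
  simp only [Category.id_comp] at h2
  rw [res_chartColumns] at h2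
  rw [c.base_hom_ext (f ≫ openIncl c.aff (c.chartOpen φ) ≫ affProj c.base _)
    (f' ≫ openIncl c.aff (c.chartOpen φ) ≫ affProj c.base _)] at h2
  refine columns_eq_of_mem k
    (t := f' ≫ openIncl c.aff (c.chartOpen φ) ≫ affProj c.base _)
    (x := fun j k =>
      (f ≫ openIncl c.aff (c.chartOpen φ)).left.appTop.hom (affCoord c.base (ULift.up (j, k))))
    (x' := fun j k =>
      (f' ≫ openIncl c.aff (c.chartOpen φ)).left.appTop.hom (affCoord c.base (ULift.up (j, k))))
    ?_ j
  have h3 : (c.chartSub φ hE).sec f' = Submodule.span Γ(T.left, ⊤) _ :=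
    congrArg (Submodule.span Γ(T.left, ⊤))
      (congrArg Set.range (funext fun k => res_chartColumns φ c f' k))
  rwa [h3] at h2

/-- The matrix of a family of sections in the frame of a chart. -/
lemma exists_matrix {T : Over S} (t : T ⟶ c.base) (w : Fin m → E.obj T) :
    ∃ M : Matrix (Fin m ⊕ Fin c.d) (Fin m) Γ(T.left, ⊤),
      ∀ k, w k = ∑ i, M i k • E.res t (c.frame i) := by
  choose a ha using fun k => c.isFrame.exists_coord (k := t) (x := w k) trivial
  exact ⟨Matrix.of fun i k => a k i, fun k => (ha k).symm⟩

/-- A symplectic subbundle with a global frame lies in a chart as soon as the projection to the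
first `m` sections of the frame of the chart is an isomorphism. -/
lemma exists_chart_hom (hE : Presieve.IsSheaf (Scheme.zariskiTopology.{u}.over S) E.toPresheaf)
    {T : Over S} (W : SympSubbundle φ m T) (t : T ⟶ c.base) {w : Fin m → E.obj T}
    (hw : IsFrame (fun _ k => W.sec k) w) (M : Matrix (Fin m ⊕ Fin c.d) (Fin m) Γ(T.left, ⊤))
    (hM : ∀ k, w k = ∑ i, M i k • E.res t (c.frame i))
    (hdet : IsUnit (M.submatrix Sum.inl id).det) :
    ∃ f : T ⟶ c.chart φ, (c.chartSub φ hE).pullback f = W := by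
  -- multiplying by the inverse of the minor makes it the identity; the remaining entries are the
  -- coordinates of the point of the chart
  let A := (M.submatrix Sum.inl id)⁻¹
  have hA : IsUnit A.det := by
    rw [Matrix.det_nonsing_inv]
    exact hdet.ringInverse
  have hw' := hw.change A hA
  obtain ⟨l, hl, hlx⟩ := exists_affOver_lift t fun i : ULift.{u} (Fin c.d × Fin m) =>
    (M * A) (Sum.inr i.down.1) i.down.2
  have hcol : ∀ k, E.res l (c.tautColumns k) = ∑ j, A j k • w j := by
    intro k
    rw [tautColumns, res_columns, columns, c.base_hom_ext (l ≫ affProj _ _) t]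
    simp only [hlx, hM]
    rw [sum_mulVec_smul M (fun j => A j k), Fintype.sum_sum_type]
    have h1 : ∀ i, M.mulVec (fun j => A j k) i = (M * A) i k := fun i => rfl
    have h2 : ∀ i, (M * A) (Sum.inl i) k = (1 : Matrix (Fin m) (Fin m) _) i k := fun i => by
      rw [← Matrix.mul_nonsing_inv _ hdet]
      rfl
    simp only [h1, h2, Matrix.one_apply]
    simp
  have hu : IsUnit (l.left.appTop.hom (gram φ c.tautColumns).det) := by
    rw [← det_gram_res]
    simp only [hcol]
    refine W.isUnit_gram (𝟙 T) ?_
    simp only [Category.comp_id]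
    exact hw'
  obtain ⟨f, hf⟩ := exists_lift_openIncl (c.chartOpen φ) l
    (mem_basicOpen_of_isUnit_pullback hu)
  refine ⟨f, SympSubbundle.ext_of_sec fun T' k => ?_⟩
  refine Eq.trans ?_ (hw' T' k).2
  change Submodule.span _ (Set.range fun i => E.res (k ≫ f) (c.chartColumns φ i)) = _
  congr 2
  funext i
  rw [E.res_comp, chartColumns, ← E.res_comp f, hf, hcol]

end ChartData

/-- A morphism from an open immersion into `T` gives a morphism from an open subscheme. -/
lemma exists_open_of_isOpenImmersion {w : ℕ} {T D H : Over S} (j : D ⟶ T) [IsOpenImmersion j.left]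
    (W : SympSubbundle φ w T) (U : SympSubbundle φ w H) (f : D ⟶ H)
    (hf : U.pullback f = W.pullback j) (p : D.left) :
    ∃ V : T.left.Opens, j.left p ∈ V ∧
      ∃ f' : openOver T V ⟶ H, U.pullback f' = W.pullback (openIncl T V) := by
  obtain ⟨g, hg⟩ := exists_lift_of_isOpenImmersion j (openIncl T j.left.opensRange)
    fun t => openIncl_left_mem t
  refine ⟨j.left.opensRange, ⟨p, rfl⟩, g ≫ f, SympSubbundle.ext_of_sec fun T' k => ?_⟩
  rw [← hg]
  have : (U.pullback f).sec (k ≫ g) = (W.pullback j).sec (k ≫ g) := by rw [hf]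
  change U.sec ((k ≫ g) ≫ f) = W.sec ((k ≫ g) ≫ j) at this
  change U.sec (k ≫ g ≫ f) = W.sec (k ≫ g ≫ j)
  rwa [Category.assoc, Category.assoc] at this

/-- Near a point where the projection of `W` to the first `m` sections of the frame of a chart is
an isomorphism, `W` lies in the chart. -/
lemma ChartData.exists_open_chart_hom (c : ChartData E m)
    (hE : Presieve.IsSheaf (Scheme.zariskiTopology.{u}.over S) E.toPresheaf) {T D : Over S}
    (j : D ⟶ T) [IsOpenImmersion j.left] (W : SympSubbundle φ m T) (t : D ⟶ c.base)
    {w : Fin m → E.obj D} (hw : IsFrame (fun _ k => W.sec (k ≫ j)) w)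
    (M : Matrix (Fin m ⊕ Fin c.d) (Fin m) Γ(D.left, ⊤))
    (hM : ∀ k, w k = ∑ i, M i k • E.res t (c.frame i)) (p : D.left)
    (hp : p ∈ D.left.basicOpen (M.submatrix Sum.inl id).det) :
    ∃ V : T.left.Opens, j.left p ∈ V ∧ ∃ f : openOver T V ⟶ c.chart φ,
      (c.chartSub φ hE).pullback f = W.pullback (openIncl T V) := by
  set O := D.left.basicOpen (M.submatrix Sum.inl id).det
  obtain ⟨q, rfl⟩ := exists_openIncl_left_eq hp
  have hw' := hw.res (openIncl D O)
  simp only [Category.assoc] at hw'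
  obtain ⟨f, hf⟩ := c.exists_chart_hom hE (W.pullback (openIncl D O ≫ j)) (openIncl D O ≫ t) hw'
    (M.map (openIncl D O).left.appTop.hom) (fun k => by
      rw [hM, res_sum]
      simp only [E.res_comp]
      rfl) (by
      have : ((M.map (openIncl D O).left.appTop.hom).submatrix Sum.inl id).det =
          (openIncl D O).left.appTop.hom (M.submatrix Sum.inl id).det :=
        (RingHom.map_det _ _).symm
      rw [this]
      exact isUnit_pullback_basicOpen _ _ fun t => openIncl_left_mem t)
  exact exists_open_of_isOpenImmersion (openIncl D O ≫ j) W _ f hf q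

lemma nonempty_hom_mk_ι {V : S.Opens} {T : Over S} (h : ∀ t : T.left, T.hom t ∈ V) :
    Nonempty (T ⟶ Over.mk V.ι) := by
  have h' : Set.range T.hom ⊆ Set.range V.ι := by
    rintro _ ⟨t, rfl⟩
    rw [V.range_ι]
    exact h t
  exact ⟨Over.homMk (IsOpenImmersion.lift V.ι T.hom h') (IsOpenImmersion.lift_fac _ _ _)⟩

lemma hom_mem_of_hom_mk_ι {V : S.Opens} {T : Over S} (f : T ⟶ Over.mk V.ι) (t : T.left) :
    T.hom t ∈ V := by
  rw [← Over.w f]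
  have : V.ι (f.left t) ∈ Set.range V.ι := ⟨_, rfl⟩
  rwa [V.range_ι] at this

lemma hom_left_apply {T' T : Over S} (k : T' ⟶ T) (t : T'.left) :
    T.hom (k.left t) = T'.hom t := by
  rw [← Over.w k]
  rfl

/-- An injection extends to a bijection, with an initial segment of `ℕ` added to its source. -/
lemma exists_sumEquiv {ι : Type*} [Fintype ι] (I : Fin m ↪ ι) :
    ∃ (d : ℕ) (e : Fin m ⊕ Fin d ≃ ι), ∀ i, e (Sum.inl i) = I i := by
  classical
  refine ⟨Fintype.card {x // x ∉ Set.range I}, (Equiv.sumCongr (Equiv.ofInjective I I.injective)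
    (Fintype.equivFin _).symm).trans (Equiv.Set.sumCompl (Set.range I)), fun i => ?_⟩
  rfl

namespace ChartData

variable {c : ChartData E m}

/-- If the span of `w` contains the columns of a point of the chart, the minor of `w` at the first
`m` sections of the frame is invertible: so the locus where a subbundle lies in the chart is where
this minor does not vanish. -/
lemma isUnit_det_of_columns_mem {T : Over S} {t : T ⟶ c.base}
    {x : Fin c.d → Fin m → Γ(T.left, ⊤)} {w : Fin m → E.obj T}
    (h : ∀ k, c.columns t x k ∈ Submodule.span Γ(T.left, ⊤) (Set.range w))
    (M : Matrix (Fin m ⊕ Fin c.d) (Fin m) Γ(T.left, ⊤))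
    (hM : ∀ k, w k = ∑ i, M i k • E.res t (c.frame i)) :
    IsUnit (M.submatrix Sum.inl id).det := by
  choose a ha using fun k => (Submodule.mem_span_range_iff_exists_fun _).mp (h k)
  refine Matrix.isUnit_det_of_right_inverse (B := Matrix.of fun l k => a k l) ?_
  ext l k
  have h1 : c.columns t x k =
      ∑ k', (Pi.single k 1 : Fin m → Γ(T.left, ⊤)) k' • c.columns t x k' := by
    simp [Pi.single_apply]
  have h2 := ha k
  simp only [hM] at h2
  rw [h1, sum_smul_columns, sum_mulVec_smul] at h2
  have h3 := congrFun (c.isFrame.coord_unique t h2) (Sum.inl l)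
  refine h3.trans ?_
  simp [Pi.single_apply, Matrix.one_apply]

end ChartData

/-- Quaternionic Grassmannians of symplectic bundles exist. The charts are given by local frames
of `E` and the choice of a nonvanishing maximal minor of the matrix of a frame of the
subbundle. -/
theorem exists_representing_symp {N : ℕ} (hE : E.IsVectorBundle N) (hφ : φ.IsSymplectic) (m : ℕ) :
    ∃ (H : Over S) (U : SympSubbundle φ m H), ∀ (T : Over S) (W : SympSubbundle φ m T),
      ∃! h : T ⟶ H, U.pullback h = W := by
  refine exists_representing_of_small (isSheaf_sympPresheaf hE.isSheaf hφ m)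
    (fun c : ChartData E m => c.chart φ) (fun c => c.chartSub φ hE.isSheaf)
    (fun c T k k' h => ChartData.chart_hom_ext hE.isSheaf h) ?_ ?_
  · intro c T T' (W : SympSubbundle φ m T) k l
      (h : (c.chartSub φ hE.isSheaf).pullback l = W.pullback k) t
    have hO : k.left t ∈ T.hom ⁻¹ᵁ c.opens := by
      change T.hom (k.left t) ∈ c.opens
      rw [hom_left_apply]
      exact hom_mem_of_hom_mk_ι (l ≫ openIncl _ _ ≫ affProj c.base _) t
    obtain ⟨V, hV, hVO, -, w, hw⟩ := W.isSubbundle.exists_affine_frame _ _ hO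
    obtain ⟨s⟩ := nonempty_hom_mk_ι (V := c.opens) (T := openOver T V) fun x => by
      rw [← hom_left_apply (openIncl T V)]
      exact hVO (openIncl_left_mem x)
    obtain ⟨M, hM⟩ := ChartData.exists_matrix (c := c) s w
    obtain ⟨q, rfl⟩ := exists_openIncl_left_eq (V := preOpen k V) hV
    have hq : k.left ((openIncl T' (preOpen k V)).left q) =
        (openIncl T V).left ((preIncl k V).left q) := by
      have := congrArg (fun f => f.left q) (preIncl_openIncl k V)
      exact this.symm
    rw [hq]
    refine c.exists_open_chart_hom hE.isSheaf (openIncl T V) W s hw M hM _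
      (mem_basicOpen_of_isUnit_pullback ?_ q)
    rw [RingHom.map_det]
    refine ChartData.isUnit_det_of_columns_mem (c := c) (t := preIncl k V ≫ s)
      (w := fun i => E.res (preIncl k V) (w i))
      (x := fun j k' => ((openIncl T' (preOpen k V) ≫ l) ≫ openIncl c.aff
        (c.chartOpen φ)).left.appTop.hom (affCoord c.base (ULift.up (j, k')))) (fun i => ?_)
      (M.map (preIncl k V).left.appTop.hom) fun i => ?_
    · have h1 : (c.chartSub φ hE.isSheaf).sec (openIncl T' (preOpen k V) ≫ l) =
          W.sec (openIncl T' (preOpen k V) ≫ k) :=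
        congrArg (fun W => W.sec (openIncl T' (preOpen k V))) h
      rw [(hw _ (preIncl k V)).2]
      beta_reduce
      rw [preIncl_openIncl, ← h1]
      rw [c.base_hom_ext (preIncl k V ≫ s) ((openIncl T' (preOpen k V) ≫ l) ≫
        openIncl c.aff (c.chartOpen φ) ≫ affProj c.base _), ← ChartData.res_chartColumns]
      exact Submodule.subset_span ⟨i, rfl⟩
    · rw [hM, res_sum]
      simp only [E.res_comp]
      rfl
  · intro T (W : SympSubbundle φ m T) p
    obtain ⟨O, hpO, b, hb⟩ := hE.exists_frame (T.hom p)
    have hb' : IsFrame (fun _ _ => ⊤) b := fun _ k => hb k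
    obtain ⟨V, hV, hVO, -, w, hw⟩ := W.isSubbundle.exists_affine_frame p (T.hom ⁻¹ᵁ O) hpO
    obtain ⟨s⟩ := nonempty_hom_mk_ι (V := O) (T := openOver T V) fun x => by
      rw [← hom_left_apply (openIncl T V)]
      exact hVO (openIncl_left_mem x)
    choose a ha using fun k => hb'.exists_coord (k := s) (x := w k) trivial
    obtain ⟨q, rfl⟩ := exists_openIncl_left_eq hV
    let κ := (pointIncl (openOver T V) q)
    -- the columns of the matrix of `w` are independent over the residue field
    obtain ⟨I, hI⟩ := exists_isUnit_det_submatrix_of_isField (isField_pointOver _ q)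
      (Matrix.of fun i k => κ.left.appTop.hom (a k i)) fun z hz => by
        refine funext fun k => hw.coord_eq_zero κ ?_ k
        have h1 : ∀ k, E.res κ (w k) = ∑ i, (Matrix.of fun i k => κ.left.appTop.hom (a k i)) i k •
            E.res κ (E.res s (b i)) := fun k => by
          rw [← ha, res_sum]
          rfl
        simp only [h1]
        rw [sum_mulVec_smul, hz]
        simp
    obtain ⟨d, e, he⟩ := exists_sumEquiv I
    let c : ChartData E m := ⟨O, d, fun i => b (e i), hb'.reindex e⟩
    refine ⟨c, c.exists_open_chart_hom hE.isSheaf (openIncl T V) W s hw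
      (Matrix.of fun i k => a k (e i)) (fun k => ?_) q ?_⟩
    · rw [← ha]
      exact (e.sum_comp fun i => a k i • E.res s (b i)).symm
    · rw [mem_basicOpen_iff_pointIncl, RingHom.map_det]
      have : (Matrix.of fun i k => a k (e i)).submatrix Sum.inl id =
          (Matrix.of fun i k => a k i).submatrix I id := by
        ext i k
        simp [he]
      rw [this]
      exact hI

/-- The scheme that represents the sheaf of symplectic subbundles of rank `2r` is the quaternionic
Grassmannian. -/
theorem exists_isHGr {N : ℕ} (hE : E.IsVectorBundle N) (hφ : φ.IsSymplectic) (r : ℕ) :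
    ∃ (H : Over S) (U : SympSubbundle φ (2 * r) H), IsHGr φ r H U := by
  obtain ⟨H, U, hU⟩ := exists_representing_symp hE hφ (2 * r)
  refine ⟨H, U, fun T W => ?_⟩
  obtain ⟨h, rfl, hu⟩ := hU T W
  exact ⟨h, fun k => rfl, fun h' hh' => hu h' (SympSubbundle.ext_of_sec fun _ k => (hh' k).symm)⟩

end ModulePresheaf

/-! ### Torsors under subbundles -/

namespace ModulePresheaf

variable {S : Scheme.{u}} {M : ModulePresheaf S} {m : ℕ} {T : Over S}

/-- The sets of sections `C`, given over all schemes over `T`, form a torsor under the subbundle `K`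
by translation: they are stable under pullback, membership is local, they are cosets of `K`, and
they are locally nonempty. -/
structure IsCoset (K : ∀ T' : Over S, (T' ⟶ T) → Submodule Γ(T'.left, ⊤) (M.obj T'))
    (C : ∀ T' : Over S, (T' ⟶ T) → Set (M.obj T')) : Prop where
  res_mem : ∀ {T'' T' : Over S} (k : T'' ⟶ T') (h : T' ⟶ T) (x : M.obj T'),
    x ∈ C T' h → M.res k x ∈ C T'' (k ≫ h)
  mem_of_locally_mem : ∀ {T' : Over S} (h : T' ⟶ T) (x : M.obj T'),
    (∀ p : T'.left, ∃ V : T'.left.Opens, p ∈ V ∧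
      M.res (openIncl T' V) x ∈ C _ (openIncl T' V ≫ h)) → x ∈ C T' h
  sub_mem : ∀ {T' : Over S} (h : T' ⟶ T) (x y : M.obj T'), x ∈ C T' h → y ∈ C T' h →
    x - y ∈ K T' h
  add_mem : ∀ {T' : Over S} (h : T' ⟶ T) (x y : M.obj T'), x ∈ K T' h → y ∈ C T' h →
    x + y ∈ C T' h
  exists_local : ∀ p : T.left, ∃ V : T.left.Opens, p ∈ V ∧ ∃ x, x ∈ C _ (openIncl T V)

section Represent

variable {K : ∀ T' : Over S, (T' ⟶ T) → Submodule Γ(T'.left, ⊤) (M.obj T')}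
  {C : ∀ T' : Over S, (T' ⟶ T) → Set (M.obj T')}

/-- The presheaf on schemes over `S` of pairs of a morphism `h` to `T` and an element of
`C h`. -/
def IsCoset.presheaf (hC : IsCoset K C) : (Over S)ᵒᵖ ⥤ Type u where
  obj Z := {z : (Z.unop ⟶ T) × M.obj Z.unop // z.2 ∈ C _ z.1}
  map k := ↾fun z => ⟨(k.unop ≫ z.1.1, M.res k.unop z.1.2), hC.res_mem k.unop z.1.1 z.1.2 z.2⟩
  map_id Z := by
    apply ConcreteCategory.hom_ext
    intro z
    exact Subtype.ext (Prod.ext (Category.id_comp _) (M.res_id _ _))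
  map_comp k k' := by
    apply ConcreteCategory.hom_ext
    intro z
    exact Subtype.ext (Prod.ext (Category.assoc _ _ _) (M.res_comp _ _ _))

/-- Both components of a pair glue, and membership in `C` is local. -/
lemma IsCoset.isSheaf_presheaf (hC : IsCoset K C)
    (hM : Presieve.IsSheaf (Scheme.zariskiTopology.{u}.over S) M.toPresheaf) :
    Presieve.IsSheaf (Scheme.zariskiTopology.{u}.over S) hC.presheaf := by
  have hT := isSheaf_yoneda_over T
  rw [isSheaf_over_iff] at hT hM ⊢
  intro Z ι V hV
  refine (Presieve.isSheafFor_arrows_iff _ _).mpr fun x hx => ?_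
  obtain ⟨h, hh, hu⟩ := (Presieve.isSheafFor_arrows_iff _ _).mp (hT Z ι V hV)
    (fun i => (x i).1.1) fun i j Z' a b hab =>
      congrArg (fun z => z.1.1) (hx i j Z' a b hab)
  obtain ⟨y, hy, hyu⟩ := (Presieve.isSheafFor_arrows_iff _ _).mp (hM Z ι V hV)
    (fun i => (x i).1.2) fun i j Z' a b hab =>
      congrArg (fun z => z.1.2) (hx i j Z' a b hab)
  have hyC : y ∈ C Z h := hC.mem_of_locally_mem h y fun p => by
    obtain ⟨i, hi⟩ := hV p
    refine ⟨V i, hi, ?_⟩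
    have h1 : openIncl Z (V i) ≫ h = (x i).1.1 := hh i
    have h2 : M.res (openIncl Z (V i)) y = (x i).1.2 := hy i
    rw [h1, h2]
    exact (x i).2
  refine ⟨⟨(h, y), hyC⟩, fun i => Subtype.ext (Prod.ext (hh i) (hy i)), fun z hz =>
    Subtype.ext (Prod.ext (hu _ fun i => congrArg (fun z => z.1.1) (hz i))
      (hyu _ fun i => congrArg (fun z => z.1.2) (hz i)))⟩

/-- A torsor under a subbundle is representable. Locally it is an affine space, the coordinates
being those of the translation that takes a fixed section to a given one. -/
theorem IsCoset.exists_representing (hC : IsCoset K C) (hK : IsSubbundle K m)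
    (hM : Presieve.IsSheaf (Scheme.zariskiTopology.{u}.over S) M.toPresheaf) :
    ∃ (P : Over S) (g : P ⟶ T) (x : M.obj P), x ∈ C P g ∧ ∀ (Z : Over S) (h : Z ⟶ T) (y : M.obj Z),
      y ∈ C Z h → ∃! k : Z ⟶ P, k ≫ g = h ∧ M.res k x = y := by
  -- the charts: an open subset of `T` with a frame of `K` and an element of `C`
  let ι := Σ V : T.left.Opens, {b : Fin m → M.obj (openOver T V) //
    IsFrame (fun T' k => K T' (k ≫ openIncl T V)) b} × C _ (openIncl T V)
  let H : ι → Over S := fun i => affOver (openOver T i.1) (ULift.{u} (Fin m))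
  let pr : ∀ i : ι, H i ⟶ openOver T i.1 := fun i => affProj _ _
  let x : ∀ i : ι, M.obj (H i) := fun i =>
    ∑ j, affCoord (openOver T i.1) (ULift.up j) • M.res (pr i) (i.2.1.1 j) + M.res (pr i) i.2.2.1
  have hx : ∀ i : ι, x i ∈ C _ (pr i ≫ openIncl T i.1) := fun i =>
    hC.add_mem _ _ _ (i.2.1.2.coord_mem (pr i) _) (hC.res_mem _ _ _ i.2.2.2)
  have hx_res : ∀ (i : ι) (Z : Over S) (k : Z ⟶ H i), M.res k (x i) =
      ∑ j, k.left.appTop.hom (affCoord (openOver T i.1) (ULift.up j)) •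
        M.res (k ≫ pr i) (i.2.1.1 j) + M.res (k ≫ pr i) i.2.2.1 := fun i Z k => by
    simp only [x, map_add, res_sum, M.res_comp]
  -- pairs `(h, y)` lie in a chart wherever `h` maps to the corresponding open subscheme
  have hlift : ∀ (i : ι) (Z : Over S) (h : Z ⟶ T) (y : M.obj Z), y ∈ C Z h →
      ∃ f : openOver Z (preOpen h i.1) ⟶ H i,
        f ≫ pr i ≫ openIncl T i.1 = openIncl Z (preOpen h i.1) ≫ h ∧
        M.res f (x i) = M.res (openIncl Z (preOpen h i.1)) y := by
    intro i Z h y hy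
    have h1 := hC.sub_mem _ _ _ (hC.res_mem (openIncl Z (preOpen h i.1)) h y hy)
      (preIncl_openIncl h i.1 ▸ hC.res_mem (preIncl h i.1) (openIncl T i.1) _ i.2.2.2)
    rw [← preIncl_openIncl] at h1
    obtain ⟨a, ha⟩ := i.2.1.2.exists_coord h1
    obtain ⟨f, hf, hfx⟩ := exists_affOver_lift (preIncl h i.1) fun j : ULift.{u} (Fin m) => a j.down
    refine ⟨f, ?_, ?_⟩
    · rw [← preIncl_openIncl, ← hf, Category.assoc]
    · rw [hx_res, show f ≫ pr i = _ from hf]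
      simp only [hfx]
      rw [ha, sub_add_cancel]
  obtain ⟨P, ⟨⟨g, z⟩, hz⟩, hP⟩ : ∃ (P : Over S) (z : hC.presheaf.obj (op P)),
      ∀ (Z : Over S) (y : hC.presheaf.obj (op Z)), ∃! k : Z ⟶ P, hC.presheaf.map k.op z = y := by
    refine SympGrass.exists_representing (hC.isSheaf_presheaf hM) H
      (fun i => ⟨(pr i ≫ openIncl T i.1, x i), hx i⟩) ?_ ?_ ?_
    · intro i Z k k' hkk'
      have h1 : k ≫ pr i ≫ openIncl T i.1 = k' ≫ pr i ≫ openIncl T i.1 :=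
        congrArg (fun z => z.1.1) hkk'
      rw [← Category.assoc, ← Category.assoc, cancel_mono] at h1
      have h2 : M.res k (x i) = M.res k' (x i) := congrArg (fun z => z.1.2) hkk'
      rw [hx_res, hx_res, h1, add_left_inj] at h2
      exact affOver_hom_ext h1 fun j => congrFun (i.2.1.2.coord_unique _ h2) j.down
    · rintro i Z Z' ⟨⟨h, y⟩, hy⟩ k l hkl t
      have h1 : l ≫ pr i ≫ openIncl T i.1 = k ≫ h := congrArg (fun z => z.1.1) hkl
      obtain ⟨f, hf, hfx⟩ := hlift i Z h y hy
      refine ⟨preOpen h i.1, ?_, f, Subtype.ext (Prod.ext hf hfx)⟩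
      have h2 : h.left (k.left t) = (openIncl T i.1).left ((pr i).left (l.left t)) :=
        congrArg (fun f => f.left t) h1.symm
      change h.left (k.left t) ∈ i.1
      rw [h2]
      exact openIncl_left_mem _
    · rintro Z ⟨⟨h, y⟩, hy⟩ p
      obtain ⟨V, hV, s, hs⟩ := hC.exists_local (h.left p)
      obtain ⟨V', hV', hV'V, -, b, hb⟩ := hK.exists_affine_frame _ _ hV
      let i : ι := ⟨V', ⟨b, hb⟩, ⟨M.res (openLE hV'V) s, by
        have := hC.res_mem (openLE hV'V) _ s hs
        rwa [openLE_openIncl] at this⟩⟩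
      obtain ⟨f, hf, hfx⟩ := hlift i Z h y hy
      exact ⟨i, preOpen h V', hV', f, Subtype.ext (Prod.ext hf hfx)⟩
  refine ⟨P, g, z, hz, fun Z h y hy => ?_⟩
  obtain ⟨k, hk, hku⟩ := hP Z ⟨(h, y), hy⟩
  exact ⟨k, ⟨congrArg (fun z => z.1.1) hk, congrArg (fun z => z.1.2) hk⟩, fun k' hk' =>
    hku k' (Subtype.ext (Prod.ext hk'.1 hk'.2))⟩

end Represent

/-- A scheme over `T`, as a scheme over `S`. -/
abbrev overBase (T : Over S) (Z : Over T.left) : Over S := (Over.map T.hom).obj Z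

/-- The structure morphism of a scheme over `T`, as a morphism of schemes over `S`. -/
def overStr (T : Over S) (Z : Over T.left) : overBase T Z ⟶ T := Over.homMk Z.hom

/-- A morphism of schemes over `T`, as a morphism of schemes over `S`. -/
abbrev overBaseMap (T : Over S) {Z' Z : Over T.left} (k : Z' ⟶ Z) : overBase T Z' ⟶ overBase T Z :=
  (Over.map T.hom).map k

lemma overBaseMap_overStr {Z' Z : Over T.left} (k : Z' ⟶ Z) :
    overBaseMap T k ≫ overStr T Z = overStr T Z' := by
  ext1
  exact Over.w k

section

variable {K : ∀ T' : Over S, (T' ⟶ T) → Submodule Γ(T'.left, ⊤) (M.obj T')}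

/-- A subbundle of the pullback of a bundle to `T`, as a bundle over `T`. -/
def IsSubbundle.toModule (hK : IsSubbundle K m) : ModulePresheaf T.left where
  obj Z := K (overBase T Z) (overStr T Z)
  addCommGroup Z := inferInstanceAs (AddCommGroup (K (overBase T Z) (overStr T Z)))
  module Z := inferInstanceAs (Module Γ((overBase T Z).left, ⊤) (K (overBase T Z) (overStr T Z)))
  res k := AddMonoidHom.mk' (fun x => ⟨M.res (overBaseMap T k) x.1, by
      have := hK.res_mem (overBaseMap T k) _ x.1 x.2
      rwa [overBaseMap_overStr] at this⟩)
    fun x y => Subtype.ext (map_add (M.res (overBaseMap T k)) x.1 y.1)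
  res_id Z x := Subtype.ext (by
    change M.res (overBaseMap T (𝟙 Z)) x.1 = x.1
    rw [overBaseMap, CategoryTheory.Functor.map_id, M.res_id])
  res_comp k h x := Subtype.ext (by
    change M.res (overBaseMap T (k ≫ h)) x.1 = M.res _ (M.res _ x.1)
    rw [overBaseMap, CategoryTheory.Functor.map_comp, M.res_comp])
  res_smul k a x := Subtype.ext (M.res_smul (overBaseMap T k) a x.1)

/-- The members of a subbundle glue since the sections of `M` do and membership is local. -/
lemma IsSubbundle.isSheaf_toModule (hK : IsSubbundle K m)
    (hM : Presieve.IsSheaf (Scheme.zariskiTopology.{u}.over S) M.toPresheaf) :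
    Presieve.IsSheaf (Scheme.zariskiTopology.{u}.over T.left) hK.toModule.toPresheaf := by
  have h : Presieve.IsSheaf (Scheme.zariskiTopology.{u}.over T.left)
      ((Over.map T.hom).op ⋙ M.toPresheaf) :=
    (Over.map T.hom).op_comp_isSheaf_of_types _ (Scheme.zariskiTopology.{u}.over S)
      ⟨M.toPresheaf, (isSheaf_iff_isSheaf_of_type _ _).mpr hM⟩
  rw [isSheaf_over_iff] at h ⊢
  intro Z ι V hV
  refine (Presieve.isSheafFor_arrows_iff _ _).mpr fun x hx => ?_
  obtain ⟨y, hy, hyu⟩ := (Presieve.isSheafFor_arrows_iff _ _).mp (h Z ι V hV)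
    (fun i => (x i).1) fun i j Z' a b hab => congrArg Subtype.val (hx i j Z' a b hab)
  have hmem : ∀ y : M.obj (overBase T Z),
      (∀ i, M.res (overBaseMap T (openIncl Z (V i))) y ∈ K _ (overStr T (openOver Z (V i)))) →
        y ∈ K (overBase T Z) (overStr T Z) := fun y hy =>
    hK.mem_of_locally_mem _ _ fun p => by
    obtain ⟨i, hi⟩ := hV p
    refine ⟨V i, hi, ?_⟩
    have : IsOpenImmersion (overBaseMap T (openIncl Z (V i))).left :=
      inferInstanceAs (IsOpenImmersion (V i).ι)
    obtain ⟨g, hg⟩ := exists_lift_of_isOpenImmersion (overBaseMap T (openIncl Z (V i)))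
      (openIncl (overBase T Z) (V i)) fun t => by
        have : (openIncl (overBase T Z) (V i)).left t ∈ V i := openIncl_left_mem t
        obtain ⟨t', ht'⟩ := exists_openIncl_left_eq (T := Z) (V := V i) this
        exact ⟨t', ht'⟩
    rw [← hg, M.res_comp, Category.assoc, overBaseMap_overStr]
    exact hK.res_mem g _ _ (hy i)
  have hyK : y ∈ K (overBase T Z) (overStr T Z) := hmem y fun i => by
    have h1 : M.res (overBaseMap T (openIncl Z (V i))) y = (x i).1 := hy i
    exact h1.symm ▸ (x i).2
  exact ⟨⟨y, hyK⟩, fun i => Subtype.ext (hy i), fun z hz =>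
    Subtype.ext (hyu _ fun i => congrArg Subtype.val (hz i))⟩

lemma linearIndependent_and_span_eq_top_of_coe {R A : Type*} [CommRing R] [AddCommGroup A]
    [Module R A] {N : Submodule R A} {ι : Type*} {b : ι → N}
    (h : LinearIndependent R fun i => (b i : A))
    (h' : Submodule.span R (Set.range fun i => (b i : A)) = N) :
    LinearIndependent R b ∧ Submodule.span R (Set.range b) = ⊤ := by
  refine ⟨LinearIndependent.of_comp N.subtype h, ?_⟩
  refine Submodule.map_injective_of_injective (f := N.subtype) Subtype.val_injective ?_
  rw [Submodule.map_span, Submodule.map_top, ← Set.range_comp, Submodule.range_subtype]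
  exact h'

lemma IsSubbundle.isVectorBundle_toModule (hK : IsSubbundle K m)
    (hM : Presieve.IsSheaf (Scheme.zariskiTopology.{u}.over S) M.toPresheaf) :
    hK.toModule.IsVectorBundle m where
  isSheaf := hK.isSheaf_toModule hM
  exists_frame p := by
    obtain ⟨V, hp, b, hb⟩ := hK.exists_frame p
    have hmem : ∀ i, b i ∈ K (openOver T V) (openIncl T V) := fun i => by
      have := hb.mem i
      rwa [Category.id_comp] at this
    refine ⟨V, hp, fun i => ⟨b i, hmem i⟩, fun {Z} k => ?_⟩
    let k' : overBase T Z ⟶ openOver T V := overBaseMap T k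
    have hk' : k' ≫ openIncl T V = overStr T Z := overBaseMap_overStr (T := T) k
    have h1 : LinearIndependent _ _ ∧ Submodule.span _ _ = K _ (k' ≫ openIncl T V) := hb _ k'
    rw [hk'] at h1
    exact linearIndependent_and_span_eq_top_of_coe (N := K (overBase T Z) (overStr T Z))
      (b := fun i => ⟨M.res k' (b i), h1.2 ▸ Submodule.subset_span ⟨i, rfl⟩⟩) h1.1 h1.2

variable {C : ∀ T' : Over S, (T' ⟶ T) → Set (M.obj T')}

/-- A scheme that represents a torsor under a subbundle of rank `m` is an affine bundle. -/
theorem IsCoset.isAffineBundle (hC : IsCoset K C) (hK : IsSubbundle K m)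
    (hM : Presieve.IsSheaf (Scheme.zariskiTopology.{u}.over S) M.toPresheaf) {P : Over S}
    (g : P ⟶ T) (x : M.obj P) (hx : x ∈ C P g)
    (hP : ∀ (Z : Over S) (h : Z ⟶ T) (y : M.obj Z), y ∈ C Z h →
      ∃! k : Z ⟶ P, k ≫ g = h ∧ M.res k x = y) : IsAffineBundle g.left m := by
  refine ⟨hK.toModule, hK.isVectorBundle_toModule hM, ⟨?_⟩⟩
  let lift : ∀ {Z : Over T.left}, (Z ⟶ Over.mk g.left) → (overBase T Z ⟶ P) := fun {Z} s =>
    Over.homMk s.left (by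
      have h1 : s.left ≫ g.left = Z.hom := Over.w s
      change s.left ≫ P.hom = Z.hom ≫ T.hom
      rw [← h1, Category.assoc, Over.w g])
  have lift_comp : ∀ {Z : Over T.left} (s : Z ⟶ Over.mk g.left), lift s ≫ g = overStr T Z := by
    intro Z s
    ext1
    exact Over.w s
  have lift_res : ∀ {Z' Z : Over T.left} (k : Z' ⟶ Z) (s : Z ⟶ Over.mk g.left),
      lift (k ≫ s) = overBaseMap T k ≫ lift s := by
    intro Z' Z k s
    ext1
    rfl
  -- sections of `P` over `Z` correspond to elements of `C`
  let sec : ∀ {Z : Over T.left}, (Z ⟶ Over.mk g.left) → C (overBase T Z) (overStr T Z) :=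
    fun {Z} s => ⟨M.res (lift s) x, by
      have := hC.res_mem (lift s) g x hx
      rwa [lift_comp] at this⟩
  have sec_bij : ∀ Z : Over T.left, Function.Bijective (sec (Z := Z)) := by
    intro Z
    constructor
    · intro s s' hs
      have h1 := (hP _ (overStr T Z) _ (sec s).2).unique ⟨lift_comp s, rfl⟩
        ⟨lift_comp s', congrArg Subtype.val hs.symm⟩
      ext1
      exact congrArg (fun f => f.left) h1
    · rintro ⟨y, hy⟩
      obtain ⟨k, ⟨hk, hky⟩, -⟩ := hP _ (overStr T Z) y hy
      exact ⟨Over.homMk k.left (congrArg (fun f => f.left) hk), Subtype.ext hky⟩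
  let e : ∀ Z : Over T.left, (Z ⟶ Over.mk g.left) ≃ C (overBase T Z) (overStr T Z) :=
    fun Z => Equiv.ofBijective _ (sec_bij Z)
  have e_res : ∀ {Z' Z : Over T.left} (k : Z' ⟶ Z) (s : Z ⟶ Over.mk g.left),
      (e Z' (k ≫ s)).1 = M.res (overBaseMap T k) (e Z s).1 := by
    intro Z' Z k s
    change M.res (lift (k ≫ s)) x = M.res _ (M.res (lift s) x)
    rw [lift_res, M.res_comp]
  let tr : ∀ {Z : Over T.left}, K (overBase T Z) (overStr T Z) →
      C (overBase T Z) (overStr T Z) → C (overBase T Z) (overStr T Z) := fun v y =>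
    ⟨v.1 + y.1, hC.add_mem _ _ _ v.2 y.2⟩
  exact
    { act := fun {Z} v s => (e Z).symm (tr v (e Z s))
      zero_act := fun {Z} s => by
        rw [Equiv.symm_apply_eq]
        exact Subtype.ext (zero_add _)
      add_act := fun {Z} v w s => by
        rw [Equiv.symm_apply_eq, Equiv.apply_symm_apply, Equiv.apply_symm_apply]
        exact Subtype.ext (add_assoc _ _ _)
      res_act := fun {Z' Z} k v s => by
        rw [Equiv.symm_apply_eq]
        refine Subtype.ext ?_
        rw [e_res, Equiv.apply_symm_apply]
        refine Eq.trans ?_ (map_add _ _ _).symm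
        exact congrArg (M.res (overBaseMap T k) v.1 + ·) (e_res k s)
      existsUnique_act := fun {Z} s s' => by
        refine ⟨⟨(e Z s').1 - (e Z s).1, hC.sub_mem _ _ _ (e Z s').2 (e Z s).2⟩, ?_,
          fun v (hv : (e Z).symm (tr v (e Z s)) = s') => ?_⟩
        · exact (Equiv.symm_apply_eq _).mpr (Subtype.ext (sub_add_cancel _ _))
        · exact Subtype.ext
            (eq_sub_of_add_eq (congrArg Subtype.val ((Equiv.symm_apply_eq _).mp hv)))
      exists_section := fun p => by
        obtain ⟨W, hp, y, hy⟩ := hC.exists_local p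
        exact ⟨W, hp, ⟨(e (Over.mk W.ι)).symm ⟨y, hy⟩⟩⟩ }

end

end ModulePresheaf

/-! ### Hyperbolic pairs in the tautological bundle -/

namespace ModulePresheaf

variable {S : Scheme.{u}}

/-- The sections of a subbundle of rank `m + 1` on which a functional takes the value `1` are
represented by an `𝔸^m`-bundle, as soon as such sections exist locally. -/
theorem IsSubbundle.exists_affineBundle {M : ModulePresheaf S} {m : ℕ} {T : Over S}
    {N : ∀ T' : Over S, (T' ⟶ T) → Submodule Γ(T'.left, ⊤) (M.obj T')}
    (hN : IsSubbundle N (m + 1))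
    (hM : Presieve.IsSheaf (Scheme.zariskiTopology.{u}.over S) M.toPresheaf)
    (l : ∀ T' : Over S, (T' ⟶ T) → M.obj T' →ₗ[Γ(T'.left, ⊤)] Γ(T'.left, ⊤))
    (l_res : ∀ {T'' T' : Over S} (k : T'' ⟶ T') (h : T' ⟶ T) (x : M.obj T'),
      l T'' (k ≫ h) (M.res k x) = k.left.appTop.hom (l T' h x))
    (l_one : ∀ p : T.left, ∃ V : T.left.Opens, p ∈ V ∧ ∃ f ∈ N _ (openIncl T V),
      l _ (openIncl T V) f = 1) :
    ∃ (P : Over S) (g : P ⟶ T) (x : M.obj P), IsAffineBundle g.left m ∧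
      x ∈ N P g ∧ l P g x = 1 ∧ ∀ (Z : Over S) (h : Z ⟶ T) (y : M.obj Z), y ∈ N Z h → l Z h y = 1 →
        ∃! k : Z ⟶ P, k ≫ g = h ∧ M.res k x = y := by
  have hK := hN.ker l l_res l_one
  have hC : IsCoset (fun T' h => N T' h ⊓ LinearMap.ker (l T' h))
      (fun T' h => {x | x ∈ N T' h ∧ l T' h x = 1}) :=
    { res_mem := fun k h x hx => ⟨hN.res_mem k h x hx.1, by rw [l_res, hx.2, map_one]⟩
      mem_of_locally_mem := fun h x hx => by
        refine ⟨hN.mem_of_locally_mem h x fun p => ?_, function_eq_of_locally _ _ fun p => ?_⟩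
        · obtain ⟨V, hp, hV⟩ := hx p
          exact ⟨V, hp, hV.1⟩
        · obtain ⟨V, hp, hV⟩ := hx p
          refine ⟨V, hp, ?_⟩
          rw [← l_res, hV.2, map_one]
      sub_mem := fun h x y hx hy => ⟨sub_mem hx.1 hy.1, by
        rw [SetLike.mem_coe, LinearMap.mem_ker, map_sub, hx.2, hy.2, sub_self]⟩
      add_mem := fun h x y hx hy => ⟨add_mem hx.1 hy.1, by
        rw [map_add, LinearMap.mem_ker.mp hx.2, hy.2, zero_add]⟩
      exists_local := fun p => by
        obtain ⟨V, hp, f, hf, hlf⟩ := l_one p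
        exact ⟨V, hp, f, hf, hlf⟩ }
  obtain ⟨P, g, x, hx, hP⟩ := hC.exists_representing hK hM
  exact ⟨P, g, x, hC.isAffineBundle hK hM g x hx hP, hx.1, hx.2,
    fun Z h y hy hly => hP Z h y ⟨hy, hly⟩⟩

/-- The functional `φ(·, f)`. -/
def AltForm.right {M : ModulePresheaf S} (φ : M.AltForm) {T : Over S} (f : M.obj T) :
    M.obj T →ₗ[Γ(T.left, ⊤)] Γ(T.left, ⊤) :=
  (φ.form T).flip f

lemma AltForm.right_apply {M : ModulePresheaf S} (φ : M.AltForm) {T : Over S} (f x : M.obj T) :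
    φ.right f x = φ.form T x f := rfl

variable {E : ModulePresheaf S} {φ : E.AltForm} {m : ℕ} {H : Over S}

/-- The projection of `F = 𝒪 ⊕ E ⊕ 𝒪` onto the third factor as a linear map. -/
def lamMap (E : ModulePresheaf S) (T : Over S) : E.hyp.obj T →ₗ[Γ(T.left, ⊤)] Γ(T.left, ⊤) :=
  (LinearMap.snd _ (E.obj T) Γ(T.left, ⊤)).comp
    (LinearMap.snd _ Γ(T.left, ⊤) (E.obj T × Γ(T.left, ⊤)))

lemma lamMap_res {T' T : Over S} (k : T' ⟶ T) (x : E.hyp.obj T) :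
    lamMap E T' (E.hyp.res k x) = k.left.appTop.hom (lamMap E T x) := rfl

lemma exists_lift_pointIncl {p : H.left} {V : H.left.Opens} (hp : p ∈ V) :
    ∃ g : pointOver H p ⟶ openOver H V, g ≫ openIncl H V = pointIncl H p :=
  exists_lift_openIncl V (pointIncl H p) fun t => by rwa [pointIncl_left_apply]

/-- A point lies off `N⁺` if `U` has a section over some scheme mapping to that point on which
`lam` is invertible. -/
lemma notMem_Nplus_of_isUnit (U : SympSubbundle φ.hyp m H) {T : Over S} (g : T ⟶ H)
    {f : E.hyp.obj T} (hf : f ∈ U.sec g) (hlf : IsUnit (lamMap E T f)) (t : T.left) :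
    g.left t ∉ Nplus U := by
  intro ht
  obtain ⟨V, hV, b, hb⟩ := U.isSubbundle.exists_frame (g.left t)
  obtain ⟨t', ht'⟩ := exists_openIncl_left_eq (T := T) (V := preOpen g V) hV
  have h1 := U.res_mem (openIncl T (preOpen g V)) g f hf
  rw [← preIncl_openIncl] at h1
  obtain ⟨a, ha⟩ := hb.exists_coord h1
  obtain ⟨s, hs⟩ := (hlf.map (openIncl T (preOpen g V)).left.appTop.hom).exists_left_inv
  rw [← lamMap_res, ← ha, map_sum, Finset.mul_sum] at hs
  obtain ⟨i, hi⟩ := exists_mem_basicOpen_of_sum_mul_eq_one (fun i => s * a i)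
    (fun i => lamMap E _ (E.hyp.res (preIncl g V) (b i))) (by
      rw [← hs]
      refine Finset.sum_congr rfl fun i _ => ?_
      rw [map_smul, smul_eq_mul, mul_assoc]) t'
  rw [lamMap_res, mem_basicOpen_pullback] at hi
  obtain ⟨κ, hκ⟩ := exists_lift_pointIncl hV
  have h2 := isUnit_pullback_basicOpen _ κ fun x => by
    have : κ.left x = (preIncl g V).left t' := by
      refine (openIncl H V).left.injective ?_
      have h3 : (openIncl H V).left (κ.left x) = (pointIncl H (g.left t)).left x :=
        congrArg (fun f => f.left x) hκ
      have h4 : (openIncl H V).left ((preIncl g V).left t') =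
          g.left ((openIncl T (preOpen g V)).left t') :=
        congrArg (fun f => f.left t') (preIncl_openIncl g V)
      rw [h3, h4, ht', pointIncl_left_apply]
    rw [this]
    exact hi
  have h5 : E.hyp.res κ (b i) ∈ U.sec (pointIncl H (g.left t)) := by
    rw [← hκ]
    exact hb.res_mem κ i
  have h6 : κ.left.appTop.hom (lamMap E _ (b i)) = 0 := ht _ h5
  have := (isField_pointOver H (g.left t)).nontrivial
  exact h2.ne_zero h6

/-- Near every point off `N⁺`, the tautological bundle has a section with `lam f = 1`. -/
lemma exists_lam_eq_one_of_notMem_Nplus (U : SympSubbundle φ.hyp m H) {p : H.left}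
    (hp : p ∉ Nplus U) : ∃ V : H.left.Opens, p ∈ V ∧ ∃ f ∈ U.sec (openIncl H V),
      lamMap E _ f = 1 := by
  obtain ⟨x, hx, hlx⟩ : ∃ x ∈ U.sec (pointIncl H p), lamMap E _ x ≠ 0 := by
    by_contra! h
    exact hp h
  obtain ⟨V, hV, b, hb⟩ := U.isSubbundle.exists_frame p
  obtain ⟨κ, hκ⟩ := exists_lift_pointIncl hV
  rw [← hκ] at hx
  obtain ⟨a, rfl⟩ := hb.exists_coord hx
  rw [map_sum] at hlx
  obtain ⟨i, -, hi⟩ := Finset.exists_ne_zero_of_sum_ne_zero hlx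
  rw [map_smul, lamMap_res] at hi
  obtain ⟨s, hs⟩ := (isField_pointOver H p).mul_inv_cancel (right_ne_zero_of_smul hi)
  obtain ⟨t⟩ : Nonempty (pointOver H p).left := inferInstance
  let O := (openOver H V).left.basicOpen (lamMap E _ (b i))
  obtain ⟨q, hq⟩ := exists_openIncl_left_eq (T := openOver H V) (V := O)
    (mem_basicOpen_of_isUnit_pullback (IsUnit.of_mul_eq_one s hs) t)
  let j := openIncl _ O ≫ openIncl H V
  obtain ⟨c, hc⟩ := (isUnit_pullback_basicOpen (lamMap E _ (b i)) (openIncl _ O)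
    fun x => openIncl_left_mem x).exists_left_inv
  have hfj : c • E.hyp.res (openIncl _ O) (b i) ∈ U.sec j :=
    Submodule.smul_mem _ _ (hb.res_mem _ i)
  obtain ⟨g, hg⟩ := exists_lift_of_isOpenImmersion j (openIncl H j.left.opensRange)
    fun t => openIncl_left_mem t
  refine ⟨j.left.opensRange, ⟨q, ?_⟩, E.hyp.res g (c • E.hyp.res (openIncl _ O) (b i)), ?_, ?_⟩
  · have h1 : (openIncl H V).left (κ.left t) = (pointIncl H p).left t :=
      congrArg (fun f => f.left t) hκ
    rw [pointIncl_left_apply, ← hq] at h1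
    exact h1
  · rw [← hg]
    exact U.res_mem g j _ hfj
  · rw [lamMap_res, map_smul, lamMap_res, smul_eq_mul, hc, map_one]

/-- The set `N⁺` is closed: the locus where some section of `U` has an invertible third component
is open. -/
lemma isOpen_compl_Nplus (U : SympSubbundle φ.hyp m H) : IsOpen (Nplus U)ᶜ := by
  rw [isOpen_iff_forall_mem_open]
  intro p hp
  obtain ⟨V, hV, f, hf, hlf⟩ := exists_lam_eq_one_of_notMem_Nplus U hp
  refine ⟨V, fun t ht => ?_, V.isOpen, hV⟩
  obtain ⟨t', rfl⟩ := exists_openIncl_left_eq (V := V) ht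
  exact notMem_Nplus_of_isUnit U _ hf (hlf ▸ isUnit_one) t'

/-- A nondegenerate alternating form yields a partner `e` of a section `f` with `lam f = 1`: the
section that represents `lam`. -/
lemma SympSubbundle.exists_partner (U : SympSubbundle φ.hyp m H) {T : Over S} (g : T ⟶ H)
    (hT : IsAffine T.left) : ∃ e ∈ U.sec g, lamMap E T e = 0 ∧
      ∀ f ∈ U.sec g, φ.hyp.form T e f = lamMap E T f := by
  obtain ⟨e, he, hef⟩ := (U.unimodularOn g hT).2 ((lamMap E T).comp (U.sec g).subtype)
  refine ⟨e, he, ?_, fun f hf => hef ⟨f, hf⟩⟩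
  rw [← φ.hyp.alt T e]
  exact (hef ⟨e, he⟩).symm

/-- The open subscheme `Y` and the two affine bundles over it that classify sections `f` with
`lam f = 1`, and their completions to a hyperbolic pair `e`, `f`. -/
theorem exists_pairBundles
    (hE : Presieve.IsSheaf (Scheme.zariskiTopology.{u}.over S) E.hyp.toPresheaf) {k : ℕ}
    (hk : k = m + 1 + 1) (U : SympSubbundle φ.hyp k H) (Y : H.left.Opens)
    (hY : (Y : Set H.left) = (Nplus U)ᶜ) :
    ∃ (Y₁ Y₂ : Over S) (g₁ : Y₁ ⟶ openOver H Y) (g₂ : Y₂ ⟶ Y₁),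
      IsAffineBundle g₁.left (m + 1) ∧ IsAffineBundle g₂.left m ∧
      ∃ f₁ : E.hyp.obj Y₁, f₁ ∈ U.sec (g₁ ≫ openIncl H Y) ∧ hyp.lam f₁ = 1 ∧
      (∀ (T : Over S) (g : T ⟶ openOver H Y) (f' : E.hyp.obj T),
        f' ∈ U.sec (g ≫ openIncl H Y) → hyp.lam f' = 1 →
        ∃! k : T ⟶ Y₁, k ≫ g₁ = g ∧ E.hyp.res k f₁ = f') ∧
      ∃ e f : E.hyp.obj Y₂, f = E.hyp.res g₂ f₁ ∧
        e ∈ U.sec (g₂ ≫ g₁ ≫ openIncl H Y) ∧ f ∈ U.sec (g₂ ≫ g₁ ≫ openIncl H Y) ∧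
        hyp.lam f = 1 ∧ hyp.lam e = 0 ∧ φ.hyp.form Y₂ e f = 1 ∧
        (∀ (T : Over S) (g : T ⟶ openOver H Y) (e' f' : E.hyp.obj T),
          e' ∈ U.sec (g ≫ openIncl H Y) → f' ∈ U.sec (g ≫ openIncl H Y) →
          hyp.lam f' = 1 → hyp.lam e' = 0 → φ.hyp.form T e' f' = 1 →
          ∃! k : T ⟶ Y₂, k ≫ g₂ ≫ g₁ = g ∧ E.hyp.res k e = e' ∧ E.hyp.res k f = f') := by
  subst hk
  set j := openIncl H Y
  have hN := U.isSubbundle.pullback j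
  have l_one : ∀ p : (openOver H Y).left, ∃ V : (openOver H Y).left.Opens, p ∈ V ∧
      ∃ f ∈ U.sec (openIncl _ V ≫ j), lamMap E _ f = 1 := by
    intro p
    have hp : j.left p ∉ Nplus U := by
      have : j.left p ∈ (Y : Set H.left) := openIncl_left_mem p
      rwa [hY] at this
    obtain ⟨V, hV, f, hf, hlf⟩ := exists_lam_eq_one_of_notMem_Nplus U hp
    refine ⟨preOpen j V, hV, E.hyp.res (preIncl j V) f, ?_, ?_⟩
    · rw [← preIncl_openIncl]
      exact U.res_mem _ _ _ hf
    · rw [lamMap_res, hlf, map_one]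
  obtain ⟨Y₁, g₁, f₁, hg₁, hf₁, hlf₁, hY₁⟩ := hN.exists_affineBundle hE (fun T' _ => lamMap E T')
    (fun k _ x => lamMap_res k x) l_one
  have hN₁ := (hN.ker (fun T' _ => lamMap E T') (fun k _ x => lamMap_res k x) l_one).pullback g₁
  obtain ⟨Y₂, g₂, e, hg₂, he, hef, hY₂⟩ := hN₁.exists_affineBundle hE
    (fun T' h => φ.hyp.right (E.hyp.res h f₁))
    (fun k h x => by
      rw [AltForm.right_apply, E.hyp.res_comp, φ.hyp.res_form, AltForm.right_apply])
    (fun p => by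
      -- the form is only known to be unimodular over affine schemes
      obtain ⟨V, hp, -, hV⟩ := exists_affine_openOver p ⊤ trivial
      obtain ⟨e, he, hle, hef⟩ := U.exists_partner (openIncl Y₁ V ≫ g₁ ≫ j) hV
      refine ⟨V, hp, e, ⟨?_, hle⟩, ?_⟩
      · rw [Category.assoc]
        exact he
      · rw [AltForm.right_apply, hef _ (U.res_mem _ _ _ hf₁), lamMap_res, hlf₁, map_one])
  have heU : e ∈ U.sec (g₂ ≫ g₁ ≫ j) := by
    have := he.1
    rwa [Category.assoc] at this
  refine ⟨Y₁, Y₂, g₁, g₂, hg₁, hg₂, f₁, hf₁, hlf₁, hY₁, e, E.hyp.res g₂ f₁, rfl, heU,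
    U.res_mem _ _ _ hf₁, ?_, he.2, hef, ?_⟩
  · exact (lamMap_res g₂ f₁).trans ((congrArg _ hlf₁).trans (map_one _))
  · intro T g e' f' he' hf' hlf' hle' hef'
    obtain ⟨k₁, ⟨hk₁, hkf₁⟩, hu₁⟩ := hY₁ T g f' hf' hlf'
    obtain ⟨k₂, ⟨hk₂, hke⟩, hu₂⟩ := hY₂ T k₁ e' ⟨by rw [hk₁]; exact he', hle'⟩ (by
      rw [AltForm.right_apply, hkf₁]
      exact hef')
    refine ⟨k₂, ⟨?_, hke, ?_⟩, ?_⟩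
    · rw [← Category.assoc, hk₂, hk₁]
    · rw [← E.hyp.res_comp, hk₂, hkf₁]
    · rintro k' ⟨hk', hke', hkf'⟩
      refine hu₂ k' ⟨hu₁ (k' ≫ g₂) ⟨?_, ?_⟩, hke'⟩
      · rw [Category.assoc, hk']
      · rw [E.hyp.res_comp, hkf']

end ModulePresheaf

/-! ### The symplectic automorphism `ρ` -/

section Transvections

open ModulePresheaf

variable {R M : Type*} [CommRing R] [AddCommGroup M] [Module R M] (B : LinearMap.BilinForm R M)

lemma hypBilin_apply (x y : R × M × R) :
    hypBilin B x y = x.1 * y.2.2 + B x.2.1 y.2.1 - x.2.2 * y.1 := rfl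

/-- The linear map with matrix `[[1, v^∨ B, b], [0, 1, v], [0, 0, 1]]`. -/
def plusMap (v : M) (b : R) : R × M × R →ₗ[R] R × M × R where
  toFun x := (x.1 + B v x.2.1 + b * x.2.2, x.2.1 + x.2.2 • v, x.2.2)
  map_add' x y := by
    refine Prod.ext ?_ (Prod.ext ?_ rfl)
    · simp
      ring
    · simp only [Prod.snd_add, Prod.fst_add, add_smul]
      abel
  map_smul' a x := by
    refine Prod.ext ?_ (Prod.ext ?_ rfl)
    · simp
      ring
    · simp [smul_smul]

/-- The linear map with matrix `[[1, 0, 0], [u, 1, 0], [0, -u^∨ B, 1]]`. -/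
def minusMap (u : M) : R × M × R →ₗ[R] R × M × R where
  toFun x := (x.1, x.1 • u + x.2.1, 0 * x.1 - B u x.2.1 + x.2.2)
  map_add' x y := by
    refine Prod.ext rfl (Prod.ext ?_ ?_)
    · simp only [Prod.snd_add, Prod.fst_add, add_smul]
      abel
    · simp
      ring
  map_smul' a x := by
    refine Prod.ext rfl (Prod.ext ?_ ?_)
    · simp [smul_smul]
    · simp
      ring

variable {B}

lemma plusMap_neg (hB : ∀ x, B x x = 0) (v : M) (b : R) (x : R × M × R) :
    plusMap B (-v) (-b) (plusMap B v b x) = x := by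
  refine Prod.ext ?_ (Prod.ext ?_ rfl)
  · simp [plusMap, hB]
    ring
  · simp [plusMap]

lemma minusMap_neg (hB : ∀ x, B x x = 0) (u : M) (x : R × M × R) :
    minusMap B (-u) (minusMap B u x) = x := by
  refine Prod.ext rfl (Prod.ext ?_ ?_)
  · simp [minusMap]
  · simp [minusMap, hB]

/-- The product `ρ₊(v, b) ρ₋(u, 0)` as a linear equivalence. -/
def rhoEquiv (hB : ∀ x, B x x = 0) (u v : M) (b : R) : (R × M × R) ≃ₗ[R] (R × M × R) where
  __ := (plusMap B v b).comp (minusMap B u)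
  invFun x := minusMap B (-u) (plusMap B (-v) (-b) x)
  left_inv x := by
    change minusMap B (-u) (plusMap B (-v) (-b) (plusMap B v b (minusMap B u x))) = x
    rw [plusMap_neg hB, minusMap_neg hB]
  right_inv x := by
    change plusMap B v b (minusMap B u (minusMap B (-u) (plusMap B (-v) (-b) x))) = x
    have h1 := minusMap_neg hB (-u)
    have h2 := plusMap_neg hB (-v) (-b)
    rw [neg_neg] at h1
    rw [neg_neg, neg_neg] at h2
    rw [h1, h2]

/-- The upper triangular factor preserves the form for every entry `b`, as the two contributions
of `b` cancel. -/
lemma hypBilin_plusMap (hB : ∀ x, B x x = 0) (hB' : ∀ x y, B x y = -B y x) (v : M) (b : R)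
    (x y : R × M × R) : hypBilin B (plusMap B v b x) (plusMap B v b y) = hypBilin B x y := by
  simp only [hypBilin_apply, plusMap, LinearMap.coe_mk, AddHom.coe_mk, map_add, map_smul,
    LinearMap.add_apply, LinearMap.smul_apply, smul_eq_mul, hB]
  rw [hB' x.2.1 v]
  ring

lemma hypBilin_minusMap (hB : ∀ x, B x x = 0) (hB' : ∀ x y, B x y = -B y x) (u : M)
    (x y : R × M × R) : hypBilin B (minusMap B u x) (minusMap B u y) = hypBilin B x y := by
  simp only [hypBilin_apply, minusMap, LinearMap.coe_mk, AddHom.coe_mk, map_add, map_smul,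
    LinearMap.add_apply, LinearMap.smul_apply, smul_eq_mul, hB]
  rw [hB' x.2.1 u]
  ring

lemma hypBilin_rhoEquiv (hB : ∀ x, B x x = 0) (hB' : ∀ x y, B x y = -B y x) (u v : M) (b : R)
    (x y : R × M × R) :
    hypBilin B (rhoEquiv hB u v b x) (rhoEquiv hB u v b y) = hypBilin B x y :=
  (hypBilin_plusMap hB hB' v b _ _).trans (hypBilin_minusMap hB hB' u x y)

/-- `𝒪 ⊕ N ⊕ 𝒪` is unimodular if and only if `N` is. -/
lemma unimodularOn_hypBilin_iff {N : Submodule R M} :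
    UnimodularOn (hypBilin B) (Submodule.prod (⊤ : Submodule R R)
      (Submodule.prod N (⊤ : Submodule R R))) ↔ UnimodularOn B N := by
  constructor
  · rintro ⟨h1, h2⟩
    refine ⟨fun w hw h => ?_, fun l => ?_⟩
    · have := h1 (0, w, 0) ⟨trivial, hw, trivial⟩ fun y hy => by
        rw [hypBilin_apply]
        simp [h _ hy.2.1]
      exact congrArg (fun z => z.2.1) this
    · let p : Submodule.prod (⊤ : Submodule R R) (Submodule.prod N (⊤ : Submodule R R)) →ₗ[R] N :=
        { toFun := fun y => ⟨y.1.2.1, y.2.2.1⟩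
          map_add' := fun _ _ => rfl
          map_smul' := fun _ _ => rfl }
      obtain ⟨x, hx, hxl⟩ := h2 (l.comp p)
      refine ⟨x.2.1, hx.2.1, fun w => ?_⟩
      have : hypBilin B x (0, (w : M), 0) = l w := hxl ⟨(0, w, 0), trivial, w.2, trivial⟩
      rw [hypBilin_apply] at this
      simpa using this
  · rintro ⟨h1, h2⟩
    refine ⟨fun x hx h => ?_, fun l => ?_⟩
    · have ha := h (0, 0, 1) ⟨trivial, N.zero_mem, trivial⟩
      have hc := h (1, 0, 0) ⟨trivial, N.zero_mem, trivial⟩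
      have hw := h1 x.2.1 hx.2.1 fun w hw => by
        have := h (0, w, 0) ⟨trivial, hw, trivial⟩
        rw [hypBilin_apply] at this
        simpa using this
      rw [hypBilin_apply] at ha hc
      exact Prod.ext (by simpa using ha) (Prod.ext hw (by simpa using hc))
    · let i : N →ₗ[R] Submodule.prod (⊤ : Submodule R R) (Submodule.prod N (⊤ : Submodule R R)) :=
        { toFun := fun w => ⟨(0, w, 0), trivial, w.2, trivial⟩
          map_add' := fun _ _ => Subtype.ext (by simp)
          map_smul' := fun _ _ => Subtype.ext (by simp) }
      let e₁ : Submodule.prod (⊤ : Submodule R R) (Submodule.prod N (⊤ : Submodule R R)) :=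
        ⟨(1, 0, 0), trivial, N.zero_mem, trivial⟩
      let e₂ : Submodule.prod (⊤ : Submodule R R) (Submodule.prod N (⊤ : Submodule R R)) :=
        ⟨(0, 0, 1), trivial, N.zero_mem, trivial⟩
      obtain ⟨w, hw, hwl⟩ := h2 (l.comp i)
      refine ⟨(l e₂, w, -l e₁), ⟨trivial, hw, trivial⟩, fun y => ?_⟩
      have hy : y = y.1.1 • e₁ + i ⟨y.1.2.1, y.2.2.1⟩ + y.1.2.2 • e₂ :=
        Subtype.ext (by simp [e₁, e₂, i])
      have h3 := hwl ⟨y.1.2.1, y.2.2.1⟩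
      rw [hypBilin_apply]
      conv_rhs => rw [hy]
      rw [map_add, map_add, map_smul, map_smul]
      simp only [LinearMap.comp_apply, smul_eq_mul] at h3 ⊢
      rw [h3]
      ring

/-- `0 ⊕ N ⊕ 0` is unimodular if `N` is. -/
lemma unimodularOn_hypBilin_mid {N : Submodule R M} (h : UnimodularOn B N) :
    UnimodularOn (hypBilin B) (Submodule.prod (⊥ : Submodule R R)
      (Submodule.prod N (⊥ : Submodule R R))) := by
  refine ⟨?_, fun l => ?_⟩
  · rintro ⟨a, w, c⟩ ⟨ha, hw, hc⟩ hx
    have := h.1 w hw fun y hy => by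
      have := hx (0, y, 0) ⟨rfl, hy, rfl⟩
      rw [hypBilin_apply] at this
      simpa using this
    exact Prod.ext ha (Prod.ext this hc)
  · let i : N →ₗ[R] Submodule.prod (⊥ : Submodule R R) (Submodule.prod N (⊥ : Submodule R R)) :=
      { toFun := fun w => ⟨(0, w, 0), rfl, w.2, rfl⟩
        map_add' := fun _ _ => Subtype.ext (by simp)
        map_smul' := fun _ _ => Subtype.ext (by simp) }
    obtain ⟨w, hw, hwl⟩ := h.2 (l.comp i)
    refine ⟨(0, w, 0), ⟨rfl, hw, rfl⟩, ?_⟩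
    rintro ⟨⟨a, y, c⟩, ha, hy, hc⟩
    have ha' : a = 0 := ha
    have hc' : c = 0 := hc
    subst ha' hc'
    refine Eq.trans ?_ (hwl ⟨y, hy⟩)
    rw [hypBilin_apply]
    simp

lemma unimodularOn_map {N : Submodule R M} (h : UnimodularOn B N) (e : M ≃ₗ[R] M)
    (he : ∀ x y, B (e x) (e y) = B x y) : UnimodularOn B (N.map e.toLinearMap) := by
  refine ⟨?_, fun l => ?_⟩
  · rintro _ ⟨x, hx, rfl⟩ hxy
    have := h.1 x hx fun y hy => by
      rw [← he]
      exact hxy _ ⟨y, hy, rfl⟩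
    rw [this]
    exact map_zero e
  · let i : N →ₗ[R] N.map e.toLinearMap := e.toLinearMap.restrict fun x hx => ⟨x, hx, rfl⟩
    obtain ⟨x, hx, hxl⟩ := h.2 (l.comp i)
    refine ⟨e x, ⟨x, hx, rfl⟩, ?_⟩
    rintro ⟨_, y, hy, rfl⟩
    exact (he x y).trans (hxl ⟨y, hy⟩)

end Transvections

namespace ModulePresheaf

variable {S : Scheme.{u}} {E : ModulePresheaf S} {φ : E.AltForm} {m : ℕ} {T : Over S}

/-- The bundle `𝒪 ⊕ E ⊕ 𝒪` is symplectic if `E` is. -/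
lemma AltForm.IsSymplectic.hyp (hφ : φ.IsSymplectic) : φ.hyp.IsSymplectic := by
  intro T hT
  have h := (unimodularOn_hypBilin_iff (B := φ.form T) (N := ⊤)).mpr (by
    obtain ⟨h1, h2⟩ := (bijective_iff _).mp (hφ T hT)
    refine ⟨fun x _ hx => h1 x fun y => hx y trivial, fun l => ?_⟩
    obtain ⟨x, hx⟩ := h2 (l.comp (Submodule.topEquiv.symm.toLinearMap))
    exact ⟨x, trivial, fun y => hx y⟩)
  refine (bijective_iff _).mpr ⟨fun x hx => h.1 x ⟨trivial, trivial, trivial⟩ fun y _ => hx y,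
    fun l => ?_⟩
  obtain ⟨x, -, hx⟩ := h.2 (LinearMap.comp l (Submodule.subtype _))
  exact ⟨x, fun y => hx ⟨y, trivial, trivial, trivial⟩⟩

/-- The symplectic automorphism `ρ = ρ₊(v, b) ρ₋(u, 0)`. -/
def rho (φ : E.AltForm) (u v : E.obj T) (b : Γ(T.left, ⊤)) : SympAut φ.hyp T where
  app {T'} h := rhoEquiv (φ.alt T') (E.res h u) (E.res h v) (h.left.appTop.hom b)
  res_app {T'' T'} k h x := by
    obtain ⟨a, w, c⟩ := x
    refine Prod.ext ?_ (Prod.ext ?_ ?_)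
    · change k.left.appTop.hom (a + φ.form T' (E.res h v) (a • E.res h u + w) +
          h.left.appTop.hom b * (0 * a - φ.form T' (E.res h u) w + c)) =
        k.left.appTop.hom a + φ.form T'' (E.res (k ≫ h) v)
          (k.left.appTop.hom a • E.res (k ≫ h) u + E.res k w) +
          (k ≫ h).left.appTop.hom b * (0 * k.left.appTop.hom a -
            φ.form T'' (E.res (k ≫ h) u) (E.res k w) + k.left.appTop.hom c)
      rw [E.res_comp, E.res_comp, ← E.res_smul, ← map_add (E.res k), φ.res_form, φ.res_form,
        appTop_comp_apply]
      simp only [map_add, map_mul, map_sub, map_zero]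
    · change E.res k (a • E.res h u + w + (0 * a - φ.form T' (E.res h u) w + c) • E.res h v) =
        k.left.appTop.hom a • E.res (k ≫ h) u + E.res k w + (0 * k.left.appTop.hom a -
            φ.form T'' (E.res (k ≫ h) u) (E.res k w) + k.left.appTop.hom c) • E.res (k ≫ h) v
      rw [E.res_comp, E.res_comp, φ.res_form, map_add, map_add, E.res_smul, E.res_smul]
      simp only [map_add, map_mul, map_sub, map_zero]
    · change k.left.appTop.hom (0 * a - φ.form T' (E.res h u) w + c) = 0 * k.left.appTop.hom a -
            φ.form T'' (E.res (k ≫ h) u) (E.res k w) + k.left.appTop.hom c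
      rw [E.res_comp, φ.res_form]
      simp only [map_add, map_mul, map_sub, map_zero]
  form_app {T'} h x y := hypBilin_rhoEquiv (φ.alt T') φ.form_swap _ _ _ x y

lemma rho_app (φ : E.AltForm) (u v : E.obj T) (b : Γ(T.left, ⊤)) {T' : Over S} (h : T' ⟶ T)
    (x : E.hyp.obj T') : (rho φ u v b).app h x =
      rhoPlus φ (E.res h v) (h.left.appTop.hom b) (rhoMinus φ (E.res h u) 0 x) := rfl

/-- The first column of `ρ` is `e = (1 - φ(u, v), u, 0)`. -/
lemma rho_app_one_zero_zero (φ : E.AltForm) (u v : E.obj T) (b : Γ(T.left, ⊤)) {T' : Over S}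
    (h : T' ⟶ T) : (rho φ u v b).app h (hyp.mk 1 0 0) =
      hyp.mk (1 - h.left.appTop.hom (φ.form T u v)) (E.res h u) 0 := by
  refine Prod.ext ?_ (Prod.ext ?_ ?_)
  · change 1 + φ.form T' (E.res h v) ((1 : Γ(T'.left, ⊤)) • E.res h u + 0) +
      h.left.appTop.hom b * (0 * 1 - φ.form T' (E.res h u) 0 + 0) = _ - _
    rw [one_smul, add_zero, φ.form_swap, φ.res_form, map_zero]
    ring
  · change (1 : Γ(T'.left, ⊤)) • E.res h u + 0 +
      (0 * 1 - φ.form T' (E.res h u) 0 + 0) • E.res h v = E.res h u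
    simp
  · change 0 * 1 - φ.form T' (E.res h u) 0 + 0 = 0
    simp

/-- The last column of `ρ` is `f = (b, v, 1)`. -/
lemma rho_app_zero_zero_one (φ : E.AltForm) (u v : E.obj T) (b : Γ(T.left, ⊤)) {T' : Over S}
    (h : T' ⟶ T) : (rho φ u v b).app h (hyp.mk 0 0 1) =
      hyp.mk (h.left.appTop.hom b) (E.res h v) 1 := by
  refine Prod.ext ?_ (Prod.ext ?_ ?_)
  · change 0 + φ.form T' (E.res h v) ((0 : Γ(T'.left, ⊤)) • E.res h u + 0) +
      h.left.appTop.hom b * (0 * 0 - φ.form T' (E.res h u) 0 + 1) = h.left.appTop.hom b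
    simp
  · change (0 : Γ(T'.left, ⊤)) • E.res h u + 0 +
      (0 * 0 - φ.form T' (E.res h u) 0 + 1) • E.res h v = E.res h v
    simp
  · change 0 * 0 - φ.form T' (E.res h u) 0 + 1 = (1 : Γ(T'.left, ⊤))
    simp

end ModulePresheaf

/-! ### Constructions with symplectic subbundles -/

namespace ModulePresheaf

variable {S : Scheme.{u}} {E : ModulePresheaf S} {φ : E.AltForm} {m : ℕ} {T : Over S}

/-- The symplectic subbundle with given sections. -/
def SympSubbundle.ofUnimodular
    (N : ∀ T' : Over S, (T' ⟶ T) → Submodule Γ(T'.left, ⊤) (E.obj T')) (hN : IsSubbundle N m)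
    (hu : ∀ (T' : Over S) (h : T' ⟶ T), IsAffine T'.left → UnimodularOn (φ.form T') (N T' h)) :
    SympSubbundle φ m T where
  sec {T'} h := N T' h
  res_mem := hN.res_mem
  mem_of_locally_mem := hN.mem_of_locally_mem
  exists_frame p := by
    obtain ⟨V, hp, b, hb⟩ := hN.exists_frame p
    exact ⟨V, hp, b, fun k => hb _ k⟩
  isSymplectic h hT' := (bijective_restrict_iff _ _).mpr (hu _ h hT')

section Prod

variable {N : ∀ T' : Over S, (T' ⟶ T) → Submodule Γ(T'.left, ⊤) (E.obj T')}

lemma IsSubbundle.prod {E' : ModulePresheaf S} {m' : ℕ}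
    {N' : ∀ T' : Over S, (T' ⟶ T) → Submodule Γ(T'.left, ⊤) (E'.obj T')} (hN : IsSubbundle N m)
    (hN' : IsSubbundle N' m') :
    IsSubbundle (E := E.prod E') (fun T' h => (N T' h).prod (N' T' h)) (m + m') where
  res_mem k h x hx := ⟨hN.res_mem k h _ hx.1, hN'.res_mem k h _ hx.2⟩
  mem_of_locally_mem h x hx := ⟨hN.mem_of_locally_mem h _ fun p => by
      obtain ⟨V, hp, hV⟩ := hx p
      exact ⟨V, hp, hV.1⟩, hN'.mem_of_locally_mem h _ fun p => by
      obtain ⟨V, hp, hV⟩ := hx p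
      exact ⟨V, hp, hV.2⟩⟩
  exists_frame p := by
    obtain ⟨V, hp, b, hb⟩ := hN.exists_frame p
    obtain ⟨V', hp', hV', -, b', hb'⟩ := hN'.exists_affine_frame p V hp
    exact ⟨V', hp', _, ((hb.restrict hV').prod hb').reindex finSumFinEquiv.symm⟩

lemma isSubbundle_unit_top (T : Over S) :
    IsSubbundle (E := unit S) (T := T) (fun _ _ => ⊤) 1 where
  res_mem _ _ _ _ := trivial
  mem_of_locally_mem _ _ _ := trivial
  exists_frame _ := ⟨⊤, trivial, _, isFrame_unit _⟩

lemma isSubbundle_unit_bot (T : Over S) :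
    IsSubbundle (E := unit S) (T := T) (fun _ _ => ⊥) 0 where
  res_mem k h x hx := by
    rw [(Submodule.mem_bot _).mp hx, map_zero]
    exact zero_mem _
  mem_of_locally_mem h x hx := function_eq_of_locally _ _ fun p => by
    obtain ⟨V, hp, hV⟩ := hx p
    exact ⟨V, hp, hV.trans (map_zero _).symm⟩
  exists_frame _ := ⟨⊤, trivial, finZeroElim, IsFrame.of_coord (fun _ _ i => i.elim0)
    (fun _ _ x hx => ⟨finZeroElim, ((Submodule.mem_bot _).mp hx).symm⟩) fun _ _ _ _ i => i.elim0⟩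

lemma IsSubbundle.ofHyp (hN : IsSubbundle N m) :
    IsSubbundle (E := E.hyp) (fun T' h => hyp.ofHyp (N T' h)) (1 + (m + 1)) :=
  (isSubbundle_unit_top T).prod (hN.prod (isSubbundle_unit_top T))

lemma IsSubbundle.ofMid (hN : IsSubbundle N m) :
    IsSubbundle (E := E.hyp) (fun T' h => hyp.ofMid (N T' h)) (0 + (m + 0)) :=
  (isSubbundle_unit_bot T).prod (hN.prod (isSubbundle_unit_bot T))

lemma IsSubbundle.map (hN : IsSubbundle N m) (ρ : SympAut φ T) :
    IsSubbundle (fun T' h => (N T' h).map (ρ.app h).toLinearMap) m where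
  res_mem k h x hx := by
    obtain ⟨y, hy, rfl⟩ := hx
    exact ⟨E.res k y, hN.res_mem k h y hy, (ρ.res_app k h y).symm⟩
  mem_of_locally_mem h x hx := by
    obtain ⟨y, rfl⟩ := (ρ.app h).surjective x
    refine ⟨y, hN.mem_of_locally_mem h y fun p => ?_, rfl⟩
    obtain ⟨V, hp, z, hz, hzy⟩ := hx p
    refine ⟨V, hp, ?_⟩
    rw [ρ.res_app] at hzy
    rwa [← (ρ.app (openIncl _ V ≫ h)).injective hzy]
  exists_frame p := by
    obtain ⟨V, hp, b, hb⟩ := hN.exists_frame p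
    refine ⟨V, hp, fun i => ρ.app (openIncl T V) (b i), fun T' k => ?_⟩
    simp only [ρ.res_app]
    refine ⟨(hb T' k).1.map' (ρ.app (k ≫ openIncl T V)).toLinearMap (LinearEquiv.ker _), ?_⟩
    refine Eq.trans ?_ (congrArg (Submodule.map _) (hb T' k).2)
    rw [Submodule.map_span, ← Set.range_comp]
    rfl

end Prod

/-- The symplectic subbundle `𝒪 ⊕ W ⊕ 𝒪` of `𝒪 ⊕ E ⊕ 𝒪`. -/
def SympSubbundle.ofHyp (W : SympSubbundle φ m T) {k : ℕ} (hk : k = m + 2) :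
    SympSubbundle φ.hyp k T :=
  SympSubbundle.ofUnimodular (fun _ h => hyp.ofHyp (W.sec h))
    (by
      have := W.isSubbundle.ofHyp
      rwa [show 1 + (m + 1) = k by omega] at this)
    fun _ h hT' => unimodularOn_hypBilin_iff.mpr (W.unimodularOn h hT')

/-- The symplectic subbundle `0 ⊕ W ⊕ 0` of `𝒪 ⊕ E ⊕ 𝒪`. -/
def SympSubbundle.ofMid (W : SympSubbundle φ m T) {k : ℕ} (hk : k = m) :
    SympSubbundle φ.hyp k T :=
  SympSubbundle.ofUnimodular (fun _ h => hyp.ofMid (W.sec h))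
    (by
      have := W.isSubbundle.ofMid
      rwa [show 0 + (m + 0) = k by omega] at this)
    fun _ h hT' => unimodularOn_hypBilin_mid (W.unimodularOn h hT')

/-- The image of a symplectic subbundle under a symplectic automorphism. -/
def SympSubbundle.map (W : SympSubbundle φ m T) (ρ : SympAut φ T) : SympSubbundle φ m T :=
  SympSubbundle.ofUnimodular (fun _ h => (W.sec h).map (ρ.app h).toLinearMap)
    (W.isSubbundle.map ρ)
    fun _ h hT' => unimodularOn_map (W.unimodularOn h hT') _ (ρ.form_app h)

/-- The inverse of a symplectic automorphism. -/
def SympAut.symm (ρ : SympAut φ T) : SympAut φ T where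
  app h := (ρ.app h).symm
  res_app k h x := by
    obtain ⟨y, rfl⟩ := (ρ.app h).surjective x
    rw [LinearEquiv.symm_apply_apply, ρ.res_app, LinearEquiv.symm_apply_apply]
  form_app h x y := by
    rw [← ρ.form_app h, LinearEquiv.apply_symm_apply, LinearEquiv.apply_symm_apply]

/-- The inclusion of `E` in `𝒪 ⊕ E ⊕ 𝒪` as a linear map. -/
def midIncl (E : ModulePresheaf S) (T : Over S) : E.obj T →ₗ[Γ(T.left, ⊤)] E.hyp.obj T :=
  (LinearMap.inr Γ(T.left, ⊤) Γ(T.left, ⊤) (E.obj T × Γ(T.left, ⊤))).comp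
    (LinearMap.inl Γ(T.left, ⊤) (E.obj T) Γ(T.left, ⊤))

/-- The projection of `𝒪 ⊕ E ⊕ 𝒪` onto the first factor as a linear map. -/
def fstMap (E : ModulePresheaf S) (T : Over S) : E.hyp.obj T →ₗ[Γ(T.left, ⊤)] Γ(T.left, ⊤) :=
  LinearMap.fst Γ(T.left, ⊤) Γ(T.left, ⊤) (E.obj T × Γ(T.left, ⊤))

lemma fstMap_res {T' T : Over S} (k : T' ⟶ T) (x : E.hyp.obj T) :
    fstMap E T' (E.hyp.res k x) = k.left.appTop.hom (fstMap E T x) := rfl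

lemma midIncl_res {T' T : Over S} (k : T' ⟶ T) (w : E.obj T) :
    E.hyp.res k (midIncl E T w) = midIncl E T' (E.res k w) :=
  Prod.ext (map_zero k.left.appTop.hom) (Prod.ext rfl (map_zero k.left.appTop.hom))

lemma midIncl_injective (T : Over S) : Function.Injective (midIncl E T) := fun _ _ h =>
  congrArg (fun x : Γ(T.left, ⊤) × E.obj T × Γ(T.left, ⊤) => x.2.1) h

lemma eq_midIncl {x : E.hyp.obj T} (hx : lamMap E T x = 0) (hx' : fstMap E T x = 0) :
    x = midIncl E T (hyp.mid x) := Prod.ext hx' (Prod.ext rfl hx)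

/-- The decomposition of `𝒪 ⊕ E ⊕ 𝒪` into its three summands. -/
lemma eq_combination (x : E.hyp.obj T) :
    x = fstMap E T x • hyp.mk 1 0 0 + midIncl E T (hyp.mid x) + lamMap E T x • hyp.mk 0 0 1 := by
  refine Prod.ext ?_ (Prod.ext ?_ ?_)
  · change x.1 = x.1 * 1 + 0 + x.2.2 * 0
    ring
  · change x.2.1 = x.1 • (0 : E.obj T) + x.2.1 + x.2.2 • (0 : E.obj T)
    simp
  · change x.2.2 = x.1 * 0 + 0 + x.2.2 * 1
    ring

section Mid

variable {N : ∀ T' : Over S, (T' ⟶ T) → Submodule Γ(T'.left, ⊤) (E.hyp.obj T')}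

/-- A submodule of `𝒪 ⊕ E ⊕ 𝒪` that contains `(1, 0, 0)` and `(0, 0, 1)` is of the form
`𝒪 ⊕ W ⊕ 𝒪`. -/
lemma ofHyp_comap_midIncl {N : Submodule Γ(T.left, ⊤) (E.hyp.obj T)}
    (h₁ : hyp.mk 1 0 0 ∈ N) (h₂ : hyp.mk 0 0 1 ∈ N) : hyp.ofHyp (N.comap (midIncl E T)) = N := by
  have key : ∀ x : E.hyp.obj T, x ∈ N ↔ midIncl E T (hyp.mid x) ∈ N := fun x => by
    conv_lhs => rw [eq_combination x]
    rw [N.add_mem_iff_left (N.smul_mem _ h₂), N.add_mem_iff_right (N.smul_mem _ h₁)]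
  ext x
  rw [key]
  exact ⟨fun h => h.2.1, fun h => ⟨trivial, h, trivial⟩⟩

/-- The middle summand `W` of a subbundle of the form `𝒪 ⊕ W ⊕ 𝒪` is a subbundle: `0 ⊕ W ⊕ 0` is
the intersection with the kernels of the projections to the outer summands. -/
lemma IsSubbundle.comap_midIncl {k : ℕ} (hN : IsSubbundle N k) (hk : k = m + 1 + 1)
    (h₁ : ∀ (T' : Over S) (h : T' ⟶ T), hyp.mk 1 0 0 ∈ N T' h)
    (h₂ : ∀ (T' : Over S) (h : T' ⟶ T), hyp.mk 0 0 1 ∈ N T' h) :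
    IsSubbundle (fun T' h => (N T' h).comap (midIncl E T')) m := by
  subst hk
  have hK := (hN.ker (fun T' _ => lamMap E T') (fun k _ x => lamMap_res k x)
    fun p => ⟨⊤, trivial, _, h₂ _ _, rfl⟩).ker (fun T' _ => fstMap E T')
    (fun k _ x => fstMap_res k x) fun p => ⟨⊤, trivial, _, ⟨h₁ _ _, rfl⟩, rfl⟩
  refine
    { res_mem := fun k h x hx => ?_
      mem_of_locally_mem := fun h x hx => ?_
      exists_frame := fun p => ?_ }
  · rw [Submodule.mem_comap, ← midIncl_res]
    exact hN.res_mem k h _ hx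
  · refine hN.mem_of_locally_mem h _ fun p => ?_
    obtain ⟨V, hp, hV⟩ := hx p
    refine ⟨V, hp, ?_⟩
    rw [midIncl_res]
    exact hV
  · obtain ⟨V, hp, b, hb⟩ := hK.exists_frame p
    have hbw : ∀ i, b i = midIncl E _ (hyp.mid (b i)) := fun i =>
      eq_midIncl (hb.mem i).1.2 (hb.mem i).2
    obtain ⟨w, rfl⟩ : ∃ w : Fin m → E.obj _, b = fun i => midIncl E _ (w i) :=
      ⟨fun i => hyp.mid (b i), funext hbw⟩
    have hsum : ∀ (T' : Over S) (k : T' ⟶ openOver T V) (a : Fin m → Γ(T'.left, ⊤)),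
        ∑ i, a i • E.hyp.res k (midIncl E _ (w i)) = midIncl E _ (∑ i, a i • E.res k (w i)) := by
      intro T' k a
      rw [map_sum]
      exact Finset.sum_congr rfl fun i _ => by rw [map_smul, midIncl_res]
    refine ⟨V, hp, w, IsFrame.of_coord (fun T' k i => ?_) (fun T' k x hx => ?_)
      fun T' k a ha => hb.coord_eq_zero k ?_⟩
    · rw [Submodule.mem_comap, ← midIncl_res]
      exact (hb.res_mem k i).1.1
    · obtain ⟨a, ha⟩ := hb.exists_coord (k := k) (x := midIncl E _ x) ⟨⟨hx, rfl⟩, rfl⟩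
      rw [hsum] at ha
      exact ⟨a, midIncl_injective _ ha⟩
    · rw [hsum, ha, map_zero]

end Mid

/-- The symplectic subbundle `W` of `E` for a symplectic subbundle of `𝒪 ⊕ E ⊕ 𝒪` of the form
`𝒪 ⊕ W ⊕ 𝒪`. -/
def SympSubbundle.mid {k : ℕ} (U : SympSubbundle φ.hyp k T) (hk : k = m + 2)
    (h₁ : ∀ (T' : Over S) (h : T' ⟶ T), hyp.mk 1 0 0 ∈ U.sec h)
    (h₂ : ∀ (T' : Over S) (h : T' ⟶ T), hyp.mk 0 0 1 ∈ U.sec h) : SympSubbundle φ m T :=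
  SympSubbundle.ofUnimodular (fun T' h => (U.sec h).comap (midIncl E T'))
    (U.isSubbundle.comap_midIncl hk h₁ h₂)
    fun T' h hT' => by
      have := U.unimodularOn h hT'
      rw [← ofHyp_comap_midIncl (h₁ T' h) (h₂ T' h)] at this
      exact unimodularOn_hypBilin_iff.mp this

end ModulePresheaf

/-! ### The projection to the smaller Grassmannian -/

namespace ModulePresheaf

variable {S : Scheme.{u}} {E : ModulePresheaf S} {φ : E.AltForm} {m : ℕ}

section Pair

variable {T : Over S} {e f : E.hyp.obj T}

/-- The condition `ψ(e, f) = 1` determines the first component of `e`: with `u` and `v` the middle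
components of `e` and `f`, it says that `e = (1 - φ(u, v), u, 0)`. -/
lemma fst_eq_of_pair (hlf : hyp.lam f = 1) (hle : hyp.lam e = 0) (hef : φ.hyp.form T e f = 1) :
    e = hyp.mk (1 - φ.form T (hyp.mid e) (hyp.mid f)) (hyp.mid e) 0 := by
  refine Prod.ext ?_ (Prod.ext rfl hle)
  have h : e.1 * hyp.lam f + φ.form T (hyp.mid e) (hyp.mid f) - hyp.lam e * f.1 = 1 := hef
  rw [hlf, hle] at h
  change e.1 = 1 - φ.form T (hyp.mid e) (hyp.mid f)
  linear_combination h

/-- The symplectic automorphism `ρ` attached to a hyperbolic pair. -/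
def rhoPair (φ : E.AltForm) (e f : E.hyp.obj T) : SympAut φ.hyp T :=
  rho φ (hyp.mid e) (hyp.mid f) (hyp.fst f)

lemma hyp_res_mk {T' : Over S} (h : T' ⟶ T) (a : Γ(T.left, ⊤)) (w : E.obj T) (c : Γ(T.left, ⊤)) :
    E.hyp.res h (hyp.mk a w c) =
      hyp.mk (h.left.appTop.hom a) (E.res h w) (h.left.appTop.hom c) := rfl

lemma rhoPair_app_one_zero_zero (hlf : hyp.lam f = 1) (hle : hyp.lam e = 0)
    (hef : φ.hyp.form T e f = 1) {T' : Over S} (h : T' ⟶ T) :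
    (rhoPair φ e f).app h (hyp.mk 1 0 0) = E.hyp.res h e := by
  conv_rhs => rw [fst_eq_of_pair hlf hle hef]
  rw [rhoPair, rho_app_one_zero_zero, hyp_res_mk, map_sub, map_one, map_zero]

lemma rhoPair_app_zero_zero_one (hlf : hyp.lam f = 1) {T' : Over S} (h : T' ⟶ T) :
    (rhoPair φ e f).app h (hyp.mk 0 0 1) = E.hyp.res h f := by
  rw [rhoPair, rho_app_zero_zero_one]
  exact Prod.ext rfl (Prod.ext rfl
    (((congrArg h.left.appTop.hom hlf).trans (map_one _)).symm))

variable {H : Over S} {k : ℕ}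

/-- A symplectic bundle that contains a hyperbolic pair is the image of `𝒪 ⊕ W ⊕ 𝒪` under the
automorphism `ρ` attached to this pair. -/
lemma SympSubbundle.exists_eq_map_ofHyp (U : SympSubbundle φ.hyp k H) (hk : k = m + 2) (g : T ⟶ H)
    (he : e ∈ U.sec g) (hf : f ∈ U.sec g) (hlf : hyp.lam f = 1) (hle : hyp.lam e = 0)
    (hef : φ.hyp.form T e f = 1) : ∃ W : SympSubbundle φ m T, ∀ (T' : Over S) (h : T' ⟶ T),
      U.sec (h ≫ g) = (hyp.ofHyp (W.sec h)).map ((rhoPair φ e f).app h).toLinearMap := by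
  have h₁ : ∀ (T' : Over S) (h : T' ⟶ T),
      hyp.mk 1 0 0 ∈ ((U.pullback g).map (rhoPair φ e f).symm).sec h := fun T' h =>
    ⟨E.hyp.res h e, U.res_mem h g e he, by
      rw [← rhoPair_app_one_zero_zero hlf hle hef]
      exact LinearEquiv.symm_apply_apply _ _⟩
  have h₂ : ∀ (T' : Over S) (h : T' ⟶ T),
      hyp.mk 0 0 1 ∈ ((U.pullback g).map (rhoPair φ e f).symm).sec h := fun T' h =>
    ⟨E.hyp.res h f, U.res_mem h g f hf, by
      rw [← rhoPair_app_zero_zero_one (φ := φ) (e := e) hlf]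
      exact LinearEquiv.symm_apply_apply _ _⟩
  refine ⟨((U.pullback g).map (rhoPair φ e f).symm).mid hk h₁ h₂, fun T' h => ?_⟩
  have h3 : hyp.ofHyp ((((U.pullback g).map (rhoPair φ e f).symm).mid hk h₁ h₂).sec h) =
      ((U.pullback g).map (rhoPair φ e f).symm).sec h := ofHyp_comap_midIncl (h₁ T' h) (h₂ T' h)
  rw [h3]
  ext x
  constructor
  · intro hx
    exact ⟨_, ⟨x, hx, rfl⟩, LinearEquiv.apply_symm_apply _ _⟩
  · rintro ⟨_, ⟨y, hy, rfl⟩, rfl⟩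
    have h4 : (rhoPair φ e f).app h ((rhoPair φ e f).symm.app h y) = y :=
      LinearEquiv.apply_symm_apply _ _
    have h5 : y ∈ U.sec (h ≫ g) := hy
    exact h4.symm ▸ h5

/-- The plane `⟨e, f⟩` spanned by a hyperbolic pair. -/
noncomputable def pairPlane
    (hE : Presieve.IsSheaf (Scheme.zariskiTopology.{u}.over S) E.hyp.toPresheaf)
    (hef : φ.hyp.form T e f = 1) : SympSubbundle φ.hyp 2 T :=
  SympSubbundle.ofFrame hE ![e, f] (by
    have h : (gram φ.hyp ![e, f]).det = 1 := by
      rw [Matrix.det_fin_two]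
      change φ.hyp.form T e e * φ.hyp.form T f f - φ.hyp.form T e f * φ.hyp.form T f e = 1
      rw [φ.hyp.form_swap f e, φ.hyp.alt, hef]
      ring
    exact h ▸ isUnit_one)

lemma pairPlane_sec (hE : Presieve.IsSheaf (Scheme.zariskiTopology.{u}.over S) E.hyp.toPresheaf)
    (hef : φ.hyp.form T e f = 1) {T' : Over S} (h : T' ⟶ T) : (pairPlane hE hef).sec h =
      Submodule.span Γ(T'.left, ⊤) {E.hyp.res h e, E.hyp.res h f} := by
  refine congrArg (Submodule.span Γ(T'.left, ⊤)) ?_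
  ext x
  simp [eq_comm]

/-- The orthogonal decomposition `𝒪 ⊕ W ⊕ 𝒪 = ⟨(1, 0, 0), (0, 0, 1)⟩ ⊥ W`, transported
along `ρ`. -/
lemma isOrthogonalSum_rhoPair
    (hE : Presieve.IsSheaf (Scheme.zariskiTopology.{u}.over S) E.hyp.toPresheaf)
    (U : SympSubbundle φ.hyp k H) (g : T ⟶ H) (W : SympSubbundle φ m T) {k' : ℕ} (hk' : k' = m)
    (hlf : hyp.lam f = 1) (hle : hyp.lam e = 0) (hef : φ.hyp.form T e f = 1)
    (hU : ∀ (T' : Over S) (h : T' ⟶ T),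
      U.sec (h ≫ g) = (hyp.ofHyp (W.sec h)).map ((rhoPair φ e f).app h).toLinearMap) :
    U.IsOrthogonalSum g (pairPlane hE hef) ((W.ofMid hk').map (rhoPair φ e f)) := by
  intro T' h
  rw [hU, pairPlane_sec, ← rhoPair_app_one_zero_zero hlf hle hef,
    ← rhoPair_app_zero_zero_one (φ := φ) (e := e) hlf]
  change _ ⊔ Submodule.map _ (hyp.ofMid (W.sec h)) = _ ∧ Disjoint _
    (Submodule.map _ (hyp.ofMid (W.sec h))) ∧
      ∀ x ∈ _, ∀ y ∈ Submodule.map _ (hyp.ofMid (W.sec h)), _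
  have hspan : Submodule.span Γ(T'.left, ⊤) {(rhoPair φ e f).app h (hyp.mk 1 0 0),
      (rhoPair φ e f).app h (hyp.mk 0 0 1)} = (Submodule.span Γ(T'.left, ⊤)
      {(hyp.mk 1 0 0 : E.hyp.obj T'), hyp.mk 0 0 1}).map ((rhoPair φ e f).app h).toLinearMap := by
    rw [Submodule.map_span, Set.image_pair]
    rfl
  rw [hspan]
  refine ⟨?_, ?_, ?_⟩
  · rw [← Submodule.map_sup]
    congr 1
    refine le_antisymm (sup_le (Submodule.span_le.mpr ?_) fun x hx => ⟨trivial, hx.2.1, trivial⟩)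
      fun x hx => ?_
    · rintro _ (rfl | rfl)
      · exact ⟨trivial, zero_mem _, trivial⟩
      · exact ⟨trivial, zero_mem _, trivial⟩
    · rw [eq_combination x]
      refine add_mem (add_mem ?_ ?_) ?_
      · exact Submodule.smul_mem _ _ (Submodule.mem_sup_left (Submodule.subset_span (Or.inl rfl)))
      · exact Submodule.mem_sup_right ⟨rfl, hx.2.1, rfl⟩
      · exact Submodule.smul_mem _ _ (Submodule.mem_sup_left (Submodule.subset_span (Or.inr rfl)))
  · rw [Submodule.disjoint_def]
    rintro _ ⟨x, hx, rfl⟩ ⟨y, hy, hxy⟩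
    obtain rfl : y = x := ((rhoPair φ e f).app h).injective hxy
    obtain ⟨a, c, rfl⟩ := Submodule.mem_span_pair.mp hx
    have ha : a * 1 + c * 0 = 0 := hy.1
    have hc : a * 0 + c * 1 = 0 := hy.2.2
    rw [show a = 0 by linear_combination ha, show c = 0 by linear_combination hc, zero_smul,
      zero_smul, add_zero]
    exact map_zero _
  · rintro _ ⟨x, hx, rfl⟩ _ ⟨y, hy, rfl⟩
    obtain ⟨a, c, rfl⟩ := Submodule.mem_span_pair.mp hx
    refine ((rhoPair φ e f).form_app h _ _).trans ?_
    have hy1 : y.1 = 0 := hy.1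
    have hy2 : y.2.2 = 0 := hy.2.2
    change (a * 1 + c * 0) * y.2.2 + φ.form T' (a • 0 + c • 0) y.2.1 - (a * 0 + c * 1) * y.1 = 0
    rw [hy1, hy2]
    simp

end Pair

variable {k N : ℕ}

/-- The pullback of a vector bundle to `T`, as a subbundle of itself. -/
lemma IsVectorBundle.isSubbundle_top {M : ModulePresheaf S} (hM : M.IsVectorBundle N) (T : Over S) :
    IsSubbundle (E := M) (T := T) (fun _ _ => ⊤) N where
  res_mem _ _ _ _ := trivial
  mem_of_locally_mem _ _ _ := trivial
  exists_frame p := by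
    obtain ⟨V, hp, b, hb⟩ := hM.exists_frame (T.hom p)
    obtain ⟨s⟩ := nonempty_hom_mk_ι (V := V) (T := openOver T (T.hom ⁻¹ᵁ V)) fun x => by
      rw [← hom_left_apply (openIncl T (T.hom ⁻¹ᵁ V))]
      exact openIncl_left_mem x
    exact ⟨T.hom ⁻¹ᵁ V, hp, _, IsFrame.res (N := fun _ _ => ⊤) (fun _ => hb) s⟩

/-- The automorphism `ρ` is compatible with pullback. -/
lemma rho_app_comp {T' T Z : Over S} (h : Z ⟶ T) (l : T' ⟶ Z) (u v : E.obj T) (b : Γ(T.left, ⊤))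
    (x : E.hyp.obj T') : (rho φ u v b).app (l ≫ h) x =
      (rho φ (E.res h u) (E.res h v) (h.left.appTop.hom b)).app l x := by
  rw [rho_app, rho_app, E.res_comp, E.res_comp, appTop_comp_apply]

/-- `P` classifies the symplectic subbundles of rank `m`, with tautological subbundle `U`. -/
def Classifies (φ : E.AltForm) {P : Over S} (U : SympSubbundle φ m P) : Prop :=
  ∀ (T : Over S) (W : SympSubbundle φ m T), ∃! h : T ⟶ P,
    ∀ {T' : Over S} (k : T' ⟶ T), W.sec k = U.sec (k ≫ h)

lemma Classifies.hom_ext {P : Over S} {U : SympSubbundle φ m P} (hU : Classifies φ U) {T : Over S}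
    {h h' : T ⟶ P} (hh : ∀ (T' : Over S) (k : T' ⟶ T), U.sec (k ≫ h) = U.sec (k ≫ h')) : h = h' :=
  (hU T (U.pullback h)).unique (fun _ => rfl) fun k => hh _ k

/-- A point of `Y₂` amounts to a point of the smaller Grassmannian and the coordinates `u`, `v`, `b`
of the sections `e = (1 - φ(u, v), u, 0)` and `f = (b, v, 1)`: the bundle classified by the point
of `Y₂` is recovered as `ρ(𝒪 ⊕ W ⊕ 𝒪)`. So `q` is a trivial torsor under `E ⊕ E ⊕ 𝒪`. -/
theorem isAffineBundle_of_pair (hE : E.IsVectorBundle N) {HF HE : Over S}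
    {UF : SympSubbundle φ.hyp k HF} (hHF : Classifies φ.hyp UF) {UE : SympSubbundle φ m HE}
    (hHE : Classifies φ UE) (hk : k = m + 2) {Y : HF.left.Opens}
    (hY : (Y : Set HF.left) = (Nplus UF)ᶜ) {Y₂ : Over S} (g : Y₂ ⟶ openOver HF Y)
    {e f : E.hyp.obj Y₂} (hlf : hyp.lam f = 1) (hle : hyp.lam e = 0) (hef : φ.hyp.form Y₂ e f = 1)
    (hY₂ : ∀ (T : Over S) (g' : T ⟶ openOver HF Y) (e' f' : E.hyp.obj T),
      e' ∈ UF.sec (g' ≫ openIncl HF Y) → f' ∈ UF.sec (g' ≫ openIncl HF Y) →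
      hyp.lam f' = 1 → hyp.lam e' = 0 → φ.hyp.form T e' f' = 1 →
      ∃! k : T ⟶ Y₂, k ≫ g = g' ∧ E.hyp.res k e = e' ∧ E.hyp.res k f = f')
    (q : Y₂ ⟶ HE) (hq : ∀ (T : Over S) (h : T ⟶ Y₂), UF.sec (h ≫ g ≫ openIncl HF Y) =
      (hyp.ofHyp (UE.sec (h ≫ q))).map ((rhoPair φ e f).app h).toLinearMap) :
    IsAffineBundle q.left (N + (N + 1)) := by
  have hM := isVectorBundle_prod hE (isVectorBundle_prod hE (isVectorBundle_unit S))
  have hC : IsCoset (M := E.prod (E.prod (unit S))) (T := HE) (fun _ _ => ⊤)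
      (fun _ _ => Set.univ) :=
    { res_mem := fun _ _ _ _ => trivial
      mem_of_locally_mem := fun _ _ _ => trivial
      sub_mem := fun _ _ _ _ _ => trivial
      add_mem := fun _ _ _ _ _ => trivial
      exists_local := fun _ => ⟨⊤, trivial, 0, trivial⟩ }
  refine hC.isAffineBundle (hM.isSubbundle_top HE) hM.isSheaf q (hyp.mid e, hyp.mid f, hyp.fst f)
    trivial fun Z h y _ => ?_
  obtain ⟨u, v, (b : Γ(Z.left, ⊤))⟩ := y
  -- the point of `HF` that classifies the bundle `ρ(𝒪 ⊕ W ⊕ 𝒪)` over `Z`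
  let ρ := rho φ u v b
  let W := ((UE.pullback h).ofHyp hk).map ρ
  obtain ⟨w, hw, -⟩ := hHF Z W
  have hmem : ∀ x ∈ hyp.ofHyp (UE.sec (𝟙 Z ≫ h)), ρ.app (𝟙 Z) x ∈ UF.sec w := fun x hx => by
    have h1 := hw (𝟙 Z)
    rw [Category.id_comp] at h1
    rw [← h1]
    exact ⟨x, hx, rfl⟩
  have he' := hmem (hyp.mk 1 0 0) ⟨trivial, zero_mem _, trivial⟩
  have hf' := hmem (hyp.mk 0 0 1) ⟨trivial, zero_mem _, trivial⟩
  rw [rho_app_one_zero_zero, appTop_id_apply, E.res_id] at he'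
  rw [rho_app_zero_zero_one, appTop_id_apply, E.res_id] at hf'
  have hef' : φ.hyp.form Z (hyp.mk (1 - φ.form Z u v) u 0) (hyp.mk b v 1) = 1 := by
    change (1 - φ.form Z u v) * 1 + φ.form Z u v - 0 * b = 1
    ring
  -- it lies in `Y`, since the bundle contains `f = (b, v, 1)`
  obtain ⟨w', rfl⟩ := exists_lift_openIncl Y w fun t => by
    change w.left t ∈ (Y : Set HF.left)
    rw [hY]
    exact notMem_Nplus_of_isUnit UF w hf' isUnit_one t
  obtain ⟨l, ⟨hl, hle', hlf'⟩, hlu⟩ := hY₂ Z w' _ _ he' hf' rfl rfl hef'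
  have hu : E.res l (hyp.mid e) = u := congrArg (fun x => hyp.mid x) hle'
  have hv : E.res l (hyp.mid f) = v := congrArg (fun x => hyp.mid x) hlf'
  have hb : l.left.appTop.hom (hyp.fst f) = b := congrArg (fun x => hyp.fst x) hlf'
  -- `ρ(𝒪 ⊕ W ⊕ 𝒪)` determines `W`, as `ρ` is injective
  refine ⟨l, ⟨hHE.hom_ext fun T' t => ?_, Prod.ext hu (Prod.ext hv hb)⟩, ?_⟩
  · have h1 := hw t
    rw [← hl, Category.assoc, ← Category.assoc, hq] at h1
    have h2 : ((rhoPair φ e f).app (t ≫ l)) = ρ.app t := LinearEquiv.ext fun x => by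
      rw [rhoPair, rho_app_comp, hu, hv, hb]
    rw [h2] at h1
    have h3 : hyp.ofHyp (UE.sec (t ≫ h)) = hyp.ofHyp (UE.sec ((t ≫ l) ≫ q)) :=
      Submodule.map_injective_of_injective (ρ.app t).injective h1
    have h4 : ∀ x, x ∈ UE.sec (t ≫ h) ↔ x ∈ UE.sec ((t ≫ l) ≫ q) := fun x => by
      have : ∀ A : Submodule Γ(T'.left, ⊤) (E.obj T'), midIncl E T' x ∈ hyp.ofHyp A ↔ x ∈ A :=
        fun A => ⟨fun hx => hx.2.1, fun hx => ⟨trivial, hx, trivial⟩⟩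
      rw [← this, h3, this]
    rw [← Category.assoc]
    exact (Submodule.ext h4).symm
  · rintro l' ⟨hl', hx⟩
    have hu' : E.res l' (hyp.mid e) = u := congrArg Prod.fst hx
    have hv' : E.res l' (hyp.mid f) = v := congrArg (fun x => x.2.1) hx
    have hb' : l'.left.appTop.hom (hyp.fst f) = b := congrArg (fun x => x.2.2) hx
    have he₂ : E.hyp.res l' e = hyp.mk (1 - φ.form Z u v) u 0 := by
      rw [fst_eq_of_pair hlf hle hef, hyp_res_mk, map_sub, map_one, map_zero, ← φ.res_form, hu',
        hv']
    have hf₂ : E.hyp.res l' f = hyp.mk b v 1 := Prod.ext hb' (Prod.ext hv'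
      ((congrArg l'.left.appTop.hom hlf).trans (map_one _)))
    refine hlu l' ⟨?_, he₂, hf₂⟩
    rw [← cancel_mono (openIncl HF Y), Category.assoc]
    refine hHF.hom_ext fun T' t => ?_
    rw [← hw t, ← Category.assoc, hq]
    have h2 : ((rhoPair φ e f).app (t ≫ l')) = ρ.app t := LinearEquiv.ext fun x => by
      rw [rhoPair, rho_app_comp, hu', hv', hb']
    rw [h2, Category.assoc, hl']
    rfl

end ModulePresheaf

end SympGrass

open SympGrass SympGrass.ModulePresheaf in
theorem mainTheorem6 (S : Scheme.{u}) (n r : ℕ) (hr : 1 ≤ r) (hrn : r ≤ n)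
    (E : ModulePresheaf S) (hE : E.IsVectorBundle (2 * n - 2))
    (φ : E.AltForm) (hφ : φ.IsSymplectic) :
    -- `HGr_S(r, F, ψ)` and `HGr_S(r - 1, E, φ)` exist
    (∃ (HF : Over S) (UF : SympSubbundle φ.hyp (2 * r) HF), IsHGr φ.hyp r HF UF) ∧
    (∃ (HE : Over S) (UE : SympSubbundle φ (2 * (r - 1)) HE), IsHGr φ (r - 1) HE UE) ∧
    ∀ (HF : Over S) (UF : SympSubbundle φ.hyp (2 * r) HF) (_ : IsHGr φ.hyp r HF UF)
      (HE : Over S) (UE : SympSubbundle φ (2 * (r - 1)) HE) (_ : IsHGr φ (r - 1) HE UE),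
    -- the open subscheme `Y`, the complement of `N⁺`
    ∃ Y : HF.left.Opens, (Y : Set HF.left) = (Nplus UF)ᶜ ∧
    -- the three affine bundles
    ∃ (Y₁ Y₂ : Over S) (g₁ : Y₁ ⟶ openOver HF Y) (g₂ : Y₂ ⟶ Y₁) (q : Y₂ ⟶ HE),
      IsAffineBundle g₁.left (2 * r - 1) ∧
      IsAffineBundle g₂.left (2 * r - 2) ∧
      IsAffineBundle q.left (4 * n - 3) ∧
    -- the tautological section `f` over `Y₁`
    ∃ f₁ : E.hyp.obj Y₁, f₁ ∈ UF.sec (g₁ ≫ openIncl HF Y) ∧ hyp.lam f₁ = 1 ∧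
      (∀ (T : Over S) (g : T ⟶ openOver HF Y) (f' : E.hyp.obj T),
        f' ∈ UF.sec (g ≫ openIncl HF Y) → hyp.lam f' = 1 →
        ∃! k : T ⟶ Y₁, k ≫ g₁ = g ∧ E.hyp.res k f₁ = f') ∧
    -- the tautological sections `e` and `f` over `Y₂`
    ∃ e f : E.hyp.obj Y₂, f = E.hyp.res g₂ f₁ ∧
      e ∈ UF.sec (g₂ ≫ g₁ ≫ openIncl HF Y) ∧ f ∈ UF.sec (g₂ ≫ g₁ ≫ openIncl HF Y) ∧
      hyp.lam f = 1 ∧ hyp.lam e = 0 ∧ φ.hyp.form Y₂ e f = 1 ∧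
      (∀ (T : Over S) (g : T ⟶ openOver HF Y) (e' f' : E.hyp.obj T),
        e' ∈ UF.sec (g ≫ openIncl HF Y) → f' ∈ UF.sec (g ≫ openIncl HF Y) →
        hyp.lam f' = 1 → hyp.lam e' = 0 → φ.hyp.form T e' f' = 1 →
        ∃! k : T ⟶ Y₂, k ≫ g₂ ≫ g₁ = g ∧ E.hyp.res k e = e' ∧ E.hyp.res k f = f') ∧
    -- the symplectic automorphism `ρ = ρ₊(v, b) ρ₋(u, 0)` for `e = (1 - φ(u, v), u, 0)`
    -- and `f = (b, v, 1)`
    ∃ ρ : SympAut φ.hyp Y₂,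
      (∀ (T : Over S) (h : T ⟶ Y₂) (x : E.hyp.obj T), ρ.app h x =
        rhoPlus φ (E.res h (hyp.mid f)) (h.left.appTop.hom (hyp.fst f))
          (rhoMinus φ (E.res h (hyp.mid e)) 0 x)) ∧
      ρ.app (𝟙 Y₂) (hyp.mk 1 0 0) = e ∧ ρ.app (𝟙 Y₂) (hyp.mk 0 0 1) = f ∧
    -- the orthogonal direct sum of the symplectic subbundles `⟨e, f⟩` and `ρ(q^* U_{r-1})`
    (∃ (A : SympSubbundle φ.hyp 2 Y₂) (B : SympSubbundle φ.hyp (2 * r - 2) Y₂),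
      (∀ (T : Over S) (h : T ⟶ Y₂),
        A.sec h = Submodule.span Γ(T.left, ⊤) {E.hyp.res h e, E.hyp.res h f} ∧
        B.sec h = (hyp.ofMid (UE.sec (h ≫ q))).map (ρ.app h).toLinearMap) ∧
      UF.IsOrthogonalSum (g₂ ≫ g₁ ≫ openIncl HF Y) A B) ∧
    -- equivalently, `ρ` maps `𝒪 ⊕ q^* U_{r-1} ⊕ 𝒪` isometrically onto the tautological bundle
    (∀ (T : Over S) (h : T ⟶ Y₂), UF.sec (h ≫ g₂ ≫ g₁ ≫ openIncl HF Y) =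
      (hyp.ofHyp (UE.sec (h ≫ q))).map (ρ.app h).toLinearMap) := by
  have hsheaf := (isVectorBundle_hyp hE).isSheaf
  refine ⟨exists_isHGr (isVectorBundle_hyp hE) hφ.hyp r, exists_isHGr hE hφ (r - 1), ?_⟩
  intro HF UF hHF HE UE hHE
  have hk : 2 * r = 2 * (r - 1) + 1 + 1 := by omega
  let Y : HF.left.Opens := ⟨(Nplus UF)ᶜ, isOpen_compl_Nplus UF⟩
  obtain ⟨Y₁, Y₂, g₁, g₂, hg₁, hg₂, f₁, hf₁, hlf₁, hY₁, e, f, hff₁, he, hf, hlf, hle, hef, hY₂⟩ :=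
    exists_pairBundles hsheaf hk UF Y rfl
  -- the symplectic subbundle `W` of `E` with `U_r = ρ(𝒪 ⊕ W ⊕ 𝒪)` defines the morphism `q`
  obtain ⟨W, hW⟩ := UF.exists_eq_map_ofHyp hk (g₂ ≫ g₁ ≫ openIncl HF Y) he hf hlf hle hef
  obtain ⟨q, hq, -⟩ := hHE Y₂ W
  have hUF : ∀ (T : Over S) (h : T ⟶ Y₂), UF.sec (h ≫ g₂ ≫ g₁ ≫ openIncl HF Y) =
      (hyp.ofHyp (UE.sec (h ≫ q))).map ((rhoPair φ e f).app h).toLinearMap := fun T h => by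
    rw [hW, hq]
  refine ⟨Y, rfl, Y₁, Y₂, g₁, g₂, q, ?_, ?_, ?_, f₁, hf₁, hlf₁, hY₁, e, f, hff₁, he, hf, hlf, hle,
    hef, hY₂, rhoPair φ e f, fun T h x => rfl, ?_, ?_, ?_, hUF⟩
  · rwa [show 2 * r - 1 = 2 * (r - 1) + 1 by omega]
  · rwa [show 2 * r - 2 = 2 * (r - 1) by omega]
  · rw [show 4 * n - 3 = 2 * n - 2 + (2 * n - 2 + 1) by omega]
    refine isAffineBundle_of_pair hE hHF hHE hk (Y := Y) rfl (g₂ ≫ g₁) hlf hle hef hY₂ q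
      fun T h => ?_
    rw [Category.assoc]
    exact hUF T h
  · rw [rhoPair_app_one_zero_zero hlf hle hef, E.hyp.res_id]
  · rw [rhoPair_app_zero_zero_one hlf, E.hyp.res_id]
  · refine ⟨pairPlane hsheaf hef, ((UE.pullback q).ofMid (by omega)).map (rhoPair φ e f),
      fun T h => ⟨pairPlane_sec hsheaf hef h, rfl⟩, ?_⟩
    exact isOrthogonalSum_rhoPair hsheaf UF _ (UE.pullback q) _ hlf hle hef hUF
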